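/- Let $n\ge 1$ and let $D(GL_n)=GL_n\times GL_n$ (over $\mathbb C$) with coordinates $(X,Y)$, $X=(x_{ij})$, $Y=(y_{ij})$. For a matrix $A$ write $A_I^J$ for the submatrix with rows $I$ and columns $J$, $A^J$ (resp. $A_I$) if all rows (resp. columns) are taken, and $[a,b]=\{a,a+1,\dots,b\}$. For a rational function $f$ of $(X,Y)$ put $\nabla_X f=(\partial f/\partial x_{ji})_{i,j}$, $\nabla_Y f=(\partial f/\partial y_{ji})_{i,j}$, $E_Rf=X\nabla_Xf+Y\nabla_Yf$, $E_Lf=\nabla_Xf\cdot X+\nabla_Yf\cdot Y$. Let $\langle A,B\rangle=\operatorname{tr}(AB)$ and $R_+=\frac12(\pi_{>0}-\pi_{<0}+\mathrm{Id})$, where $\pi_{>0},\pi_{<0}$ are the projections onto strictly upper and strictly lower triangular matrices. The standard Poisson–Lie bracket on $D(GL_n)$ is $$\{f_1,f_2\}_D=\langle R_+(E_Lf_1),E_Lf_2\rangle-\langle R_+(E_Rf_1),E_Rf_2\rangle+\langle E_Rf_1,Y\nabla_Yf_2\rangle-\langle E_Lf_1,\nabla_Yf_2\cdot Y\rangle .$$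 With $U=X^{-1}Y$ define $$g_{ij}=\det X_{[i,n]}^{[j,j+n-i]}\ (1\le j\le i\le n),\qquad h_{ij}=\det Y_{[i,i+n-j]}^{[j,n]}\ (1\le i\le j\le n),$$ $$f_{kl}=\det\bigl[X^{[n-k+1,n]}\ \ Y^{[n-l+1,n]}\bigr]_{[n-k-l+1,n]}\ (k,l\ge1,\ k+l\le n-1),$$ $$\varphi_{kl}=s_{kl}(\det X)^{n-k-l+1}\det\bigl[(U^0)^{[n-k+1,n]}\ \ U^{[n-l+1,n]}\ \ (U^2)^{\{n\}}\ \cdots\ (U^{n-k-l+1})^{\{n\}}\bigr]\ (k,l\ge1,\ k+l\le n),$$ where $s_{kl}=(-1)^{k(l+1)}$ for $n$ even and $s_{kl}=(-1)^{(n-1)/2+k(k-1)/2+l(l-1)/2}$ for $n$ odd, and define $c_1,\dots,c_{n-1}$ by $\det(X+\lambda Y)=\sum_{i=0}^n(-1)^{i(n-1)}c_i\lambda^i$. Theorem. The $2n^2$ functions $F_n=\{g_{ij},h_{ij},f_{kl},\varphi_{kl},c_1,\dots,c_{n-1}\}$ form a log-canonical coordinate system on $D(GL_n)$ with respect to $\{\cdot,\cdot\}_D$.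 That is: they are algebraically independent over $\mathbb C$ and generate the field of rational functions $\mathbb C(D(GL_n))$; and for any two of them, $p$ and $q$, one has $\{p,q\}_D=\omega_{pq}\,p\,q$ with a constant $\omega_{pq}\in\frac12\mathbb Z$. -/

import Mathlib

noncomputable section

namespace DrinfeldDouble

open Matrix

/-- The coordinates on `GL_n × GL_n`: `Sum.inl (i, j)` stands for `x_{ij}`, `Sum.inr (i, j)` for
`y_{ij}`. -/
abbrev Coord (n : ℕ) : Type := (Fin n × Fin n) ⊕ (Fin n × Fin n)

/-- The ring `ℂ[x_{ij}, y_{ij}]`. -/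
abbrev PolyRing (n : ℕ) : Type := MvPolynomial (Coord n) ℂ

/-- The field `ℂ(D(GL_n))` of rational functions on the double `D(GL_n) = GL_n × GL_n`, an open
dense subset of the affine space with coordinates `x_{ij}, y_{ij}`. -/
abbrev RatFun (n : ℕ) : Type := FractionRing (PolyRing n)

variable {n : ℕ}

/-- A coordinate as a rational function. -/
def coordFun (v : Coord n) : RatFun n := algebraMap (PolyRing n) (RatFun n) (MvPolynomial.X v)

/-- The matrix `X = (x_{ij})` of coordinates on the first factor. -/
def matX (n : ℕ) : Matrix (Fin n) (Fin n) (RatFun n) := of fun i j => coordFun (Sum.inl (i, j))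

/-- The matrix `Y = (y_{ij})` of coordinates on the second factor. -/
def matY (n : ℕ) : Matrix (Fin n) (Fin n) (RatFun n) := of fun i j => coordFun (Sum.inr (i, j))

/-- `U = X⁻¹ Y` (the generic matrix `X` is invertible, see `isUnit_det_matX`). -/
def matU (n : ℕ) : Matrix (Fin n) (Fin n) (RatFun n) := (matX n)⁻¹ * matY n

theorem isUnit_det_matX (n : ℕ) : IsUnit (matX n).det := by
  have h : matX n = (algebraMap (PolyRing n) (RatFun n)).mapMatrix
      ((MvPolynomial.rename (Sum.inl : Fin n × Fin n → Coord n)).mapMatrix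
        (Matrix.mvPolynomialX (Fin n) (Fin n) ℂ)) := by
    ext i j
    simp [matX, coordFun, Matrix.mvPolynomialX]
  rw [h, ← RingHom.map_det, ← AlgHom.map_det, isUnit_iff_ne_zero, Ne,
    FaithfulSMul.algebraMap_eq_zero_iff]
  intro h0
  rw [← map_zero (MvPolynomial.rename (R := ℂ) (Sum.inl : Fin n × Fin n → Coord n))] at h0
  exact Matrix.det_mvPolynomialX_ne_zero (Fin n) ℂ
    (MvPolynomial.rename_injective _ Sum.inl_injective h0)

/-! ### Partial derivatives of rational functions -/

/-- The Taylor expansion `f ↦ f + ε ∂f/∂v` of polynomials. -/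
def taylorPoly (v : Coord n) : PolyRing n →ₐ[ℂ] TrivSqZeroExt (RatFun n) (RatFun n) :=
  MvPolynomial.aeval fun w =>
    TrivSqZeroExt.inl (coordFun w) + TrivSqZeroExt.inr (if w = v then 1 else 0)

theorem fst_taylorPoly (v : Coord n) (f : PolyRing n) :
    (taylorPoly v f).fst = algebraMap (PolyRing n) (RatFun n) f := by
  have h : (TrivSqZeroExt.fstHom ℂ (RatFun n) (RatFun n)).comp (taylorPoly v) =
      IsScalarTower.toAlgHom ℂ (PolyRing n) (RatFun n) := by
    apply MvPolynomial.algHom_ext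
    intro w
    by_cases hw : w = v <;> simp [taylorPoly, coordFun, hw]
  exact DFunLike.congr_fun h f

theorem isUnit_taylorPoly (v : Coord n) (s : nonZeroDivisors (PolyRing n)) :
    IsUnit (taylorPoly v (s : PolyRing n)) := by
  rw [TrivSqZeroExt.isUnit_iff_isUnit_fst, fst_taylorPoly]
  exact IsLocalization.map_units (RatFun n) s

/-- The Taylor expansion `f ↦ f + ε ∂f/∂v` of rational functions. -/
def taylor (v : Coord n) : RatFun n →ₐ[ℂ] TrivSqZeroExt (RatFun n) (RatFun n) :=
  IsLocalization.liftAlgHom (M := nonZeroDivisors (PolyRing n)) (f := taylorPoly v)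
    (isUnit_taylorPoly v)

theorem taylor_algebraMap (v : Coord n) (f : PolyRing n) :
    taylor v (algebraMap (PolyRing n) (RatFun n) f) = taylorPoly v f := by
  simp [taylor]

theorem fst_taylor (v : Coord n) (f : RatFun n) : (taylor v f).fst = f := by
  have h : (TrivSqZeroExt.fstHom ℂ (RatFun n) (RatFun n)).comp (taylor v) =
      AlgHom.id ℂ (RatFun n) := by
    apply IsLocalization.algHom_ext (nonZeroDivisors (PolyRing n))
    ext w
    change (taylor v (algebraMap (PolyRing n) (RatFun n) (MvPolynomial.X w))).fst =
      algebraMap (PolyRing n) (RatFun n) (MvPolynomial.X w)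
    rw [taylor_algebraMap, fst_taylorPoly]
  exact DFunLike.congr_fun h f

/-- The partial derivative `∂/∂v` of rational functions. -/
def partialDeriv (v : Coord n) : Derivation ℂ (RatFun n) (RatFun n) :=
  Derivation.mk' ((TrivSqZeroExt.sndHom (RatFun n) (RatFun n)).restrictScalars ℂ ∘ₗ
    (taylor v).toLinearMap) (by
      intro a b
      simp [fst_taylor, mul_comm])

theorem partialDeriv_coordFun (v w : Coord n) :
    partialDeriv v (coordFun w) = if w = v then 1 else 0 := by
  by_cases hw : w = v <;> simp [partialDeriv, coordFun, taylor_algebraMap, taylorPoly, hw]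

/-! ### The Poisson–Lie bracket on the double -/

/-- `∇_X f = (∂f/∂x_{ji})_{i,j}`. -/
def gradX (f : RatFun n) : Matrix (Fin n) (Fin n) (RatFun n) :=
  of fun i j => partialDeriv (Sum.inl (j, i)) f

/-- `∇_Y f = (∂f/∂y_{ji})_{i,j}`. -/
def gradY (f : RatFun n) : Matrix (Fin n) (Fin n) (RatFun n) :=
  of fun i j => partialDeriv (Sum.inr (j, i)) f

/-- `E_R f = X ∇_X f + Y ∇_Y f`. -/
def eR (f : RatFun n) : Matrix (Fin n) (Fin n) (RatFun n) := matX n * gradX f + matY n * gradY f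

/-- `E_L f = ∇_X f X + ∇_Y f Y`. -/
def eL (f : RatFun n) : Matrix (Fin n) (Fin n) (RatFun n) := gradX f * matX n + gradY f * matY n

/-- The projection `π_{>0}` onto strictly upper triangular matrices. -/
def projPos (A : Matrix (Fin n) (Fin n) (RatFun n)) : Matrix (Fin n) (Fin n) (RatFun n) :=
  of fun i j => if i < j then A i j else 0

/-- The projection `π_{<0}` onto strictly lower triangular matrices. -/
def projNeg (A : Matrix (Fin n) (Fin n) (RatFun n)) : Matrix (Fin n) (Fin n) (RatFun n) :=
  of fun i j => if j < i then A i j else 0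

/-- `R_+ = (R + Id) / 2` with `R = π_{>0} - π_{<0}`. -/
def rPlus (A : Matrix (Fin n) (Fin n) (RatFun n)) : Matrix (Fin n) (Fin n) (RatFun n) :=
  (1 / 2 : RatFun n) • (projPos A - projNeg A + A)

/-- The trace form `⟨A, B⟩ = tr (A B)`. -/
def traceForm (A B : Matrix (Fin n) (Fin n) (RatFun n)) : RatFun n := (A * B).trace

/-- The standard Poisson–Lie bracket on the double `D(GL_n)`. -/
def bracket (f₁ f₂ : RatFun n) : RatFun n :=
  traceForm (rPlus (eL f₁)) (eL f₂) - traceForm (rPlus (eR f₁)) (eR f₂)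
    + traceForm (eR f₁) (matY n * gradY f₂) - traceForm (eL f₁) (gradY f₂ * matY n)

/-! ### The family of functions

Rows and columns of matrices are numbered from `1` to `n` by natural numbers. -/

/-- The entry of `A` in row `i` and column `j`, with `1 ≤ i, j ≤ n`. The value `0` outside this
range is never used by the functions below. -/
def entry {K : Type*} [Zero K] (A : Matrix (Fin n) (Fin n) K) (i j : ℕ) : K :=
  if h : (1 ≤ i ∧ i ≤ n) ∧ (1 ≤ j ∧ j ≤ n) then
    A ⟨i - 1, by omega⟩ ⟨j - 1, by omega⟩
  else 0

/-- `g_{ij} = det X_{[i,n]}^{[j,j+n-i]}` (lower indices are rows), `1 ≤ j ≤ i ≤ n`. -/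
def gFun (n i j : ℕ) : RatFun n :=
  (of fun s t : Fin (n - i + 1) => entry (matX n) (i + s) (j + t)).det

/-- `h_{ij} = det Y_{[i,i+n-j]}^{[j,n]}`, `1 ≤ i ≤ j ≤ n`. -/
def hFun (n i j : ℕ) : RatFun n :=
  (of fun s t : Fin (n - j + 1) => entry (matY n) (i + s) (j + t)).det

/-- `f_{kl} = det [X^{[n-k+1,n]} Y^{[n-l+1,n]}]_{[n-k-l+1,n]}`, `k, l ≥ 1`, `k + l ≤ n - 1`. -/
def fFun (n k l : ℕ) : RatFun n :=
  (of fun s t : Fin (k + l) =>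
    if (t : ℕ) < k then entry (matX n) (n - k - l + 1 + s) (n - k + 1 + t)
    else entry (matY n) (n - k - l + 1 + s) (n - l + 1 + (t - k))).det

/-- The `n × n` matrix
`Φ_{kl} = [(U^0)^{[n-k+1,n]} U^{[n-l+1,n]} (U^2)^{[n]} ⋯ (U^{n-k-l+1})^{[n]}]`,
`k, l ≥ 1`, `k + l ≤ n`. -/
def matPhi (n k l : ℕ) : Matrix (Fin n) (Fin n) (RatFun n) :=
  of fun s t =>
    if (t : ℕ) < k then entry ((matU n) ^ 0) (s + 1) (n - k + 1 + t)
    else if (t : ℕ) < k + l then entry (matU n) (s + 1) (n - l + 1 + (t - k))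
    else entry ((matU n) ^ (t - (k + l) + 2)) (s + 1) n

/-- The sign `s_{kl}`. -/
def signPhi (n k l : ℕ) : ℤ :=
  if Even n then (-1) ^ (k * (l + 1))
  else (-1) ^ ((n - 1) / 2 + k * (k - 1) / 2 + l * (l - 1) / 2)

/-- `φ_{kl} = s_{kl} (det X)^{n-k-l+1} det Φ_{kl}`. -/
def phiFun (n k l : ℕ) : RatFun n :=
  (signPhi n k l : RatFun n) * (matX n).det ^ (n - k - l + 1) * (matPhi n k l).det

/-- `c_i`, defined by `det (X + λ Y) = ∑ λ^i s_i c_i` with `s_i = (-1)^{i(n-1)} = s_i⁻¹`. -/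
def cFun (n i : ℕ) : RatFun n :=
  (-1) ^ (i * (n - 1)) *
    ((matX n).map Polynomial.C +
      (Polynomial.X : Polynomial (RatFun n)) • (matY n).map Polynomial.C).det.coeff i

/-- The labels of the functions in the family `F_n`. -/
inductive Label (n : ℕ) : Type
  | g (i j : ℕ) (h : 1 ≤ j ∧ j ≤ i ∧ i ≤ n)
  | h (i j : ℕ) (h : 1 ≤ i ∧ i ≤ j ∧ j ≤ n)
  | f (k l : ℕ) (h : 1 ≤ k ∧ 1 ≤ l ∧ k + l + 1 ≤ n)
  | phi (k l : ℕ) (h : 1 ≤ k ∧ 1 ≤ l ∧ k + l ≤ n)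
  | c (i : ℕ) (h : 1 ≤ i ∧ i + 1 ≤ n)

/-- The family `F_n = {g_{ij}, h_{ij}, f_{kl}, φ_{kl}, c_1, …, c_{n-1}}`. -/
def family (n : ℕ) : Label n → RatFun n
  | .g i j _ => gFun n i j
  | .h i j _ => hFun n i j
  | .f k l _ => fFun n k l
  | .phi k l _ => phiFun n k l
  | .c i _ => cFun n i

end DrinfeldDouble

end

set_option linter.unusedSectionVars false

namespace DrinfeldDouble
open Matrix

/-! ### Derivatives of determinants. -/

section DerivationMatrix

variable {R A : Type*} [CommRing R] [CommRing A] [Algebra R A] (D : Derivation R A A)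
variable {l m p : Type*}

/-! Log-canonicity comes from knowing `eL f` and `eR f` well enough that, in each trace occurring in
the bracket, only products of diagonal entries survive. Diagonal entries are integer multiples of f,
and the factor 1/2 is the weight of R_+ on the diagonal.

Minors of `[X Y]` (the g, h and f): if I is the set of rows, `eR f` is f times the identity on the
rows in I and vanishes on the columns outside I; a similar statement holds for the columns
(`isMinor_det`). All index sets are intervals, so off-diagonal products vanish in the triangle seen
by R_+ or R_+ - Id, if need be after exchanging the two functions (`IsMinor.logC_bracket`,
`IsMinor.logC_bracket_of_gradX_eq_zero`). The c_i are semi-invariant under left and right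
multiplication, hence Casimirs (`bracket_cFun`).

For φ, write ψ = det Φ(U). It is invariant under conjugation of U by lower unitriangular N
(`det_phiMat_conj`). Over the function field some N brings U to a Hessenberg matrix H = N⁻¹UN whose
last column is a multiple of the first unit vector (`exists_isHess_conj`). There ψ is, up to sign, a
product of the entries b_0 = H_{0,m}, b_j = H_{j,j-1} with one minor μ of H (`IsHess.det_phiMat`).
This normal form is infinitesimally rigid, so derivatives of H follow from those of U without
computing the derivative of N (`IsNormalizer.map_hess`). It follows that `eR φ` is scalar and `eL φ`
lower triangular, which settles φ against minors. For two φ's the remaining trace is the derivative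
of the second along δU = U · `eL` of the first; it is computed in `intMul_trace_phi_phi`.

Generation is turned into a uniqueness statement: an element lies in a subfield L as soon as any two
ring homomorphisms that agree on L agree on it (`mem_range_algebraMap_of_forall_ringHom`). Let σ, τ
agree on the family. The φ determine the b_j and the minors of H, hence its rows below the first;
the c_i give the characteristic polynomial, hence the first row (`mapMatrix_hess_eq`). Then the
trailing minors of `[X Y]` together with the h and the g force the images of X, Y and N to agree
(`isLowerUni_transpose_of_trailMinor`, `eq_one_of_colMinor`).

Algebraic independence follows by counting: 2n² elements generate a field of transcendence degree at
least 2n². -/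

theorem map_derivation_mul [Fintype m] (M : Matrix l m A) (N : Matrix m p A) :
    (M * N).map D = M.map D * N + M * N.map D := by
  ext i j
  simp only [map_apply, mul_apply, Matrix.add_apply, map_sum, Derivation.leibniz, smul_eq_mul]
  rw [← Finset.sum_add_distrib]
  exact Finset.sum_congr rfl fun k _ => by ring

theorem map_derivation_one [DecidableEq m] : (1 : Matrix m m A).map D = 0 := by
  ext i j
  by_cases h : i = j
  · subst h; simp
  · simp [h]

theorem derivation_prod [DecidableEq m] (s : Finset m) (f : m → A) :
    D (∏ i ∈ s, f i) = ∑ i ∈ s, (∏ j ∈ s.erase i, f j) * D (f i) := by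
  induction s using Finset.induction_on with
  | empty => simp
  | insert a s ha ih =>
    rw [Finset.prod_insert ha, Derivation.leibniz, ih, Finset.sum_insert ha, smul_eq_mul,
      smul_eq_mul, Finset.mul_sum, Finset.erase_insert ha, add_comm]
    congr 1
    refine Finset.sum_congr rfl fun i hi => ?_
    have hia : i ≠ a := fun h => ha (h ▸ hi)
    rw [Finset.erase_insert_of_ne hia.symm, Finset.prod_insert
      (fun h => ha (Finset.mem_of_mem_erase h)), mul_assoc]

/-- Jacobi's formula. By Cramer's rule each diagonal entry of the adjugate times the differentiated
matrix is the determinant with one column differentiated. -/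
theorem derivation_det [Fintype m] [DecidableEq m] (M : Matrix m m A) :
    D M.det = (M.adjugate * M.map D).trace := by
  have h : ∀ i, (M.adjugate * M.map D) i i = (M.updateCol i fun s => D (M s i)).det := by
    intro i
    rw [← cramer_apply, cramer_eq_adjugate_mulVec]
    rfl
  simp only [trace, diag_apply, h]
  simp only [det_apply, map_sum, Units.smul_def, map_zsmul]
  rw [Finset.sum_comm]
  refine Finset.sum_congr rfl fun σ _ => ?_
  rw [← Finset.smul_sum, derivation_prod]
  congr 1
  refine Finset.sum_congr rfl fun i _ => ?_
  rw [← Finset.mul_prod_erase _ _ (Finset.mem_univ i), updateCol_self, mul_comm]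
  congr 1
  refine Finset.prod_congr rfl fun j hj => ?_
  rw [updateCol_ne (Finset.ne_of_mem_erase hj)]

theorem derivation_det_mul_right [Fintype m] [DecidableEq m] {M Z : Matrix m m A}
    (h : M.map D = M * Z) : D M.det = Z.trace * M.det := by
  rw [derivation_det, h, ← Matrix.mul_assoc, adjugate_mul, smul_mul, Matrix.one_mul, trace_smul,
    smul_eq_mul, mul_comm]

theorem derivation_det_mul_left [Fintype m] [DecidableEq m] {M Z : Matrix m m A}
    (h : M.map D = Z * M) : D M.det = Z.trace * M.det := by
  rw [derivation_det, h, trace_mul_comm, Matrix.mul_assoc, mul_adjugate, Matrix.mul_smul,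
    Matrix.mul_one,
    trace_smul, smul_eq_mul, mul_comm]

end DerivationMatrix

/-! ### Gradients of minors. -/

section MinorGradient

variable {R : Type*} [CommRing R] {I J T : Type*} [Fintype I] [Fintype J] [Fintype T]
  [DecidableEq I] [DecidableEq J] [DecidableEq T]

/-- The gradient of the minor `det (W.submatrix r c)` as a function of the matrix `W`. -/
noncomputable def minorGrad (W : Matrix I J R) (r : T → I) (c : T → J) : Matrix J I R :=
  (1 : Matrix J J R).submatrix id c * (W.submatrix r c).adjugate * (1 : Matrix I I R).submatrix r id

theorem submatrix_eq_mul (W : Matrix I J R) (r : T → I) (c : T → J) :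
    W.submatrix r c = (1 : Matrix I I R).submatrix r id * W *
      (1 : Matrix J J R).submatrix id c := by
  ext s t
  simp [mul_apply, one_apply, Finset.sum_ite_eq]

theorem derivation_minor {S : Type*} [CommRing S] [Algebra S R] (D : Derivation S R R)
    (W : Matrix I J R) (r : T → I) (c : T → J) :
    D (W.submatrix r c).det = (minorGrad W r c * W.map D).trace := by
  rw [derivation_det, ← submatrix_map, submatrix_eq_mul (W.map D), minorGrad,
    ← Matrix.mul_assoc, trace_mul_comm]
  simp only [Matrix.mul_assoc]

theorem mul_minorGrad_apply_of_notMem (W : Matrix I J R) (r : T → I) (c : T → J) {a b : I}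
    (hb : b ∉ Set.range r) : (W * minorGrad W r c) a b = 0 := by
  rw [minorGrad, ← Matrix.mul_assoc, mul_apply]
  refine Finset.sum_eq_zero fun t _ => ?_
  rw [submatrix_apply, id, one_apply_ne (fun h => hb ⟨t, h⟩), mul_zero]

/-- On the rows of the minor, the product contains the submatrix times its adjugate, which is
scalar. -/
theorem mul_minorGrad_apply (W : Matrix I J R) (r : T → I) (c : T → J) (s : T) (b : I) :
    (W * minorGrad W r c) (r s) b = if r s = b then (W.submatrix r c).det else 0 := by
  have h : (1 : Matrix I I R).submatrix r id * (W * minorGrad W r c) =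
      (W.submatrix r c).det • (1 : Matrix I I R).submatrix r id := by
    rw [minorGrad, ← Matrix.mul_assoc, ← Matrix.mul_assoc, ← Matrix.mul_assoc,
      ← submatrix_eq_mul, mul_adjugate, smul_mul, Matrix.one_mul]
  have h2 := congr_fun (congr_fun h s) b
  rw [mul_apply] at h2
  simpa [one_apply, Finset.sum_ite_eq] using h2

theorem minorGrad_mul_apply_of_notMem (W : Matrix I J R) (r : T → I) (c : T → J) {a b : J}
    (ha : a ∉ Set.range c) : (minorGrad W r c * W) a b = 0 := by
  rw [minorGrad, Matrix.mul_assoc, Matrix.mul_assoc, mul_apply]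
  refine Finset.sum_eq_zero fun t _ => ?_
  rw [submatrix_apply, id, one_apply_ne (fun h => ha ⟨t, h.symm⟩), zero_mul]

theorem minorGrad_mul_apply (W : Matrix I J R) (r : T → I) (c : T → J) (a : J) (t : T) :
    (minorGrad W r c * W) a (c t) = if a = c t then (W.submatrix r c).det else 0 := by
  have h : minorGrad W r c * W * (1 : Matrix J J R).submatrix id c =
      (W.submatrix r c).det • (1 : Matrix J J R).submatrix id c := by
    rw [minorGrad, Matrix.mul_assoc, Matrix.mul_assoc, Matrix.mul_assoc,
      ← Matrix.mul_assoc _ W, ← submatrix_eq_mul, adjugate_mul, Matrix.mul_smul, Matrix.mul_one]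
  have h2 := congr_fun (congr_fun h a) t
  rw [mul_apply] at h2
  simpa [one_apply, Finset.sum_ite_eq] using h2

theorem minorGrad_apply_of_notMem_left (W : Matrix I J R) (r : T → I) (c : T → J) {a : J} {b : I}
    (ha : a ∉ Set.range c) : minorGrad W r c a b = 0 := by
  rw [minorGrad, Matrix.mul_assoc, mul_apply]
  refine Finset.sum_eq_zero fun t _ => ?_
  rw [submatrix_apply, id, one_apply_ne (fun h => ha ⟨t, h.symm⟩), zero_mul]

theorem minorGrad_apply_of_notMem_right (W : Matrix I J R) (r : T → I) (c : T → J) {a : J} {b : I}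
    (hb : b ∉ Set.range r) : minorGrad W r c a b = 0 := by
  rw [minorGrad, mul_apply]
  refine Finset.sum_eq_zero fun t _ => ?_
  rw [submatrix_apply, id, one_apply_ne (fun h => hb ⟨t, h⟩), mul_zero]

/-- Cauchy–Binet with a single term, because the columns `c` of `Z` are supported on the rows `c`.
-/
theorem det_submatrix_mul (W : Matrix I J R) (Z : Matrix J J R) (r : T → I) {c : T → J}
    (hc : Function.Injective c) (hZ : ∀ j, j ∉ Set.range c → ∀ t, Z j (c t) = 0) :
    ((W * Z).submatrix r c).det = (W.submatrix r c).det * (Z.submatrix c c).det := by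
  rw [← det_mul]
  congr 1
  ext s t
  simp only [submatrix_apply, mul_apply]
  symm
  rw [← Finset.sum_image (f := fun j => W (r s) j * Z j (c t)) (s := Finset.univ) (g := c)
    (fun a _ b _ h => hc h)]
  refine Finset.sum_subset (Finset.subset_univ _) fun j _ hj => ?_
  rw [hZ j (fun ⟨t', h⟩ => hj (Finset.mem_image.2 ⟨t', Finset.mem_univ _, h⟩)), mul_zero]

end MinorGradient

/-! ### Vector fields, the bracket, and bookkeeping for log-canonical pairs. -/

variable {n : ℕ}

/-- The vector field with `δX = P` and `δY = Q`. -/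
noncomputable def vf (P Q : Matrix (Fin n) (Fin n) (RatFun n)) : Derivation ℂ (RatFun n)
    (RatFun n) :=
  ∑ i, ∑ j, (P i j • partialDeriv (Sum.inl (i, j)) + Q i j • partialDeriv (Sum.inr (i, j)))

theorem vf_apply (P Q : Matrix (Fin n) (Fin n) (RatFun n)) (f : RatFun n) :
    vf P Q f = (gradX f * P).trace + (gradY f * Q).trace := by
  have h (f : RatFun n) : vf P Q f = ∑ i, ∑ j, (P i j * partialDeriv (Sum.inl (i, j)) f +
      Q i j * partialDeriv (Sum.inr (i, j)) f) := by
    rw [vf, ← Derivation.coeFnAddMonoidHom_apply]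
    simp only [map_sum, Finset.sum_apply, Derivation.coeFnAddMonoidHom_apply]
    rfl
  simp only [h, trace, diag_apply, mul_apply, gradX, gradY, of_apply, Finset.sum_add_distrib]
  congr 1
  · rw [Finset.sum_comm]
    exact Finset.sum_congr rfl fun _ _ => Finset.sum_congr rfl fun _ _ => mul_comm _ _
  · rw [Finset.sum_comm]
    exact Finset.sum_congr rfl fun _ _ => Finset.sum_congr rfl fun _ _ => mul_comm _ _

theorem gradX_coordFun_inl (i j : Fin n) :
    gradX (coordFun (Sum.inl (i, j))) = Matrix.single j i (1 : RatFun n) := by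
  ext a b
  simp only [gradX, of_apply, partialDeriv_coordFun, single, Sum.inl.injEq, Prod.mk.injEq]
  simp only [and_comm]

theorem gradY_coordFun_inr (i j : Fin n) :
    gradY (coordFun (Sum.inr (i, j))) = Matrix.single j i (1 : RatFun n) := by
  ext a b
  simp only [gradY, of_apply, partialDeriv_coordFun, single, Sum.inr.injEq, Prod.mk.injEq]
  simp only [and_comm]

theorem gradX_coordFun_inr (i j : Fin n) : gradX (coordFun (Sum.inr (i, j))) = 0 := by
  ext a b
  simp [gradX, of_apply, partialDeriv_coordFun]

theorem gradY_coordFun_inl (i j : Fin n) : gradY (coordFun (Sum.inl (i, j))) = 0 := by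
  ext a b
  simp [gradY, of_apply, partialDeriv_coordFun]

theorem map_vf_matX (P Q : Matrix (Fin n) (Fin n) (RatFun n)) : (matX n).map (vf P Q) = P := by
  ext i j
  simp [matX, vf_apply, gradX_coordFun_inl, gradY_coordFun_inl, trace_single_mul]

theorem map_vf_matY (P Q : Matrix (Fin n) (Fin n) (RatFun n)) : (matY n).map (vf P Q) = Q := by
  ext i j
  simp [matY, vf_apply, gradX_coordFun_inr, gradY_coordFun_inr, trace_single_mul]

/-- Pairing with `eL` differentiates along simultaneous right multiplication of X and Y, and pairing
with `eR` along left multiplication. All later computations of these two matrices rest on this. -/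
theorem trace_eL_mul (f : RatFun n) (Z : Matrix (Fin n) (Fin n) (RatFun n)) :
    (eL f * Z).trace = vf (matX n * Z) (matY n * Z) f := by
  rw [vf_apply, eL, Matrix.add_mul, trace_add, Matrix.mul_assoc, Matrix.mul_assoc]

theorem trace_eR_mul (f : RatFun n) (Z : Matrix (Fin n) (Fin n) (RatFun n)) :
    (eR f * Z).trace = vf (Z * matX n) (Z * matY n) f := by
  rw [vf_apply, eR, Matrix.add_mul, trace_add, Matrix.mul_assoc, Matrix.mul_assoc,
    trace_mul_comm, trace_mul_comm (matY n), Matrix.mul_assoc, Matrix.mul_assoc]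

theorem apply_eq_trace_mul_single {R : Type*} [CommRing R] {m : Type*} [Fintype m] [DecidableEq m]
    (A : Matrix m m R) (a b : m) : A a b = (A * Matrix.single b a 1).trace := by
  simp [trace_mul_single]

theorem eq_of_trace_mul_eq {R : Type*} [CommRing R] {m p : Type*} [Fintype m] [DecidableEq m]
    [Fintype p] [DecidableEq p]
    {A B : Matrix m p R} (h : ∀ Z : Matrix p m R, (A * Z).trace = (B * Z).trace) : A = B := by
  ext a b
  have := h (Matrix.single b a 1)
  simpa [trace_mul_single] using this

/-- `x` is a half-integer multiple of `f₁ f₂`. -/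
def LogC (f₁ f₂ x : RatFun n) : Prop := ∃ w : ℤ, x = (w : RatFun n) / 2 * f₁ * f₂

/-- `x` is an integer multiple of `f`. -/
def IntMul (f x : RatFun n) : Prop := ∃ m : ℤ, x = (m : RatFun n) * f

namespace IntMul

variable {f x y : RatFun n}

theorem zero : IntMul f 0 := ⟨0, by simp⟩

theorem self : IntMul f f := ⟨1, by simp⟩

theorem add (hx : IntMul f x) (hy : IntMul f y) : IntMul f (x + y) := by
  obtain ⟨a, rfl⟩ := hx
  obtain ⟨b, rfl⟩ := hy
  exact ⟨a + b, by push_cast; ring⟩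

theorem neg (hx : IntMul f x) : IntMul f (-x) := by
  obtain ⟨a, rfl⟩ := hx
  exact ⟨-a, by push_cast; ring⟩

theorem sub (hx : IntMul f x) (hy : IntMul f y) : IntMul f (x - y) :=
  sub_eq_add_neg x y ▸ hx.add hy.neg

theorem sum {ι : Type*} {s : Finset ι} {g : ι → RatFun n} (h : ∀ i ∈ s, IntMul f (g i)) :
    IntMul f (∑ i ∈ s, g i) :=
  Finset.sum_induction g (IntMul f) (fun _ _ => add) zero h

theorem mul (hx : IntMul f x) (z : RatFun n) : IntMul (f * z) (x * z) := by
  obtain ⟨a, rfl⟩ := hx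
  exact ⟨a, by ring⟩

theorem intCast_mul (hx : IntMul f x) (m : ℤ) : IntMul f (m * x) := by
  obtain ⟨a, rfl⟩ := hx
  exact ⟨m * a, by push_cast; ring⟩

end IntMul

namespace LogC

variable {f₁ f₂ x y : RatFun n}

theorem zero : LogC f₁ f₂ 0 := ⟨0, by simp⟩

theorem add (hx : LogC f₁ f₂ x) (hy : LogC f₁ f₂ y) : LogC f₁ f₂ (x + y) := by
  obtain ⟨a, rfl⟩ := hx
  obtain ⟨b, rfl⟩ := hy
  exact ⟨a + b, by push_cast; ring⟩

theorem neg (hx : LogC f₁ f₂ x) : LogC f₁ f₂ (-x) := by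
  obtain ⟨a, rfl⟩ := hx
  exact ⟨-a, by push_cast; ring⟩

theorem sub (hx : LogC f₁ f₂ x) (hy : LogC f₁ f₂ y) : LogC f₁ f₂ (x - y) :=
  sub_eq_add_neg x y ▸ hx.add hy.neg

theorem swap (hx : LogC f₁ f₂ x) : LogC f₂ f₁ x := by
  obtain ⟨a, rfl⟩ := hx
  exact ⟨a, by ring⟩

theorem sum {ι : Type*} {s : Finset ι} {g : ι → RatFun n} (h : ∀ i ∈ s, LogC f₁ f₂ (g i)) :
    LogC f₁ f₂ (∑ i ∈ s, g i) :=
  Finset.sum_induction g (LogC f₁ f₂) (fun _ _ => add) zero h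

theorem of_intMul (hx : IntMul f₁ x) (hy : IntMul f₂ y) : LogC f₁ f₂ (x * y) := by
  obtain ⟨a, rfl⟩ := hx
  obtain ⟨b, rfl⟩ := hy
  refine ⟨2 * a * b, ?_⟩
  push_cast
  field_simp

theorem half (hx : IntMul f₁ x) (hy : IntMul f₂ y) : LogC f₁ f₂ (1 / 2 * x * y) := by
  obtain ⟨a, rfl⟩ := hx
  obtain ⟨b, rfl⟩ := hy
  refine ⟨a * b, ?_⟩
  push_cast
  field_simp

theorem of_intMul_mul (hx : IntMul (f₁ * f₂) x) : LogC f₁ f₂ x := by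
  obtain ⟨a, rfl⟩ := hx
  refine ⟨2 * a, ?_⟩
  push_cast
  field_simp

end LogC

theorem rPlus_apply (A : Matrix (Fin n) (Fin n) (RatFun n)) (a b : Fin n) :
    rPlus A a b = if a < b then A a b else if a = b then 1 / 2 * A a b else 0 := by
  rcases lt_trichotomy a b with h | h | h
  · simp only [rPlus, projPos, projNeg, Matrix.smul_apply, Matrix.add_apply, Matrix.sub_apply,
      of_apply, smul_eq_mul, h, not_lt_of_gt h, if_true, if_false, sub_zero]
    ring
  · subst h
    simp [rPlus, projPos, projNeg]
  · simp [rPlus, projPos, projNeg, h, not_lt_of_gt h, h.ne']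

theorem trace_mul_eq_sum {R : Type*} [CommRing R] (A B : Matrix (Fin n) (Fin n) R) :
    (A * B).trace = ∑ a, ∑ b, A a b * B b a := rfl

theorem rPlus_add_transpose (A B : Matrix (Fin n) (Fin n) (RatFun n)) :
    traceForm (rPlus A) B + traceForm (rPlus B) A = (A * B).trace := by
  rw [traceForm, traceForm, trace_mul_comm (rPlus B)]
  simp only [trace_mul_eq_sum, ← Finset.sum_add_distrib]
  refine Finset.sum_congr rfl fun a _ => Finset.sum_congr rfl fun b _ => ?_
  rw [rPlus_apply, rPlus_apply]
  rcases lt_trichotomy a b with h | h | h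
  · simp [h, not_lt_of_gt h, h.ne']
  · subst h
    simp only [lt_irrefl, if_false, if_true]
    ring
  · simp [h, not_lt_of_gt h, h.ne']

/-- R is skew for the trace form, so the R_+ terms symmetrize to plain traces, and the rest cancels
by cyclicity of the trace. Thanks to this a pair may be treated in whichever order is convenient. -/
theorem bracket_skew (f₁ f₂ : RatFun n) : bracket f₁ f₂ = -bracket f₂ f₁ := by
  have hL := rPlus_add_transpose (eL f₁) (eL f₂)
  have hR := rPlus_add_transpose (eR f₁) (eR f₂)
  have key : (eL f₁ * eL f₂).trace - (eR f₁ * eR f₂).trace + (eR f₁ * (matY n * gradY f₂)).trace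
      + (eR f₂ * (matY n * gradY f₁)).trace - (eL f₁ * (gradY f₂ * matY n)).trace
      - (eL f₂ * (gradY f₁ * matY n)).trace = 0 := by
    have cyc (A B C E : Matrix (Fin n) (Fin n) (RatFun n)) :
        (A * B * (C * E)).trace = (B * C * (E * A)).trace := by
      rw [Matrix.mul_assoc, trace_mul_comm]
      simp only [Matrix.mul_assoc]
    simp only [eL, eR, Matrix.add_mul, Matrix.mul_add, trace_add]
    rw [cyc (gradX f₁) (matX n) (gradX f₂) (matX n), cyc (gradX f₁) (matX n) (gradY f₂) (matY n),
      cyc (gradY f₁) (matY n) (gradX f₂) (matX n), cyc (gradY f₁) (matY n) (gradY f₂) (matY n),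
      cyc (gradX f₂) (matX n) (gradY f₁) (matY n), cyc (gradY f₂) (matY n) (gradY f₁) (matY n),
      trace_mul_comm (matY n * gradY f₂) (matY n * gradY f₁),
      trace_mul_comm (matX n * gradX f₂) (matY n * gradY f₁),
      trace_mul_comm (matX n * gradY f₁) (matY n * gradX f₂)]
    have e1 := cyc (matY n) (gradX f₂) (matX n) (gradY f₁)
    rw [e1, trace_mul_comm (matX n * gradX f₂) (matX n * gradX f₁)]
    ring
  simp only [bracket]
  simp only [traceForm] at hL hR key ⊢
  linear_combination hL - hR + key

theorem LogC.bracket_swap {f₁ f₂ : RatFun n} (h : LogC f₁ f₂ (bracket f₁ f₂)) :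
    LogC f₂ f₁ (bracket f₂ f₁) := by
  rw [bracket_skew]
  exact h.swap.neg

/-! ### Traces in which only the diagonal contributes. -/

section Pairing

variable {A B : Matrix (Fin n) (Fin n) (RatFun n)} {f₁ f₂ : RatFun n}

theorem logC_trace_mul (h : ∀ a b, a ≠ b → A a b * B b a = 0) (hA : ∀ a, IntMul f₁ (A a a))
    (hB : ∀ a, IntMul f₂ (B a a)) : LogC f₁ f₂ (A * B).trace := by
  rw [trace_mul_eq_sum]
  refine LogC.sum fun a _ => LogC.sum fun b _ => ?_
  by_cases hab : a = b
  · subst hab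
    exact LogC.of_intMul (hA a) (hB a)
  · rw [h a b hab]
    exact LogC.zero

theorem logC_rPlus (h : ∀ a b, a < b → A a b * B b a = 0) (hA : ∀ a, IntMul f₁ (A a a))
    (hB : ∀ a, IntMul f₂ (B a a)) : LogC f₁ f₂ (traceForm (rPlus A) B) := by
  rw [traceForm, trace_mul_eq_sum]
  refine LogC.sum fun a _ => LogC.sum fun b _ => ?_
  rw [rPlus_apply]
  rcases lt_trichotomy a b with hab | hab | hab
  · rw [if_pos hab, h a b hab]
    exact LogC.zero
  · subst hab
    simp only [lt_irrefl, if_false, if_true]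
    exact LogC.half (hA a) (hB a)
  · rw [if_neg (not_lt_of_gt hab), if_neg hab.ne', zero_mul]
    exact LogC.zero

/-- R_+ - Id kills the strictly upper part, so only the pairs below the diagonal have to be
controlled. -/
theorem logC_rPlus_sub_trace (h : ∀ a b, b < a → A a b * B b a = 0) (hA : ∀ a, IntMul f₁ (A a a))
    (hB : ∀ a, IntMul f₂ (B a a)) : LogC f₁ f₂ (traceForm (rPlus A) B - (A * B).trace) := by
  rw [traceForm, trace_mul_eq_sum, trace_mul_eq_sum, ← Finset.sum_sub_distrib]
  refine LogC.sum fun a _ => ?_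
  rw [← Finset.sum_sub_distrib]
  refine LogC.sum fun b _ => ?_
  rw [rPlus_apply]
  rcases lt_trichotomy a b with hab | hab | hab
  · rw [if_pos hab, sub_self]
    exact LogC.zero
  · subst hab
    simp only [lt_irrefl, if_false, if_true]
    rw [show 1 / 2 * A a a * B a a - A a a * B a a = -(1 / 2 * A a a * B a a) by ring]
    exact (LogC.half (hA a) (hB a)).neg
  · rw [h a b hab, if_neg (not_lt_of_gt hab), if_neg hab.ne', zero_mul, sub_zero]
    exact LogC.zero

end Pairing

/-! ### Minors of `[X Y]` -/

/-- The matrix `[X Y]`. -/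
noncomputable def matW (n : ℕ) : Matrix (Fin n) (Fin n ⊕ Fin n) (RatFun n) :=
  fromCols (matX n) (matY n)

/-- The properties of a minor of `[X Y]` with the set `I` of rows, the set `J` of columns of `X`
and the set `J'` of columns of `Y` that determine its brackets with other minors. -/
structure IsMinor (f : RatFun n) (I J J' : Fin n → Prop) : Prop where
  eR_zero : ∀ a b, ¬ I b → eR f a b = 0
  eR_off : ∀ a b, I a → a ≠ b → eR f a b = 0
  eR_diag : ∀ a, I a → eR f a a = f
  yR_zero : ∀ a b, ¬ I b → (matY n * gradY f) a b = 0
  x_zero : ∀ a b, ¬ J a → (gradX f * matX n) a b = 0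
  x_off : ∀ a b, J b → a ≠ b → (gradX f * matX n) a b = 0
  x_diag : ∀ a, IntMul f ((gradX f * matX n) a a)
  y_zero : ∀ a b, ¬ J' a → (gradY f * matY n) a b = 0
  y_off : ∀ a b, J' b → a ≠ b → (gradY f * matY n) a b = 0
  y_diag : ∀ a, IntMul f ((gradY f * matY n) a a)
  gradX_zero : (∀ a, ¬ J a) → gradX f = 0
  gradY_zero : (∀ a, ¬ J' a) → gradY f = 0

/-- With G the gradient of the minor as a function of W = `[X Y]`, all the properties are read off
from WG and GW. -/
theorem isMinor_det {T : Type*} [Fintype T] [DecidableEq T] {r : T → Fin n}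
    {c : T → Fin n ⊕ Fin n} {I J J' : Fin n → Prop} (hI : ∀ a, I a ↔ a ∈ Set.range r)
    (hJ : ∀ a, J a ↔ Sum.inl a ∈ Set.range c) (hJ' : ∀ a, J' a ↔ Sum.inr a ∈ Set.range c) :
    IsMinor ((matW n).submatrix r c).det I J J' := by
  set f := ((matW n).submatrix r c).det with hf
  set G := minorGrad (matW n) r c with hG
  have hW (P Q : Matrix (Fin n) (Fin n) (RatFun n)) : (matW n).map (vf P Q) = fromCols P Q := by
    ext i (j | j)
    · exact congr_fun (congr_fun (map_vf_matX P Q) i) j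
    · exact congr_fun (congr_fun (map_vf_matY P Q) i) j
  -- Testing against all vector fields identifies `gradX` and `gradY` with the two halves of G.
  have hD (P Q : Matrix (Fin n) (Fin n) (RatFun n)) :
      (gradX f * P).trace + (gradY f * Q).trace =
        (G.toRows₁ * P).trace + (G.toRows₂ * Q).trace := by
    rw [← vf_apply, hf, derivation_minor, hW, ← hG, ← fromRows_toRows G, fromRows_mul_fromCols,
      toRows₁_fromRows, toRows₂_fromRows]
    simp [trace, Fintype.sum_sum_type]
  have hX : gradX f = G.toRows₁ := eq_of_trace_mul_eq fun Z => by simpa using hD Z 0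
  have hY : gradY f = G.toRows₂ := eq_of_trace_mul_eq fun Z => by simpa using hD 0 Z
  have hR : eR f = matW n * G := by
    rw [eR, hX, hY, matW, ← fromCols_mul_fromRows, fromRows_toRows]
  have hXX (a b : Fin n) : (gradX f * matX n) a b = (G * matW n) (Sum.inl a) (Sum.inl b) := by
    rw [hX]
    rfl
  have hYY (a b : Fin n) : (gradY f * matY n) a b = (G * matW n) (Sum.inr a) (Sum.inr b) := by
    rw [hY]
    rfl
  refine ⟨fun a b hb => ?_, fun a b ha hab => ?_, fun a ha => ?_, fun a b hb => ?_,
    fun a b ha => ?_, fun a b hb hab => ?_, fun a => ?_, fun a b ha => ?_, fun a b hb hab => ?_,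
    fun a => ?_, fun h => ?_, fun h => ?_⟩
  · rw [hR]
    exact mul_minorGrad_apply_of_notMem _ _ _ fun h => hb ((hI b).2 h)
  · obtain ⟨s, rfl⟩ := (hI a).1 ha
    rw [hR, hG, mul_minorGrad_apply, if_neg hab]
  · obtain ⟨s, rfl⟩ := (hI a).1 ha
    rw [hR, hG, mul_minorGrad_apply, if_pos rfl]
  · rw [hY, mul_apply]
    refine Finset.sum_eq_zero fun j _ => ?_
    rw [toRows₂_apply, hG, minorGrad_apply_of_notMem_right _ _ _ fun h => hb ((hI b).2 h), mul_zero]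
  · rw [hXX]
    exact minorGrad_mul_apply_of_notMem _ _ _ fun h => ha ((hJ a).2 h)
  · obtain ⟨t, ht⟩ := (hJ b).1 hb
    rw [hXX, ← ht, hG, minorGrad_mul_apply, ht, if_neg (fun h => hab (Sum.inl.inj h))]
  · rw [hXX]
    by_cases ha : Sum.inl a ∈ Set.range c
    · obtain ⟨t, ht⟩ := ha
      rw [← ht, hG, minorGrad_mul_apply, if_pos rfl]
      exact IntMul.self
    · rw [hG, minorGrad_mul_apply_of_notMem _ _ _ ha]
      exact IntMul.zero
  · rw [hYY]
    exact minorGrad_mul_apply_of_notMem _ _ _ fun h => ha ((hJ' a).2 h)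
  · obtain ⟨t, ht⟩ := (hJ' b).1 hb
    rw [hYY, ← ht, hG, minorGrad_mul_apply, ht, if_neg (fun h => hab (Sum.inr.inj h))]
  · rw [hYY]
    by_cases ha : Sum.inr a ∈ Set.range c
    · obtain ⟨t, ht⟩ := ha
      rw [← ht, hG, minorGrad_mul_apply, if_pos rfl]
      exact IntMul.self
    · rw [hG, minorGrad_mul_apply_of_notMem _ _ _ ha]
      exact IntMul.zero
  · rw [hX]
    ext a b
    exact minorGrad_apply_of_notMem_left _ _ _ fun h' => h a ((hJ a).2 h')
  · rw [hY]
    ext a b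
    exact minorGrad_apply_of_notMem_left _ _ _ fun h' => h a ((hJ' a).2 h')

namespace IsMinor

variable {f₁ f₂ : RatFun n} {I₁ I₂ J₁ J₂ J₁' J₂' : Fin n → Prop}

theorem intMul_eR (h₁ : IsMinor f₁ I₁ J₁ J₁') (a : Fin n) : IntMul f₁ (eR f₁ a a) := by
  by_cases ha : I₁ a
  · rw [h₁.eR_diag a ha]
    exact IntMul.self
  · rw [h₁.eR_zero a a ha]
    exact IntMul.zero

theorem intMul_eL (h₁ : IsMinor f₁ I₁ J₁ J₁') (a : Fin n) : IntMul f₁ (eL f₁ a a) :=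
  (h₁.x_diag a).add (h₁.y_diag a)

theorem intMul_trace_y (h₁ : IsMinor f₁ I₁ J₁ J₁') : IntMul f₁ (matY n * gradY f₁).trace := by
  rw [trace_mul_comm]
  exact IntMul.sum fun a _ => h₁.y_diag a

theorem x_eq_zero (h₁ : IsMinor f₁ I₁ J₁ J₁') {a b : Fin n} (hab : a ≠ b) (h : J₁ a → J₁ b) :
    (gradX f₁ * matX n) a b = 0 := by
  by_cases ha : J₁ a
  · exact h₁.x_off a b (h ha) hab
  · exact h₁.x_zero a b ha

theorem y_eq_zero (h₁ : IsMinor f₁ I₁ J₁ J₁') {a b : Fin n} (hab : a ≠ b) (h : J₁' a → J₁' b) :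
    (gradY f₁ * matY n) a b = 0 := by
  by_cases ha : J₁' a
  · exact h₁.y_off a b (h ha) hab
  · exact h₁.y_zero a b ha

theorem eL_eq_zero (h₁ : IsMinor f₁ I₁ J₁ J₁') {a b : Fin n} (hab : a ≠ b)
    (h : (J₁ a → J₁ b) ∧ (J₁' a → J₁' b)) : eL f₁ a b = 0 := by
  rw [eL, Matrix.add_apply, h₁.x_eq_zero hab h.1, h₁.y_eq_zero hab h.2, add_zero]

theorem eR_eq_zero (h₁ : IsMinor f₁ I₁ J₁ J₁') {a b : Fin n} (hab : a ≠ b) (h : I₁ b → I₁ a) :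
    eR f₁ a b = 0 := by
  by_cases hb : I₁ b
  · exact h₁.eR_off a b (h hb) hab
  · exact h₁.eR_zero a b hb

/-- The two left-hand terms regroup into R_+ paired with the X-part of `eL f₂` and R_+ - Id paired
with its Y-part. So `eL f₁` matters above the diagonal for the former and below it for the latter.
-/
theorem logC_left (h₁ : IsMinor f₁ I₁ J₁ J₁') (h₂ : IsMinor f₂ I₂ J₂ J₂')
    (hx : ∀ a b, a < b → J₂ b → ¬ J₂ a → (J₁ a → J₁ b) ∧ (J₁' a → J₁' b))
    (hy : ∀ a b, b < a → J₂' b → ¬ J₂' a → (J₁ a → J₁ b) ∧ (J₁' a → J₁' b)) :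
    LogC f₁ f₂ (traceForm (rPlus (eL f₁)) (eL f₂) - traceForm (eL f₁) (gradY f₂ * matY n)) := by
  have e : traceForm (rPlus (eL f₁)) (eL f₂) - traceForm (eL f₁) (gradY f₂ * matY n) =
      traceForm (rPlus (eL f₁)) (gradX f₂ * matX n) +
        (traceForm (rPlus (eL f₁)) (gradY f₂ * matY n) - (eL f₁ * (gradY f₂ * matY n)).trace) := by
    rw [eL, eL, traceForm, traceForm, traceForm, traceForm, Matrix.mul_add, trace_add]
    ring
  rw [e]
  refine LogC.add (logC_rPlus (fun a b hab => ?_) h₁.intMul_eL h₂.x_diag)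
    (logC_rPlus_sub_trace (fun a b hab => ?_) h₁.intMul_eL h₂.y_diag)
  · by_cases h : J₂ b → J₂ a
    · rw [h₂.x_eq_zero hab.ne' h, mul_zero]
    · push Not at h
      rw [h₁.eL_eq_zero hab.ne (hx a b hab h.1 h.2), zero_mul]
  · by_cases h : J₂' b → J₂' a
    · rw [h₂.y_eq_zero hab.ne h, mul_zero]
    · push Not at h
      rw [h₁.eL_eq_zero hab.ne' (hy a b hab h.1 h.2), zero_mul]

theorem logC_bracket (h₁ : IsMinor f₁ I₁ J₁ J₁') (h₂ : IsMinor f₂ I₂ J₂ J₂')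
    (hx : ∀ a b, a < b → J₂ b → ¬ J₂ a → (J₁ a → J₁ b) ∧ (J₁' a → J₁' b))
    (hy : ∀ a b, b < a → J₂' b → ¬ J₂' a → (J₁ a → J₁ b) ∧ (J₁' a → J₁' b))
    (hR : ∀ a b, a < b → I₁ b → ¬ I₁ a → I₂ a → I₂ b)
    (hT : (∀ a, I₂ a → I₁ a) ∨ ∀ a, ¬ J₂' a) : LogC f₁ f₂ (bracket f₁ f₂) := by
  have e : bracket f₁ f₂ =
      (traceForm (rPlus (eL f₁)) (eL f₂) - traceForm (eL f₁) (gradY f₂ * matY n)) -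
        traceForm (rPlus (eR f₁)) (eR f₂) + traceForm (eR f₁) (matY n * gradY f₂) := by
    rw [bracket]
    ring
  rw [e]
  refine ((h₁.logC_left h₂ hx hy).sub
    (logC_rPlus (fun a b hab => ?_) h₁.intMul_eR h₂.intMul_eR)).add ?_
  · by_cases h : I₁ b → I₁ a
    · rw [h₁.eR_eq_zero hab.ne h, zero_mul]
    · push Not at h
      rw [h₂.eR_eq_zero hab.ne' (hR a b hab h.1 h.2), mul_zero]
  · rcases hT with hT | hT
    -- The columns of Y∇_Y f₂ outside `I₂` vanish, and on the rows in `I₂ ⊆ I₁` the matrix `eR f₁`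
    -- acts as the scalar `f₁`.
    · have e2 : traceForm (eR f₁) (matY n * gradY f₂) = f₁ * (matY n * gradY f₂).trace := by
        rw [traceForm, trace_mul_comm, trace_mul_eq_sum, trace, Finset.mul_sum]
        refine Finset.sum_congr rfl fun a _ => ?_
        rw [diag_apply, Finset.sum_eq_single a]
        · by_cases ha : I₂ a
          · rw [h₁.eR_diag a (hT a ha), mul_comm]
          · rw [h₂.yR_zero a a ha, mul_zero, zero_mul]
        · intro b _ hb
          by_cases hb2 : I₂ b
          · rw [h₁.eR_off b a (hT b hb2) hb, mul_zero]
          · rw [h₂.yR_zero a b hb2, zero_mul]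
        · intro h
          exact absurd (Finset.mem_univ a) h
      rw [e2]
      exact LogC.of_intMul IntMul.self h₂.intMul_trace_y
    · rw [h₂.gradY_zero hT, traceForm, Matrix.mul_zero, Matrix.mul_zero, trace_zero]
      exact LogC.zero

/-- When f₂ depends on Y only, `eR f₂` equals Y∇_Y f₂, and the third term of the bracket turns R_+
into R_+ - Id on the right-hand side. The condition on rows therefore moves to the other triangle.
-/
theorem logC_bracket_of_gradX_eq_zero (h₁ : IsMinor f₁ I₁ J₁ J₁') (h₂ : IsMinor f₂ I₂ J₂ J₂')
    (hJ₂ : ∀ a, ¬ J₂ a)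
    (hy : ∀ a b, b < a → J₂' b → ¬ J₂' a → (J₁ a → J₁ b) ∧ (J₁' a → J₁' b))
    (hR : ∀ a b, b < a → I₁ b → ¬ I₁ a → I₂ a → I₂ b) : LogC f₁ f₂ (bracket f₁ f₂) := by
  have e : bracket f₁ f₂ =
      (traceForm (rPlus (eL f₁)) (eL f₂) - traceForm (eL f₁) (gradY f₂ * matY n)) -
        (traceForm (rPlus (eR f₁)) (eR f₂) - (eR f₁ * eR f₂).trace) := by
    have e2 : eR f₂ = matY n * gradY f₂ := by
      rw [eR, h₂.gradX_zero hJ₂, Matrix.mul_zero, zero_add]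
    rw [bracket, e2]
    simp only [traceForm]
    ring
  rw [e]
  refine (h₁.logC_left h₂ (fun a b _ h => absurd h (hJ₂ b)) hy).sub
    (logC_rPlus_sub_trace (fun a b hab => ?_) h₁.intMul_eR h₂.intMul_eR)
  by_cases h : I₁ b → I₁ a
  · rw [h₁.eR_eq_zero hab.ne' h, zero_mul]
  · push Not at h
    rw [h₂.eR_eq_zero hab.ne (hR a b hab h.1 h.2), mul_zero]

end IsMinor

theorem entry_eq {K : Type*} [Zero K] (A : Matrix (Fin n) (Fin n) K) {i j : ℕ} {a b : Fin n}
    (hi : i = a + 1) (hj : j = b + 1) : entry A i j = A a b := by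
  subst hi hj
  rw [entry, dif_pos ⟨⟨by omega, by omega⟩, by omega, by omega⟩]
  rfl

/-- The rows `i, i+1, …` of `gFun n i j`, counted from zero. -/
def gRow {i j : ℕ} (h : 1 ≤ j ∧ j ≤ i ∧ i ≤ n) (s : Fin (n - i + 1)) : Fin n :=
  ⟨i - 1 + s, by omega⟩

/-- The columns `j, j+1, …` of `gFun n i j`, counted from zero. -/
def gCol {i j : ℕ} (h : 1 ≤ j ∧ j ≤ i ∧ i ≤ n) (s : Fin (n - i + 1)) : Fin n :=
  ⟨j - 1 + s, by omega⟩

theorem gFun_eq {i j : ℕ} (h : 1 ≤ j ∧ j ≤ i ∧ i ≤ n) :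
    gFun n i j = ((matX n).submatrix (gRow h) (gCol h)).det := by
  rw [gFun]
  congr 1
  ext s t
  exact entry_eq _ (by simp only [gRow]; omega) (by simp only [gCol]; omega)

theorem hFun_eq {i j : ℕ} (h : 1 ≤ i ∧ i ≤ j ∧ j ≤ n) :
    hFun n i j = ((matY n).submatrix (gCol h) (gRow h)).det := by
  rw [hFun]
  congr 1
  ext s t
  exact entry_eq _ (by simp only [gCol]; omega) (by simp only [gRow]; omega)

/-- The rows of `fFun n k l`, counted from zero. -/
def fRow {k l : ℕ} (h : k + l ≤ n) (s : Fin (k + l)) : Fin n := ⟨n - k - l + s, by omega⟩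

/-- The columns of `fFun n k l`, counted from zero. -/
def fCol {k l : ℕ} (h : k + l ≤ n) (t : Fin (k + l)) : Fin n ⊕ Fin n :=
  if ht : (t : ℕ) < k then Sum.inl ⟨n - k + t, by omega⟩ else Sum.inr ⟨n - l + (t - k), by omega⟩

theorem fFun_eq {k l : ℕ} (h : k + l ≤ n) :
    fFun n k l = ((matW n).submatrix (fRow h) (fCol h)).det := by
  rw [fFun]
  congr 1
  ext s t
  rw [of_apply, submatrix_apply, fCol]
  split_ifs with ht
  · exact entry_eq _ (by simp only [fRow]; omega) (by simp only; omega)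
  · exact entry_eq _ (by simp only [fRow]; omega) (by simp only; omega)

theorem isMinor_gFun {i j : ℕ} (h : 1 ≤ j ∧ j ≤ i ∧ i ≤ n) :
    IsMinor (gFun n i j) (fun a => i ≤ a + 1) (fun a => j ≤ a + 1 ∧ a + i + 1 ≤ j + n)
      (fun _ => False) := by
  rw [gFun_eq h]
  refine isMinor_det (r := gRow h) (c := fun t => Sum.inl (gCol h t)) (fun a => ⟨fun ha => ?_, ?_⟩)
    (fun a => ⟨fun ha => ?_, ?_⟩) (fun a => ?_)
  · exact ⟨⟨a + 1 - i, by omega⟩, Fin.ext (by simp only [gRow]; omega)⟩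
  · rintro ⟨s, rfl⟩
    simp only [gRow]
    omega
  · exact ⟨⟨a + 1 - j, by omega⟩, congrArg Sum.inl (Fin.ext (by simp only [gCol]; omega))⟩
  · rintro ⟨s, hs⟩
    rw [← Sum.inl.inj hs]
    simp only [gCol]
    omega
  · simp

theorem isMinor_hFun {i j : ℕ} (h : 1 ≤ i ∧ i ≤ j ∧ j ≤ n) :
    IsMinor (hFun n i j) (fun a => i ≤ a + 1 ∧ a + j + 1 ≤ i + n) (fun _ => False)
      (fun a => j ≤ a + 1) := by
  rw [hFun_eq h]
  refine isMinor_det (r := gCol h) (c := fun t => Sum.inr (gRow h t)) (fun a => ⟨fun ha => ?_, ?_⟩)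
    (fun a => ?_) (fun a => ⟨fun ha => ?_, ?_⟩)
  · exact ⟨⟨a + 1 - i, by omega⟩, Fin.ext (by simp only [gCol]; omega)⟩
  · rintro ⟨s, rfl⟩
    simp only [gCol]
    omega
  · simp
  · exact ⟨⟨a + 1 - j, by omega⟩, congrArg Sum.inr (Fin.ext (by simp only [gRow]; omega))⟩
  · rintro ⟨s, hs⟩
    rw [← Sum.inr.inj hs]
    simp only [gRow]
    omega

theorem isMinor_fFun {k l : ℕ} (h : k + l ≤ n) :
    IsMinor (fFun n k l) (fun a => n ≤ a + k + l) (fun a => n ≤ a + k) (fun a => n ≤ a + l) := by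
  rw [fFun_eq h]
  refine isMinor_det (fun a => ⟨fun ha => ?_, ?_⟩)
    (fun a => ⟨fun ha => ?_, ?_⟩) (fun a => ⟨fun ha => ?_, ?_⟩)
  · exact ⟨⟨a + k + l - n, by omega⟩, Fin.ext (by simp only [fRow]; omega)⟩
  · rintro ⟨s, rfl⟩
    simp only [fRow]
    omega
  · refine ⟨⟨a + k - n, by omega⟩, ?_⟩
    rw [fCol, dif_pos (by simp only; omega)]
    exact congrArg Sum.inl (Fin.ext (by simp only; omega))
  · rintro ⟨s, hs⟩
    rw [fCol] at hs
    split_ifs at hs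
    rw [← Sum.inl.inj hs]
    simp only
    omega
  · refine ⟨⟨k + (a + l - n), by omega⟩, ?_⟩
    rw [fCol, dif_neg (by simp only; omega)]
    exact congrArg Sum.inr (Fin.ext (by simp only; omega))
  · rintro ⟨s, hs⟩
    rw [fCol] at hs
    split_ifs at hs
    rw [← Sum.inr.inj hs]
    simp only
    omega

theorem logC_gFun_gFun {i j i' j' : ℕ} (h : 1 ≤ j ∧ j ≤ i ∧ i ≤ n)
    (h' : 1 ≤ j' ∧ j' ≤ i' ∧ i' ≤ n) :
    LogC (gFun n i j) (gFun n i' j') (bracket (gFun n i j) (gFun n i' j')) := by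
  -- The bad position: the column interval of the first minor both begins and ends to the left of
  -- that of the second.
  by_cases hc : j < j' ∧ j + i' < j' + i
  · refine (IsMinor.logC_bracket (isMinor_gFun h') (isMinor_gFun h) ?_ ?_ ?_ ?_).bracket_swap
    · intro a b _ _ _
      refine ⟨fun _ => ?_, fun _ => ?_⟩ <;> beta_reduce at * <;> omega
    · intro a b _ hb
      exact hb.elim
    · intro a b
      omega
    · exact Or.inr fun a ha => ha
  · refine IsMinor.logC_bracket (isMinor_gFun h) (isMinor_gFun h') ?_ ?_ ?_ ?_
    · intro a b _ _ _
      refine ⟨fun _ => ?_, fun _ => ?_⟩ <;> beta_reduce at * <;> omega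
    · intro a b _ hb
      exact hb.elim
    · intro a b
      omega
    · exact Or.inr fun a ha => ha

theorem logC_fFun_gFun {k l i j : ℕ} (h : k + l ≤ n) (h' : 1 ≤ j ∧ j ≤ i ∧ i ≤ n) :
    LogC (fFun n k l) (gFun n i j) (bracket (fFun n k l) (gFun n i j)) := by
  refine IsMinor.logC_bracket (isMinor_fFun h) (isMinor_gFun h') ?_ ?_ ?_ ?_
  · intro a b _ _ _
    omega
  · intro a b _ hb
    exact hb.elim
  · intro a b
    omega
  · exact Or.inr fun a ha => ha

theorem logC_fFun_fFun {k l k' l' : ℕ} (h : k + l ≤ n) (h' : k' + l' ≤ n) :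
    LogC (fFun n k l) (fFun n k' l') (bracket (fFun n k l) (fFun n k' l')) := by
  -- The minor with more rows goes first: all row sets are final segments, so the other row set is
  -- contained in its own.
  by_cases hc : k + l ≤ k' + l'
  · refine (IsMinor.logC_bracket (isMinor_fFun h') (isMinor_fFun h) ?_ ?_ ?_ ?_).bracket_swap
    · intro a b _ _ _
      refine ⟨fun _ => ?_, fun _ => ?_⟩ <;> beta_reduce at * <;> omega
    · intro a b _ _ _
      refine ⟨fun _ => ?_, fun _ => ?_⟩ <;> beta_reduce at * <;> omega
    · intro a b
      omega
    · exact Or.inl fun a ha => by omega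
  · refine IsMinor.logC_bracket (isMinor_fFun h) (isMinor_fFun h') ?_ ?_ ?_ ?_
    · intro a b _ _ _
      refine ⟨fun _ => ?_, fun _ => ?_⟩ <;> beta_reduce at * <;> omega
    · intro a b _ _ _
      refine ⟨fun _ => ?_, fun _ => ?_⟩ <;> beta_reduce at * <;> omega
    · intro a b
      omega
    · exact Or.inl fun a ha => by omega

theorem logC_gFun_hFun {i j i' j' : ℕ} (h : 1 ≤ j ∧ j ≤ i ∧ i ≤ n)
    (h' : 1 ≤ i' ∧ i' ≤ j' ∧ j' ≤ n) :
    LogC (gFun n i j) (hFun n i' j') (bracket (gFun n i j) (hFun n i' j')) := by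
  refine IsMinor.logC_bracket_of_gradX_eq_zero (isMinor_gFun h) (isMinor_hFun h')
    (fun a ha => ha) ?_ ?_
  · intro a b _ _ _
    omega
  · intro a b
    omega

theorem logC_fFun_hFun {k l i j : ℕ} (h : k + l ≤ n) (h' : 1 ≤ i ∧ i ≤ j ∧ j ≤ n) :
    LogC (fFun n k l) (hFun n i j) (bracket (fFun n k l) (hFun n i j)) := by
  refine IsMinor.logC_bracket_of_gradX_eq_zero (isMinor_fFun h) (isMinor_hFun h')
    (fun a ha => ha) ?_ ?_
  · intro a b _ _ _
    omega
  · intro a b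
    omega

theorem logC_hFun_hFun {i j i' j' : ℕ} (h : 1 ≤ i ∧ i ≤ j ∧ j ≤ n)
    (h' : 1 ≤ i' ∧ i' ≤ j' ∧ j' ≤ n) :
    LogC (hFun n i j) (hFun n i' j') (bracket (hFun n i j) (hFun n i' j')) := by
  -- Here the row intervals decide: the first must not lie to the left of the second at both ends.
  by_cases hc : ¬ (i < i' ∧ i + j' < i' + j)
  · refine IsMinor.logC_bracket_of_gradX_eq_zero (isMinor_hFun h) (isMinor_hFun h')
      (fun a ha => ha) ?_ ?_
    · intro a b _ _ _
      refine ⟨fun _ => ?_, fun _ => ?_⟩ <;> beta_reduce at * <;> omega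
    · intro a b
      omega
  · refine (IsMinor.logC_bracket_of_gradX_eq_zero (isMinor_hFun h') (isMinor_hFun h)
      (fun a ha => ha) ?_ ?_).bracket_swap
    · intro a b _ _ _
      refine ⟨fun _ => ?_, fun _ => ?_⟩ <;> beta_reduce at * <;> omega
    · intro a b
      omega

/-! ### The functions `c_i` -/

/-- The coefficientwise extension of a derivation to polynomials. -/
noncomputable def coeffDeriv {A : Type*} [CommRing A] [Algebra ℂ A] (D : Derivation ℂ A A) :
    Derivation ℤ (Polynomial A) (Polynomial A) :=
  letI : Differential A := ⟨D.restrictScalars ℤ⟩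
  Differential.mapCoeffs

theorem coeff_coeffDeriv {A : Type*} [CommRing A] [Algebra ℂ A] (D : Derivation ℂ A A)
    (p : Polynomial A) (i : ℕ) : (coeffDeriv D p).coeff i = D (p.coeff i) :=
  letI : Differential A := ⟨D.restrictScalars ℤ⟩
  Differential.coeff_mapCoeffs p i

theorem coeffDeriv_det_mul_right {A : Type*} [CommRing A] [Algebra ℂ A] (D : Derivation ℂ A A)
    {M Z : Matrix (Fin n) (Fin n) (Polynomial A)} (h : M.map (coeffDeriv D) = M * Z) :
    coeffDeriv D M.det = Z.trace * M.det :=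
  derivation_det_mul_right _ h

theorem coeffDeriv_det_mul_left {A : Type*} [CommRing A] [Algebra ℂ A] (D : Derivation ℂ A A)
    {M Z : Matrix (Fin n) (Fin n) (Polynomial A)} (h : M.map (coeffDeriv D) = Z * M) :
    coeffDeriv D M.det = Z.trace * M.det :=
  derivation_det_mul_left _ h

/-- The matrix `X + λ Y`. -/
noncomputable def pencil {R : Type*} [CommRing R] (A B : Matrix (Fin n) (Fin n) R) :
    Matrix (Fin n) (Fin n) (Polynomial R) :=
  A.map Polynomial.C + (Polynomial.X : Polynomial R) • B.map Polynomial.C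

theorem map_coeffDeriv_pencil (D : Derivation ℂ (RatFun n) (RatFun n))
    (A B : Matrix (Fin n) (Fin n) (RatFun n)) :
    (pencil A B).map (coeffDeriv D) = pencil (A.map D) (B.map D) := by
  ext i j m
  simp only [map_apply, coeff_coeffDeriv, pencil, Matrix.add_apply, Matrix.smul_apply, smul_eq_mul,
    Polynomial.coeff_add, Polynomial.coeff_C, map_add]
  congr 1
  · split_ifs <;> simp
  · cases m with
    | zero => simp
    | succ m =>
      rw [Polynomial.coeff_X_mul, Polynomial.coeff_X_mul, Polynomial.coeff_C, Polynomial.coeff_C]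
      split_ifs <;> simp

theorem cFun_eq (i : ℕ) :
    cFun n i = (-1) ^ (i * (n - 1)) * (pencil (matX n) (matY n)).det.coeff i := rfl

theorem derivation_cFun (i : ℕ) (D : Derivation ℂ (RatFun n) (RatFun n)) (t : RatFun n)
    (h : (coeffDeriv D) (pencil (matX n) (matY n)).det =
      Polynomial.C t * (pencil (matX n) (matY n)).det) : D (cFun n i) = t * cFun n i := by
  have h2 := congrArg (Polynomial.coeff · i) h
  simp only [coeff_coeffDeriv, Polynomial.coeff_C_mul] at h2
  have h3 : D ((-1) ^ (i * (n - 1))) = 0 := by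
    simp
  rw [cFun_eq, Derivation.leibniz, h2, h3, smul_zero, add_zero, smul_eq_mul]
  ring

theorem trace_map_C (Z : Matrix (Fin n) (Fin n) (RatFun n)) :
    (Z.map Polynomial.C).trace = Polynomial.C Z.trace := by
  simp [trace, map_sum]

theorem eL_cFun (i : ℕ) : eL (cFun n i) = cFun n i • (1 : Matrix (Fin n) (Fin n) (RatFun n)) := by
  refine eq_of_trace_mul_eq fun Z => ?_
  rw [trace_eL_mul, smul_mul, Matrix.one_mul, trace_smul, smul_eq_mul, mul_comm]
  refine derivation_cFun i _ _ ?_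
  rw [← trace_map_C]
  refine coeffDeriv_det_mul_right _ ?_
  rw [map_coeffDeriv_pencil, map_vf_matX, map_vf_matY, pencil, pencil, Matrix.add_mul, smul_mul,
    Matrix.map_mul, Matrix.map_mul]

theorem eR_cFun (i : ℕ) : eR (cFun n i) = cFun n i • (1 : Matrix (Fin n) (Fin n) (RatFun n)) := by
  refine eq_of_trace_mul_eq fun Z => ?_
  rw [trace_eR_mul, smul_mul, Matrix.one_mul, trace_smul, smul_eq_mul, mul_comm]
  refine derivation_cFun i _ _ ?_
  rw [← trace_map_C]
  refine coeffDeriv_det_mul_left _ ?_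
  rw [map_coeffDeriv_pencil, map_vf_matX, map_vf_matY, pencil, pencil, Matrix.mul_add,
    Matrix.mul_smul, Matrix.map_mul, Matrix.map_mul]

theorem traceForm_rPlus_smul_one (t : RatFun n) (B : Matrix (Fin n) (Fin n) (RatFun n)) :
    traceForm (rPlus (t • (1 : Matrix (Fin n) (Fin n) (RatFun n)))) B = 1 / 2 * t * B.trace := by
  have h : rPlus (t • (1 : Matrix (Fin n) (Fin n) (RatFun n))) =
      (1 / 2 * t) • (1 : Matrix (Fin n) (Fin n) (RatFun n)) := by
    ext a b
    rw [rPlus_apply]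
    rcases lt_trichotomy a b with h | h | h
    · simp [h, h.ne]
    · subst h
      simp
    · simp [not_lt_of_gt h, h.ne']
  rw [traceForm, h, smul_mul, Matrix.one_mul, trace_smul, smul_eq_mul]

/-- As `eL` and `eR` of c_i are the same scalar matrix, the four terms become traces that cancel in
pairs: c_i is a Casimir. -/
theorem bracket_cFun (i : ℕ) (f : RatFun n) : bracket (cFun n i) f = 0 := by
  rw [bracket, eL_cFun, eR_cFun, traceForm_rPlus_smul_one, traceForm_rPlus_smul_one, traceForm,
    traceForm, smul_mul, smul_mul, Matrix.one_mul, Matrix.one_mul, trace_smul, trace_smul,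
    eL, eR, trace_add, trace_add, trace_mul_comm (gradX f), trace_mul_comm (gradY f)]
  ring

/-! ### The determinants `ψ_{kl}` -/

section Psi

variable {R : Type*} [CommRing R] {m : ℕ}

/-- The power of `U` in the column `t` of `Φ_{kl}`. -/
def phiExp (k l t : ℕ) : ℕ := if t < k then 0 else if t < k + l then 1 else t - (k + l) + 2

/-- The column of the power of `U` in the column `t` of `Φ_{kl}`. -/
def phiCol {k l : ℕ} (h : k + l ≤ m + 1) (t : Fin (m + 1)) : Fin (m + 1) :=
  ⟨if (t : ℕ) < k then m + 1 - k + t else if (t : ℕ) < k + l then m + 1 - l + (t - k) else m, by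
    split_ifs <;> omega⟩

/-- The matrix `Φ_{kl}` of an arbitrary matrix `A`. -/
def phiMat (A : Matrix (Fin (m + 1)) (Fin (m + 1)) R) {k l : ℕ} (h : k + l ≤ m + 1) :
    Matrix (Fin (m + 1)) (Fin (m + 1)) R :=
  of fun s t => (A ^ phiExp k l t) s (phiCol h t)

theorem matPhi_eq {k l : ℕ} (h : k + l ≤ m + 1) : matPhi (m + 1) k l = phiMat (matU (m + 1)) h := by
  ext s t
  simp only [matPhi, phiMat, of_apply, phiExp, phiCol]
  split_ifs with h1 h2
  · exact entry_eq _ rfl (by simp only; omega)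
  · rw [pow_one]
    exact entry_eq _ rfl (by simp only; omega)
  · exact entry_eq _ rfl rfl

theorem det_phiMat_map {S : Type*} [CommRing S] (σ : R →+* S)
    (A : Matrix (Fin (m + 1)) (Fin (m + 1)) R) {k l : ℕ} (h : k + l ≤ m + 1) :
    (phiMat (A.map σ) h).det = σ (phiMat A h).det := by
  rw [RingHom.map_det]
  congr 1
  ext s t
  simp only [phiMat, of_apply, RingHom.mapMatrix_apply, map_apply]
  rw [← RingHom.mapMatrix_apply, ← map_pow]
  rfl

/-- Lower triangular matrices with ones on the diagonal. -/
structure IsLowerUni {ι : Type*} [LinearOrder ι] (N : Matrix ι ι R) : Prop where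
  zero : ∀ i j, i < j → N i j = 0
  one : ∀ i, N i i = 1

theorem IsLowerUni.det {ι : Type*} [LinearOrder ι] [Fintype ι] {N : Matrix ι ι R}
    (hN : IsLowerUni N) : N.det = 1 := by
  rw [det_of_isLowerTriangular N fun i j hij => hN.zero i j hij]
  exact Finset.prod_eq_one fun i _ => hN.one i

theorem conj_pow {A N N' : Matrix (Fin (m + 1)) (Fin (m + 1)) R} (hN : N * N' = 1)
    (hN' : N' * N = 1) (q : ℕ) : (N' * A * N) ^ q = N' * A ^ q * N := by
  induction q with
  | zero => rw [pow_zero, pow_zero, Matrix.mul_one, hN']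
  | succ q ih =>
    rw [pow_succ, pow_succ, ih]
    calc N' * A ^ q * N * (N' * A * N) = N' * A ^ q * (N * N') * A * N := by
          simp only [Matrix.mul_assoc]
      _ = N' * (A ^ q * A) * N := by rw [hN, Matrix.mul_one, Matrix.mul_assoc N']

/-- For each power of `A` the selected columns are the last ones, and right multiplication by a
lower unitriangular matrix mixes such columns unitriangularly. The left factor `N'` has determinant
one. -/
theorem det_phiMat_conj {A N N' : Matrix (Fin (m + 1)) (Fin (m + 1)) R} (hN : N * N' = 1)
    (hN' : N' * N = 1) (hL : IsLowerUni N) {k l : ℕ} (hl : 1 ≤ l) (h : k + l ≤ m + 1) :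
    (phiMat (N' * A * N) h).det = (phiMat A h).det := by
  -- `B` puts all powers of `A` side by side (the exponents stay below m + 3) and `Z` is block
  -- diagonal with copies of `N`.
  let B : Matrix (Fin (m + 1)) (Fin (m + 3) × Fin (m + 1)) R := of fun s j => (A ^ (j.1 : ℕ)) s j.2
  let Z : Matrix (Fin (m + 3) × Fin (m + 1)) (Fin (m + 3) × Fin (m + 1)) R :=
    of fun i j => if i.1 = j.1 then N i.2 j.2 else 0
  have hq (t : Fin (m + 1)) : phiExp k l t < m + 3 := by
    rw [phiExp]
    split_ifs <;> omega
  let c : Fin (m + 1) → Fin (m + 3) × Fin (m + 1) := fun t => (⟨phiExp k l t, hq t⟩, phiCol h t)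
  have hBZ (q : Fin (m + 3)) (s j : Fin (m + 1)) : (B * Z) s (q, j) = (A ^ (q : ℕ) * N) s j := by
    simp only [mul_apply, Fintype.sum_prod_type, B, Z, of_apply]
    rw [Finset.sum_eq_single q]
    · simp
    · intro q' _ hq'
      simp [hq']
    · simp
  have hc : Function.Injective c := by
    intro t t' htt
    have h1 := congrArg (fun x => (x.1 : ℕ)) htt
    have h2 := congrArg (fun x => (x.2 : ℕ)) htt
    simp only [c, phiExp, phiCol] at h1 h2
    apply Fin.ext
    split_ifs at h1 h2 <;> omega
  have e1 : phiMat A h = B.submatrix id c := rfl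
  have e2 : phiMat (N' * A * N) h = N' * (B * Z).submatrix id c := by
    ext s t
    simp only [phiMat, of_apply, conj_pow hN hN']
    rw [Matrix.mul_assoc, mul_apply, mul_apply]
    refine Finset.sum_congr rfl fun i _ => ?_
    rw [submatrix_apply, hBZ]
    rfl
  have hZ : (Z.submatrix c c).det = 1 := by
    refine IsLowerUni.det ⟨fun i j hij => ?_, fun i => ?_⟩
    · simp only [submatrix_apply, Z, of_apply, c]
      split_ifs with heq
      · refine hL.zero _ _ ?_
        have heq' := congrArg Fin.val heq
        simp only [phiExp] at heq'
        rw [Fin.lt_def] at hij ⊢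
        simp only [phiCol]
        split_ifs at heq' ⊢ <;> omega
      · rfl
    · simp [Z, c, hL.one]
  have hdetN' : N'.det = 1 := by
    have := congrArg Matrix.det hN'
    rwa [det_mul, hL.det, mul_one, det_one] at this
  rw [e1, e2, det_mul, hdetN', one_mul, det_submatrix_mul B Z id hc, hZ, mul_one]
  rintro ⟨q, j⟩ hj t
  simp only [Z, of_apply, c]
  split_ifs with heq
  · refine hL.zero _ _ (lt_of_not_ge fun hge => hj ?_)
    subst heq
    rw [Fin.le_def] at hge
    simp only [phiCol] at hge
    refine ⟨⟨if (t : ℕ) < k then j + k - (m + 1) else if (t : ℕ) < k + l then k + (j + l - (m + 1))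
      else t, by split_ifs at hge ⊢ <;> omega⟩, ?_⟩
    simp only [c, Prod.mk.injEq, Fin.ext_iff, phiExp, phiCol]
    split_ifs at hge ⊢ <;> constructor <;> omega
  · rfl

/-! ### Hessenberg matrices whose last column is a multiple of the first unit vector -/

/-- Hessenberg matrices whose last column is a multiple of the first unit vector. -/
structure IsHess (H : Matrix (Fin (m + 1)) (Fin (m + 1)) R) : Prop where
  zero : ∀ i j : Fin (m + 1), (j : ℕ) + 1 < i → H i j = 0
  last : ∀ i : Fin (m + 1), i ≠ 0 → H i (Fin.last m) = 0

/-- The entries `H_{0,m}, H_{1,0}, H_{2,1}, …`. -/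
def hessB (H : Matrix (Fin (m + 1)) (Fin (m + 1)) R) (j : Fin (m + 1)) : R :=
  H j (if j = 0 then Fin.last m else j - 1)

theorem hessB_zero (H : Matrix (Fin (m + 1)) (Fin (m + 1)) R) :
    hessB H 0 = H 0 (Fin.last m) := by
  simp [hessB]

theorem hessB_succ (H : Matrix (Fin (m + 1)) (Fin (m + 1)) R) (j : Fin m) :
    hessB H j.succ = H j.succ j.castSucc := by
  rw [hessB, if_neg (Fin.succ_ne_zero j)]
  congr 1
  rw [sub_eq_iff_eq_add, Fin.coeSucc_eq_succ]

/-- The product of the first `p` of the entries `hessB`. -/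
def hessT (H : Matrix (Fin (m + 1)) (Fin (m + 1)) R) (p : ℕ) : R :=
  ∏ j ∈ Finset.univ.filter fun j : Fin (m + 1) => (j : ℕ) < p, hessB H j

theorem hessT_zero (H : Matrix (Fin (m + 1)) (Fin (m + 1)) R) : hessT H 0 = 1 := by
  simp [hessT]

theorem hessT_succ (H : Matrix (Fin (m + 1)) (Fin (m + 1)) R) (j : Fin (m + 1)) :
    hessT H (j + 1) = hessB H j * hessT H j := by
  rw [hessT, hessT, ← Finset.prod_insert (by simp)]
  congr 1
  ext i
  simp only [Finset.mem_filter, Finset.mem_univ, true_and, Finset.mem_insert, Fin.ext_iff]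
  omega

/-- H sends the last unit vector to a multiple of e_0, and it sends the span of e_0, …, e_p into
that of e_0, …, e_{p+1}, multiplying the leading coefficient by the subdiagonal entry. -/
theorem IsHess.pow_last {H : Matrix (Fin (m + 1)) (Fin (m + 1)) R} (hH : IsHess H) (p : ℕ) :
    (∀ i : Fin (m + 1), p < i → (H ^ (p + 1)) i (Fin.last m) = 0) ∧
      ∀ i : Fin (m + 1), (i : ℕ) = p → (H ^ (p + 1)) i (Fin.last m) = hessT H (p + 1) := by
  induction p with
  | zero =>
    refine ⟨fun i hi => ?_, fun i hi => ?_⟩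
    · rw [pow_one]
      exact hH.last i fun h => by simp [h] at hi
    · obtain rfl : i = 0 := Fin.ext hi
      have := hessT_succ H 0
      simp only [Fin.val_zero, hessT_zero, mul_one] at this
      rw [pow_one, this, hessB_zero]
  | succ p ih =>
    refine ⟨fun i hi => ?_, fun i hi => ?_⟩
    · rw [pow_succ', mul_apply]
      refine Finset.sum_eq_zero fun j _ => ?_
      by_cases hj : p < j
      · rw [ih.1 j hj, mul_zero]
      · rw [hH.zero i j (by omega), zero_mul]
    · rw [pow_succ', mul_apply]
      have hp : p < m := by omega
      have hi' : i = (⟨p, hp⟩ : Fin m).succ := Fin.ext hi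
      rw [Finset.sum_eq_single ((⟨p, hp⟩ : Fin m).castSucc)]
      · have h3 := hessT_succ H i
        rw [hi] at h3
        rw [h3, ih.2 _ rfl, hi', hessB_succ]
      · intro j _ hj
        by_cases hj' : p < j
        · rw [ih.1 j hj', mul_zero]
        · have : (j : ℕ) ≠ p := fun h => hj (Fin.ext h)
          rw [hH.zero i j (by omega), zero_mul]
      · simp

/-- The rows of the minor of `H` in `ψ_{kl}(H)`. -/
def muRow {P a : ℕ} (h : P + a ≤ m + 1) (i : Fin a) : Fin (m + 1) := ⟨P + i, by omega⟩

/-- The columns of the minor of `H` in `ψ_{kl}(H)`. -/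
def muCol {a : ℕ} (h : a + 1 ≤ m + 1) (i : Fin a) : Fin (m + 1) := ⟨m - a + i, by omega⟩

theorem det_submatrix_equiv_equiv {ι κ : Type*} [Fintype ι] [DecidableEq ι] [Fintype κ]
    [DecidableEq κ] (e₁ e₂ : ι ≃ κ) (M : Matrix κ κ R) :
    (M.submatrix e₁ e₂).det = ((Equiv.Perm.sign (e₁.symm.trans e₂) : ℤ) : R) * M.det := by
  have : M.submatrix e₁ e₂ = (M.submatrix id (e₁.symm.trans e₂)).submatrix e₁ e₁ := by
    ext i j
    simp
  rw [this, det_submatrix_equiv_self, det_permute']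

/-- After permuting columns the matrix is block triangular. The last columns of H, …, H^P live in
the first `P` rows and are triangular there; the columns of the identity live in the last `k` rows;
the minor of H is left in the middle. -/
theorem IsHess.det_phiMat {H : Matrix (Fin (m + 1)) (Fin (m + 1)) R} (hH : IsHess H)
    {P a k : ℕ} (h : P + (a + k) = m + 1) (hP : 1 ≤ P) :
    ∃ ε : ℤˣ, (phiMat H (k := k) (l := a + 1) (by omega)).det = ((ε : ℤ) : R) *
      ((∏ p : Fin P, hessT H (p + 1)) *
        (H.submatrix (muRow (P := P) (a := a) (by omega)) (muCol (by omega))).det) := by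
  let e₁ : Fin P ⊕ (Fin a ⊕ Fin k) ≃ Fin (m + 1) :=
    ((Equiv.sumCongr (Equiv.refl _) finSumFinEquiv).trans finSumFinEquiv).trans (finCongr h)
  -- Of the a + 1 columns taken from H itself, the last one is counted among the powers, with
  -- exponent 1.
  let e₂ : Fin P ⊕ (Fin a ⊕ Fin k) ≃ Fin (m + 1) :=
    ((((Equiv.sumComm _ _).trans (Equiv.sumCongr (Equiv.sumComm _ _) (Equiv.refl _))).trans
      (Equiv.sumCongr finSumFinEquiv (Equiv.refl _))).trans finSumFinEquiv).trans
      (finCongr (by omega))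
  have a1 (p : Fin P) : (e₁ (Sum.inl p) : ℕ) = p := rfl
  have a2 (i : Fin a) : (e₁ (Sum.inr (Sum.inl i)) : ℕ) = P + i := rfl
  have a3 (b : Fin k) : (e₁ (Sum.inr (Sum.inr b)) : ℕ) = P + (a + b) := rfl
  have b1 (p : Fin P) : (e₂ (Sum.inl p) : ℕ) = k + a + p := rfl
  have b2 (i : Fin a) : (e₂ (Sum.inr (Sum.inl i)) : ℕ) = k + i := rfl
  have b3 (b : Fin k) : (e₂ (Sum.inr (Sum.inr b)) : ℕ) = b := rfl
  set Φ := phiMat H (k := k) (l := a + 1) (by omega) with hΦ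
  have c1 (s : Fin (m + 1)) (p : Fin P) :
      Φ s (e₂ (Sum.inl p)) = (H ^ ((p : ℕ) + 1)) s (Fin.last m) := by
    have hq : phiExp k (a + 1) (e₂ (Sum.inl p)) = p + 1 := by
      rw [phiExp, b1]
      split_ifs <;> omega
    have hc : phiCol (m := m) (k := k) (l := a + 1) (by omega) (e₂ (Sum.inl p)) = Fin.last m := by
      apply Fin.ext
      simp only [phiCol, b1, Fin.val_last]
      split_ifs <;> omega
    rw [hΦ, phiMat, of_apply, hq, hc]
  have c2 (s : Fin (m + 1)) (i : Fin a) :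
      Φ s (e₂ (Sum.inr (Sum.inl i))) = H s (muCol (by omega) i) := by
    have hq : phiExp k (a + 1) (e₂ (Sum.inr (Sum.inl i))) = 1 := by
      rw [phiExp, b2]
      split_ifs <;> omega
    have hc : phiCol (m := m) (k := k) (l := a + 1) (by omega) (e₂ (Sum.inr (Sum.inl i))) =
        muCol (by omega) i := by
      apply Fin.ext
      simp only [phiCol, b2, muCol]
      split_ifs <;> omega
    rw [hΦ, phiMat, of_apply, hq, hc, pow_one]
  have c3 (s : Fin (m + 1)) (b : Fin k) :
      Φ s (e₂ (Sum.inr (Sum.inr b))) = if (s : ℕ) = P + (a + b) then 1 else 0 := by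
    have hq : phiExp k (a + 1) (e₂ (Sum.inr (Sum.inr b))) = 0 := by
      rw [phiExp, b3]
      split_ifs <;> omega
    rw [hΦ, phiMat, of_apply, hq, pow_zero, one_apply]
    refine if_congr ?_ rfl rfl
    rw [Fin.ext_iff]
    simp only [phiCol, b3]
    split_ifs <;> omega
  have hblock : Φ.submatrix e₁ e₂ = fromBlocks
      (of fun p' p : Fin P => (H ^ ((p : ℕ) + 1)) (e₁ (Sum.inl p')) (Fin.last m))
      (of fun p' j => Φ (e₁ (Sum.inl p')) (e₂ (Sum.inr j))) 0
      (fromBlocks (H.submatrix (muRow (P := P) (a := a) (by omega)) (muCol (by omega))) 0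
        (of fun b j => Φ (e₁ (Sum.inr (Sum.inr b))) (e₂ (Sum.inr (Sum.inl j)))) 1) := by
    ext (i | i | i) (j | j | j)
    · exact c1 _ _
    · rfl
    · rfl
    · rw [submatrix_apply, c1, (hH.pow_last j).1]
      · rfl
      · rw [a2]
        omega
    · rw [submatrix_apply, c2]
      rfl
    · rw [submatrix_apply, c3, if_neg]
      · rfl
      · rw [a2]
        omega
    · rw [submatrix_apply, c1, (hH.pow_last j).1]
      · rfl
      · rw [a3]
        omega
    · rfl
    · rw [submatrix_apply, c3, fromBlocks_apply₂₂, fromBlocks_apply₂₂, one_apply, a3]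
      refine if_congr ?_ rfl rfl
      rw [Fin.ext_iff]
      omega
  have hdet := det_submatrix_equiv_equiv e₁ e₂ Φ
  rw [hblock, det_fromBlocks_zero₂₁, det_fromBlocks_zero₁₂, det_one, mul_one,
    det_of_isUpperTriangular] at hdet
  · refine ⟨Equiv.Perm.sign (e₁.symm.trans e₂), ?_⟩
    have hT : ∏ p : Fin P, hessT H (p + 1) = ∏ i : Fin P,
        (of fun p' p : Fin P => (H ^ ((p : ℕ) + 1)) (e₁ (Sum.inl p')) (Fin.last m)) i i :=
      Finset.prod_congr rfl fun p _ => ((hH.pow_last p).2 _ (a1 p)).symm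
    rw [hT, hdet, ← mul_assoc, ← Int.cast_mul, ← Units.val_mul, Int.units_mul_self]
    simp
  · intro i j hij
    rw [of_apply]
    refine (hH.pow_last j).1 _ ?_
    rw [a1]
    exact hij

end Psi

/-! ### Existence of the normal form. -/

section NormalForm

variable {F : Type*} [Field F] {m : ℕ}

/-- A Krylov argument. Up to sign the leading principal minors of Kr = (Ae_m, A²e_m, …) are the det
Φ_{k,1}. As they do not vanish, Kr factors as N T⁻¹ with N lower unitriangular and T upper
triangular, and multiplication by A shifts the columns of Kr. -/
theorem exists_isHess_conj (A : Matrix (Fin (m + 1)) (Fin (m + 1)) F)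
    (hA : ∀ k (hk : k + 1 ≤ m + 1), (phiMat A hk).det ≠ 0) :
    ∃ N N' : Matrix (Fin (m + 1)) (Fin (m + 1)) F,
      N * N' = 1 ∧ N' * N = 1 ∧ IsLowerUni N ∧ IsHess (N' * A * N) := by
  let Ap (p : Fin (m + 1)) : Matrix (Fin (m + 1)) (Fin (m + 1)) F :=
    of fun s j => if j ≤ p then (A ^ ((j : ℕ) + 1)) s (Fin.last m) else (1 : Matrix _ _ F) s j
  let Kr : Matrix (Fin (m + 1)) (Fin (m + 1)) F :=
    of fun s j => (A ^ ((j : ℕ) + 1)) s (Fin.last m)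
  -- `Ap p` is Φ_{m-p,1} with its columns rotated cyclically.
  have hAp (p : Fin (m + 1)) : IsUnit (Ap p).det := by
    have e : Ap p = (phiMat A (k := m - p) (l := 1) (by omega)).submatrix id
        (Equiv.addRight (⟨m - p, by omega⟩ : Fin (m + 1))) := by
      ext s j
      have hv : ((Equiv.addRight (⟨m - p, by omega⟩ : Fin (m + 1)) j : Fin (m + 1)) : ℕ) =
          if j ≤ p then j + (m - p) else j - p - 1 := by
        rw [Equiv.coe_addRight, Fin.val_add]
        simp only
        split_ifs with h
        · rw [Fin.le_def] at h
          rw [Nat.mod_eq_of_lt (by omega)]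
        · rw [Fin.le_def] at h
          rw [Nat.mod_eq_sub_mod (by omega), Nat.mod_eq_of_lt (by omega)]
          omega
      simp only [submatrix_apply, id, phiMat, of_apply, Ap]
      split_ifs with h
      · rw [if_pos h] at hv
        rw [Fin.le_def] at h
        have h1 : phiExp (m - p) 1 (Equiv.addRight (⟨m - p, by omega⟩ : Fin (m + 1)) j) =
            j + 1 := by
          rw [phiExp, hv]
          split_ifs <;> omega
        have h2 : phiCol (m := m) (k := m - p) (l := 1) (by omega)
            (Equiv.addRight (⟨m - p, by omega⟩ : Fin (m + 1)) j) = Fin.last m := by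
          apply Fin.ext
          simp only [phiCol, hv, Fin.val_last]
          split_ifs <;> omega
        rw [h1, h2]
      · rw [if_neg h] at hv
        rw [Fin.le_def] at h
        have h1 : phiExp (m - p) 1 (Equiv.addRight (⟨m - p, by omega⟩ : Fin (m + 1)) j) = 0 := by
          rw [phiExp, hv]
          split_ifs <;> omega
        have h2 : phiCol (m := m) (k := m - p) (l := 1) (by omega)
            (Equiv.addRight (⟨m - p, by omega⟩ : Fin (m + 1)) j) = j := by
          apply Fin.ext
          simp only [phiCol, hv]
          split_ifs <;> omega
        rw [h1, h2, pow_zero]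
    rw [e, det_permute', isUnit_iff_ne_zero]
    refine mul_ne_zero ?_ (hA _ _)
    rcases Int.units_eq_one_or (Equiv.Perm.sign (Equiv.addRight (⟨m - p, by omega⟩ : Fin (m + 1))))
      with h | h <;> rw [h] <;> simp
  -- Column p of the inverse of `Ap p` writes e_p through the first p + 1 columns of Kr and the unit
  -- vectors after e_p. The coefficients of the first kind form column p of T, those of the second
  -- kind, negated, column p of N.
  let T : Matrix (Fin (m + 1)) (Fin (m + 1)) F := of fun i p => if i ≤ p then (Ap p)⁻¹ i p else 0
  let N : Matrix (Fin (m + 1)) (Fin (m + 1)) F :=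
    of fun j p => if p < j then -(Ap p)⁻¹ j p else if j = p then 1 else 0
  have hN : IsLowerUni N := by
    refine ⟨fun i j hij => ?_, fun i => ?_⟩
    · simp only [N, of_apply, if_neg (not_lt_of_gt hij), if_neg hij.ne]
    · simp [N]
  have hNKT : N = Kr * T := by
    ext s p
    have h1 := congr_fun (congr_fun (mul_nonsing_inv (Ap p) (hAp p)) s) p
    rw [mul_apply] at h1
    have h2 : ∀ i, Ap p s i * (Ap p)⁻¹ i p =
        Kr s i * T i p + if p < i then (if s = i then (Ap p)⁻¹ i p else 0) else 0 := by
      intro i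
      simp only [Ap, Kr, T, of_apply, one_apply]
      by_cases h : i ≤ p
      · simp [h, not_lt_of_ge h]
      · simp [h, lt_of_not_ge h]
    rw [Finset.sum_congr rfl fun i _ => h2 i, Finset.sum_add_distrib, ← mul_apply] at h1
    have h3 : (∑ i, if p < i then (if s = i then (Ap p)⁻¹ i p else 0) else 0) =
        if p < s then (Ap p)⁻¹ s p else 0 := by
      rw [Finset.sum_eq_single s]
      · simp
      · intro i _ hi
        simp [hi.symm]
      · simp
    rw [h3, one_apply] at h1
    simp only [N, of_apply]
    split_ifs at h1 ⊢ with h4 h5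
    · exact absurd h5 h4.ne'
    · linear_combination -h1
    · linear_combination -h1
    · linear_combination -h1
  have hdetN : IsUnit N.det := by rw [hN.det]; exact isUnit_one
  have hdetT : IsUnit T.det := by
    rw [hNKT, det_mul] at hdetN
    exact isUnit_of_mul_isUnit_right hdetN
  have hTri : T⁻¹.BlockTriangular id := by
    have hT : T.BlockTriangular id := fun i j hij => by
      simp only [T, of_apply]
      exact if_neg (not_le_of_gt hij)
    have := T.invertibleOfIsUnitDet hdetT
    exact blockTriangular_inv_of_blockTriangular hT
  have hKr : N⁻¹ * Kr = T⁻¹ := by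
    have : Kr = N * T⁻¹ := by
      rw [hNKT, Matrix.mul_assoc, mul_nonsing_inv _ hdetT, Matrix.mul_one]
    rw [this, ← Matrix.mul_assoc, nonsing_inv_mul _ hdetN, Matrix.one_mul]
  refine ⟨N, N⁻¹, mul_nonsing_inv _ hdetN, nonsing_inv_mul _ hdetN, hN, ?_⟩
  -- As N = Kr T, the left side is a column of N⁻¹ A Kr, that is, the next column of N⁻¹ Kr = T⁻¹.
  have hHT (i : Fin (m + 1)) (j : Fin m) :
      (N⁻¹ * A * N * T⁻¹) i j.castSucc = T⁻¹ i j.succ := by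
    have e : N⁻¹ * A * N * T⁻¹ = N⁻¹ * (A * Kr) := by
      rw [hNKT, Matrix.mul_assoc, Matrix.mul_assoc, Matrix.mul_assoc Kr, mul_nonsing_inv _ hdetT,
        Matrix.mul_one]
    rw [e, ← hKr, mul_apply, mul_apply]
    refine Finset.sum_congr rfl fun s _ => ?_
    congr 1
    simp only [Kr, of_apply, mul_apply]
    rw [Fin.val_succ, pow_succ' A (j + 1), mul_apply]
    rfl
  refine ⟨fun i j hij => ?_, fun i hi => ?_⟩
  · have hjm : (j : ℕ) < m := by omega
    have e : N⁻¹ * A * N = N⁻¹ * A * N * T⁻¹ * T := by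
      rw [Matrix.mul_assoc (N⁻¹ * A * N), nonsing_inv_mul _ hdetT, Matrix.mul_one]
    rw [e, mul_apply]
    refine Finset.sum_eq_zero fun r _ => ?_
    by_cases hr : r ≤ j
    · rw [Fin.le_def] at hr
      have hr' : r = (⟨r, by omega⟩ : Fin m).castSucc := rfl
      rw [hr', hHT, hTri, zero_mul]
      rw [id, id, Fin.lt_def, Fin.val_succ]
      simp only
      omega
    · simp only [T, of_apply, if_neg hr, mul_zero]
  · have hcol : ∀ s, N s (Fin.last m) = if s = Fin.last m then 1 else 0 := by
      intro s
      simp only [N, of_apply]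
      rw [if_neg (not_lt_of_ge (Fin.le_last s))]
    have e : (N⁻¹ * A * N) i (Fin.last m) = (N⁻¹ * Kr) i 0 := by
      rw [mul_apply, Finset.sum_eq_single (Fin.last m)]
      · rw [hcol, if_pos rfl, mul_one, mul_apply, mul_apply]
        refine Finset.sum_congr rfl fun s _ => ?_
        simp [Kr]
      · intro b _ hb
        rw [hcol, if_neg hb, mul_zero]
      · simp
    rw [e, hKr, hTri]
    exact Fin.pos_of_ne_zero hi

/-- For k = 0, l = 1 the minor is empty, and each of the entries divides det Φ_{0,1}. -/
theorem IsHess.hessB_ne_zero {H : Matrix (Fin (m + 1)) (Fin (m + 1)) F} (hH : IsHess H)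
    (h : (phiMat H (k := 0) (l := 1) (by omega)).det ≠ 0) (j : Fin (m + 1)) : hessB H j ≠ 0 := by
  obtain ⟨ε, hε⟩ := hH.det_phiMat (P := m + 1) (a := 0) (k := 0) rfl (by omega)
  intro hj
  refine h (hε.trans ?_)
  rw [Finset.prod_eq_zero (Finset.mem_univ j), zero_mul, mul_zero]
  rw [hessT_succ, hj, zero_mul]

end NormalForm

/-! ### Nonvanishing -/

section Nonvanishing

/-- The entries of the minor are distinct variables, so it is a generic determinant up to renaming.
-/
theorem det_submatrix_matW_ne_zero {T : Type*} [Fintype T] [DecidableEq T] {r : T → Fin n}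
    {c : T → Fin n ⊕ Fin n} (hr : Function.Injective r) (hc : Function.Injective c) :
    ((matW n).submatrix r c).det ≠ 0 := by
  let v : T × T → Coord n := fun p =>
    Sum.map (fun j => (r p.1, j)) (fun j => (r p.1, j)) (c p.2)
  have hv : Function.Injective v := by
    rintro ⟨s, t⟩ ⟨s', t'⟩ h
    simp only [v] at h
    rcases h1 : c t with j | j <;> rcases h2 : c t' with j' | j' <;> rw [h1, h2] at h <;>
      simp only [Sum.map_inl, Sum.map_inr, Sum.inl.injEq, Sum.inr.injEq, Prod.mk.injEq,
        reduceCtorEq] at h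
    · exact Prod.ext (hr h.1) (hc (by rw [h1, h2, h.2]))
    · exact Prod.ext (hr h.1) (hc (by rw [h1, h2, h.2]))
  have h : (matW n).submatrix r c = (algebraMap (PolyRing n) (RatFun n)).mapMatrix
      ((MvPolynomial.rename v).mapMatrix (Matrix.mvPolynomialX T T ℂ)) := by
    ext i j
    simp only [submatrix_apply, matW, RingHom.mapMatrix_apply, AlgHom.mapMatrix_apply, map_apply,
      mvPolynomialX_apply, MvPolynomial.rename_X, v]
    rcases c j with j | j
    · rfl
    · rfl
  rw [h, ← RingHom.map_det, ← AlgHom.map_det, Ne, FaithfulSMul.algebraMap_eq_zero_iff]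
  intro h0
  rw [← map_zero (MvPolynomial.rename (R := ℂ) v)] at h0
  exact Matrix.det_mvPolynomialX_ne_zero T ℂ (MvPolynomial.rename_injective _ hv h0)

theorem gFun_ne_zero {i j : ℕ} (h : 1 ≤ j ∧ j ≤ i ∧ i ≤ n) : gFun n i j ≠ 0 := by
  rw [gFun_eq h]
  refine det_submatrix_matW_ne_zero (r := gRow h) (c := fun t => Sum.inl (gCol h t))
    (fun s s' hs => ?_) fun s s' hs => ?_
  · simp only [gRow, Fin.ext_iff] at hs
    exact Fin.ext (by omega)
  · simp only [gCol, Sum.inl.injEq, Fin.ext_iff] at hs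
    exact Fin.ext (by omega)

theorem hFun_ne_zero {i j : ℕ} (h : 1 ≤ i ∧ i ≤ j ∧ j ≤ n) : hFun n i j ≠ 0 := by
  rw [hFun_eq h]
  refine det_submatrix_matW_ne_zero (r := gCol h) (c := fun t => Sum.inr (gRow h t))
    (fun s s' hs => ?_) fun s s' hs => ?_
  · simp only [gCol, Fin.ext_iff] at hs
    exact Fin.ext (by omega)
  · simp only [gRow, Sum.inr.injEq, Fin.ext_iff] at hs
    exact Fin.ext (by omega)

theorem fCol_injective {k l : ℕ} (h : k + l ≤ n) : Function.Injective (fCol h) := by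
  intro s s' hs
  simp only [fCol] at hs
  split_ifs at hs <;> simp only [Sum.inl.injEq, Sum.inr.injEq, Fin.mk.injEq] at hs <;>
    exact Fin.ext (by omega)

theorem fFun_ne_zero {k l : ℕ} (h : k + l ≤ n) : fFun n k l ≠ 0 := by
  rw [fFun_eq h]
  refine det_submatrix_matW_ne_zero (fun s s' hs => ?_) (fCol_injective h)
  simp only [fRow, Fin.ext_iff] at hs
  exact Fin.ext (by omega)

theorem exists_det_phiMat_ne_zero (m : ℕ) {P a k : ℕ} (h : P + (a + k) = m + 1) (hP : 1 ≤ P) :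
    ∃ H : Matrix (Fin (m + 1)) (Fin (m + 1)) ℂ,
      (phiMat H (k := k) (l := a + 1) (by omega)).det ≠ 0 := by
  -- The first two alternatives make every `hessB` equal to 1; the third puts ones on the diagonal
  -- of the minor, which remains lower unitriangular.
  let H : Matrix (Fin (m + 1)) (Fin (m + 1)) ℂ := of fun i j =>
    if (i : ℕ) = j + 1 ∨ ((i : ℕ) = 0 ∧ (j : ℕ) = m) ∨ ((i : ℕ) + (m - a) = P + j ∧ (j : ℕ) < m)
    then 1 else 0
  have hH : IsHess H := by
    refine ⟨fun i j hij => ?_, fun i hi => ?_⟩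
    · simp only [H, of_apply]
      rw [if_neg]
      omega
    · have : (i : ℕ) ≠ 0 := fun h => hi (Fin.ext h)
      simp only [H, of_apply, Fin.val_last]
      rw [if_neg]
      omega
  obtain ⟨ε, hε⟩ := hH.det_phiMat h hP
  have hb (j : Fin (m + 1)) : hessB H j = 1 := by
    induction j using Fin.cases with
    | zero => rw [hessB_zero]; simp [H]
    | succ j => rw [hessB_succ]; simp [H]
  have hT (p : ℕ) : hessT H p = 1 := Finset.prod_eq_one fun j _ => hb j
  have hμ : (H.submatrix (muRow (P := P) (a := a) (by omega)) (muCol (by omega))).det = 1 := by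
    refine IsLowerUni.det ⟨fun i j hij => ?_, fun i => ?_⟩
    · rw [Fin.lt_def] at hij
      simp only [submatrix_apply, H, of_apply, muRow, muCol]
      rw [if_neg]
      omega
    · simp only [submatrix_apply, H, of_apply, muRow, muCol]
      rw [if_pos]
      omega
  refine ⟨H, ?_⟩
  rw [hε, hμ, Finset.prod_eq_one fun p _ => hT _]
  rcases Int.units_eq_one_or ε with h | h <;> rw [h] <;> simp

theorem det_phiMat_smul {R : Type*} [CommRing R] {m : ℕ} (x : R)
    (A : Matrix (Fin (m + 1)) (Fin (m + 1)) R) {k l : ℕ} (h : k + l ≤ m + 1) :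
    (phiMat (x • A) h).det = (phiMat A h).det * ∏ t : Fin (m + 1), x ^ phiExp k l t := by
  rw [← det_diagonal, ← det_mul]
  congr 1
  ext s t
  rw [mul_diagonal, phiMat, phiMat, of_apply, of_apply, smul_pow, Matrix.smul_apply, smul_eq_mul,
    mul_comm]

/-- U has denominators, so the polynomial matrix adj(X)Y = det X · U is evaluated at X = 1, Y = u;
homogeneity of each column removes the powers of det X. -/
theorem det_phiMat_matU_ne_zero {m k l : ℕ} (hl : 1 ≤ l) (h : k + l ≤ m + 1) :
    (phiMat (matU (m + 1)) h).det ≠ 0 := by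
  obtain ⟨a, rfl⟩ : ∃ a, l = a + 1 := ⟨l - 1, by omega⟩
  obtain ⟨u, hu⟩ := exists_det_phiMat_ne_zero m (P := m + 1 - k - a) (a := a) (k := k) (by omega)
    (by omega)
  let Xp : Matrix (Fin (m + 1)) (Fin (m + 1)) (PolyRing (m + 1)) :=
    of fun i j => MvPolynomial.X (Sum.inl (i, j))
  let Yp : Matrix (Fin (m + 1)) (Fin (m + 1)) (PolyRing (m + 1)) :=
    of fun i j => MvPolynomial.X (Sum.inr (i, j))
  let ev : PolyRing (m + 1) →ₐ[ℂ] ℂ := MvPolynomial.aeval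
    (Sum.elim (fun p => (1 : Matrix (Fin (m + 1)) (Fin (m + 1)) ℂ) p.1 p.2) fun p => u p.1 p.2)
  have hne : (phiMat (Xp.adjugate * Yp) h).det ≠ 0 := by
    intro h0
    have h1 := det_phiMat_map ev.toRingHom (Xp.adjugate * Yp) h
    rw [h0, map_zero, Matrix.map_mul] at h1
    have hX : Xp.adjugate.map ev.toRingHom = 1 := by
      have := RingHom.map_adjugate ev.toRingHom Xp
      rw [RingHom.mapMatrix_apply, RingHom.mapMatrix_apply] at this
      rw [this]
      have : Xp.map ev.toRingHom = 1 := by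
        ext i j
        simp [Xp, ev]
      rw [this, adjugate_one]
    have hY : Yp.map ev.toRingHom = u := by
      ext i j
      simp [Yp, ev]
    rw [hX, hY, Matrix.one_mul] at h1
    exact hu h1
  have hmap := det_phiMat_map (algebraMap (PolyRing (m + 1)) (RatFun (m + 1)))
    (Xp.adjugate * Yp) h
  have hU : (Xp.adjugate * Yp).map (algebraMap (PolyRing (m + 1)) (RatFun (m + 1))) =
      (matX (m + 1)).det • matU (m + 1) := by
    have hX : (algebraMap (PolyRing (m + 1)) (RatFun (m + 1))).mapMatrix Xp = matX (m + 1) := rfl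
    have hY : Yp.map (algebraMap (PolyRing (m + 1)) (RatFun (m + 1))) = matY (m + 1) := rfl
    rw [Matrix.map_mul, hY, ← RingHom.mapMatrix_apply, RingHom.map_adjugate, hX, matU, inv_def,
      smul_mul, smul_smul, Ring.mul_inverse_cancel _ (isUnit_det_matX _), one_smul]
  rw [hU, det_phiMat_smul] at hmap
  intro h0
  rw [h0, zero_mul] at hmap
  exact hne ((FaithfulSMul.algebraMap_eq_zero_iff _ _).1 hmap.symm)

theorem signPhi_ne_zero (k l : ℕ) : (signPhi n k l : RatFun n) ≠ 0 := by
  rw [signPhi]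
  split_ifs <;> simp

theorem phiFun_eq {m k l : ℕ} (h : k + l ≤ m + 1) : phiFun (m + 1) k l =
    (signPhi (m + 1) k l : RatFun (m + 1)) * (matX (m + 1)).det ^ (m + 1 - k - l + 1) *
      (phiMat (matU (m + 1)) h).det := by
  rw [phiFun, matPhi_eq h]

end Nonvanishing

/-! ### Lower triangular matrices and rigidity of the normal form. -/

section Lower

variable {R : Type*} [CommRing R] {m : ℕ}

theorem IsHess.sub {A B : Matrix (Fin (m + 1)) (Fin (m + 1)) R} (hA : IsHess A) (hB : IsHess B) :
    IsHess (A - B) :=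
  ⟨fun i j h => by rw [Matrix.sub_apply, hA.zero i j h, hB.zero i j h, sub_zero],
    fun i h => by rw [Matrix.sub_apply, hA.last i h, hB.last i h, sub_zero]⟩

theorem IsHess.map {A : Matrix (Fin (m + 1)) (Fin (m + 1)) R} (hA : IsHess A) {S : Type*}
    [CommRing S] {σ : R → S} (hσ : σ 0 = 0) : IsHess (A.map σ) :=
  ⟨fun i j h => by rw [map_apply, hA.zero i j h, hσ], fun i h => by rw [map_apply, hA.last i h, hσ]⟩

theorem lower_mul {A B : Matrix (Fin m) (Fin m) R} (hA : ∀ i j, i < j → A i j = 0)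
    (hB : ∀ i j, i < j → B i j = 0) :
    (∀ i j, i < j → (A * B) i j = 0) ∧ ∀ i, (A * B) i i = A i i * B i i := by
  refine ⟨fun i j hij => ?_, fun i => ?_⟩
  · rw [mul_apply]
    refine Finset.sum_eq_zero fun s _ => ?_
    rcases lt_or_ge i s with h | h
    · rw [hA i s h, zero_mul]
    · rw [hB s j (h.trans_lt hij), mul_zero]
  · rw [mul_apply]
    refine Finset.sum_eq_single i (fun s _ hs => ?_) fun h => absurd (Finset.mem_univ i) h
    rcases lt_or_gt_of_ne hs with h | h
    · rw [hB s i h, mul_zero]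
    · rw [hA i s h, zero_mul]

theorem IsLowerUni.of_mul_eq_one {N N' : Matrix (Fin m) (Fin m) R} (hN : IsLowerUni N)
    (h : N * N' = 1) : IsLowerUni N' := by
  have hlow : ∀ i j, i < j → N' i j = 0 := by
    intro i
    induction i using WellFoundedLT.induction with
    | ind i ih =>
      intro j hij
      have h1 := congr_fun (congr_fun h i) j
      rw [mul_apply, one_apply_ne hij.ne, Finset.sum_eq_single i, hN.one, one_mul] at h1
      · exact h1
      · intro s _ hs
        rcases lt_or_gt_of_ne hs with h' | h'
        · rw [ih s h' j (h'.trans hij), mul_zero]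
        · rw [hN.zero i s h', zero_mul]
      · intro h'
        exact absurd (Finset.mem_univ i) h'
  refine ⟨hlow, fun i => ?_⟩
  have h1 := (lower_mul hN.zero hlow).2 i
  rw [h, one_apply_eq, hN.one, one_mul] at h1
  exact h1.symm

/-- Infinitesimal uniqueness of N. The last column of the commutator gives d_{i,0} b_0 = 0; once the
columns up to j of d vanish, the entries of column j below the subdiagonal give d_{i,j+1} b_{j+1} =
0. -/
theorem IsHess.eq_zero_of_commutator {F : Type*} [Field F]
    {H d : Matrix (Fin (m + 1)) (Fin (m + 1)) F} (hH : IsHess H) (hb : ∀ j, hessB H j ≠ 0)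
    (hd : ∀ i j, i ≤ j → d i j = 0) (h : IsHess (H * d - d * H)) : d = 0 := by
  have hcol : ∀ j i, d i j = 0 := by
    intro j
    induction j using WellFoundedLT.induction with
    | ind j ih =>
      intro i
      induction j using Fin.cases with
      | zero =>
        by_cases hi : i = 0
        · exact hd i 0 hi.le
        · have h1 := h.last i hi
          rw [Matrix.sub_apply, mul_apply, mul_apply, Finset.sum_eq_zero, zero_sub, neg_eq_zero,
            Finset.sum_eq_single 0] at h1
          · exact (mul_eq_zero.1 h1).resolve_right (hessB_zero H ▸ hb 0)
          · intro s _ hs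
            rw [hH.last s hs, mul_zero]
          · simp
          · intro s _
            rw [hd s _ (Fin.le_last s), mul_zero]
      | succ j =>
        by_cases hi : i ≤ j.succ
        · exact hd i _ hi
        · rw [Fin.le_def, Fin.val_succ] at hi
          have h1 := h.zero i j.castSucc (by rw [Fin.val_castSucc]; omega)
          rw [Matrix.sub_apply, mul_apply, mul_apply, Finset.sum_eq_zero, zero_sub, neg_eq_zero,
            Finset.sum_eq_single j.succ] at h1
          · exact (mul_eq_zero.1 h1).resolve_right (hessB_succ H j ▸ hb j.succ)
          · intro s _ hs
            rcases lt_or_gt_of_ne hs with h' | h'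
            · rw [ih s h' i, zero_mul]
            · rw [hH.zero s j.castSucc, mul_zero]
              rw [Fin.lt_def, Fin.val_succ] at h'
              rw [Fin.val_castSucc]
              omega
          · simp
          · intro s _
            rw [ih j.castSucc (Fin.castSucc_lt_succ) s, mul_zero]
  ext i j
  exact hcol j i

end Lower

/-! ### How derivations act on U and on its normal form. -/

section Derivations

/-- Square matrices of rational functions. -/
abbrev RatMat (n : ℕ) : Type := Matrix (Fin n) (Fin n) (RatFun n)

/-- Derivations of the field of rational functions. -/
abbrev RatDer (n : ℕ) : Type := Derivation ℂ (RatFun n) (RatFun n)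

variable {m : ℕ}

theorem map_matU (D : RatDer (m + 1)) : (matU (m + 1)).map D =
    (matX (m + 1))⁻¹ * ((matY (m + 1)).map D - (matX (m + 1)).map D * matU (m + 1)) := by
  have h := isUnit_det_matX (m + 1)
  have h1 : matX (m + 1) * matU (m + 1) = matY (m + 1) := by
    rw [matU, ← Matrix.mul_assoc, mul_nonsing_inv _ h, Matrix.one_mul]
  have h2 : matX (m + 1) * (matU (m + 1)).map D =
      (matY (m + 1)).map D - (matX (m + 1)).map D * matU (m + 1) := by
    rw [← h1, map_derivation_mul]
    abel
  rw [← h2, ← Matrix.mul_assoc, nonsing_inv_mul _ h, Matrix.one_mul]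

/-- `N⁻¹ U N` is a Hessenberg matrix whose last column is a multiple of the first unit vector. -/
structure IsNormalizer (N N' : RatMat (m + 1)) : Prop where
  mul : N * N' = 1
  mul' : N' * N = 1
  lower : IsLowerUni N
  hess : IsHess (N' * matU (m + 1) * N)

theorem exists_isNormalizer (m : ℕ) : ∃ N N' : RatMat (m + 1), IsNormalizer N N' := by
  obtain ⟨N, N', h1, h2, h3, h4⟩ := exists_isHess_conj (matU (m + 1))
    fun k hk => det_phiMat_matU_ne_zero le_rfl hk
  exact ⟨N, N', h1, h2, h3, h4⟩

namespace IsNormalizer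

variable {N N' : RatMat (m + 1)} (hN : IsNormalizer N N')
include hN

theorem det_phiMat {k l : ℕ} (hl : 1 ≤ l) (h : k + l ≤ m + 1) :
    (phiMat (matU (m + 1)) h).det = (phiMat (N' * matU (m + 1) * N) h).det :=
  (det_phiMat_conj hN.mul hN.mul' hN.lower hl h).symm

theorem hessB_ne_zero (j : Fin (m + 1)) : hessB (N' * matU (m + 1) * N) j ≠ 0 := by
  refine hN.hess.hessB_ne_zero ?_ j
  rw [← hN.det_phiMat le_rfl]
  exact det_phiMat_matU_ne_zero le_rfl _

/-- Differentiating H = N'UN gives DH = N'(DU)N + [H, N'DN] with N'DN strictly lower triangular.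
Thus DH - Z₀ is the commutator of H with ν + N'DN; it has Hessenberg shape, so ν + N'DN = 0 by
rigidity. N'DN itself is never needed. -/
theorem map_hess (D : RatDer (m + 1)) {Z₀ ν : RatMat (m + 1)} (hν : ∀ i j, i ≤ j → ν i j = 0)
    (hZ : IsHess Z₀) (h : N' * (matU (m + 1)).map D * N =
      Z₀ + (N' * matU (m + 1) * N * ν - ν * (N' * matU (m + 1) * N))) :
    (N' * matU (m + 1) * N).map D = Z₀ := by
  set H := N' * matU (m + 1) * N with hH
  have hN'low := hN.lower.of_mul_eq_one hN.mul
  have hDN' : N'.map D = -(N' * N.map D * N') := by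
    have h1 := map_derivation_mul D N' N
    rw [hN.mul', map_derivation_one] at h1
    have h2 : N'.map D * N * N' = -(N' * N.map D) * N' := by
      rw [eq_neg_of_add_eq_zero_left h1.symm]
    rwa [Matrix.mul_assoc, hN.mul, Matrix.mul_one, Matrix.neg_mul] at h2
  have hDH : H.map D = Z₀ + (H * (ν + N' * N.map D) - (ν + N' * N.map D) * H) := by
    have e : H * (N' * N.map D) = N' * matU (m + 1) * N.map D := by
      rw [hH, ← Matrix.mul_assoc, Matrix.mul_assoc (N' * _) N, hN.mul, Matrix.mul_one]
    have e' : N' * N.map D * H = N' * N.map D * N' * matU (m + 1) * N := by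
      rw [hH]
      simp only [Matrix.mul_assoc]
    rw [Matrix.mul_add, Matrix.add_mul, e, e', hH, map_derivation_mul, map_derivation_mul, hDN',
      Matrix.add_mul, h]
    simp only [Matrix.neg_mul]
    abel
  have hd : ν + N' * N.map D = 0 := by
    refine hN.hess.eq_zero_of_commutator hN.hessB_ne_zero (fun i j hij => ?_) ?_
    · rw [Matrix.add_apply, hν i j hij, zero_add, mul_apply]
      refine Finset.sum_eq_zero fun s _ => ?_
      rcases lt_or_ge i s with h' | h'
      · rw [hN'low.zero i s h', zero_mul]
      · rw [map_apply]
        rcases (h'.trans hij).lt_or_eq with h'' | h''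
        · rw [hN.lower.zero s j h'', map_zero, mul_zero]
        · rw [h'', hN.lower.one, Derivation.map_one_eq_zero, mul_zero]
    · rw [eq_sub_iff_add_eq'.2 hDH.symm]
      exact (hN.hess.map (map_zero D)).sub hZ
  rw [hDH, hd]
  simp

end IsNormalizer

theorem map_matU_vf_mul_right (Z : RatMat (m + 1)) :
    (matU (m + 1)).map (vf (matX (m + 1) * Z) (matY (m + 1) * Z)) =
      matU (m + 1) * Z - Z * matU (m + 1) := by
  rw [map_matU, map_vf_matX, map_vf_matY, Matrix.mul_sub, ← Matrix.mul_assoc,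
    Matrix.mul_assoc (matX (m + 1)), ← Matrix.mul_assoc _ (matX (m + 1)),
    nonsing_inv_mul _ (isUnit_det_matX _), Matrix.one_mul]
  rfl

theorem map_matU_vf_mul_left (Z : RatMat (m + 1)) :
    (matU (m + 1)).map (vf (Z * matX (m + 1)) (Z * matY (m + 1))) = 0 := by
  rw [map_matU, map_vf_matX, map_vf_matY, matU, Matrix.mul_assoc Z, ← Matrix.mul_assoc (matX _),
    mul_nonsing_inv _ (isUnit_det_matX _), Matrix.one_mul, sub_self, Matrix.mul_zero]

theorem map_matU_vf_zero (Z : RatMat (m + 1)) :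
    (matU (m + 1)).map (vf 0 (matY (m + 1) * Z)) = matU (m + 1) * Z := by
  rw [map_matU, map_vf_matX, map_vf_matY, Matrix.zero_mul, sub_zero, ← Matrix.mul_assoc]
  rfl

/-- The derivation `D` multiplies `x` by an integer multiple of `s`. -/
def LogDeriv (D : RatDer (m + 1)) (s x : RatFun (m + 1)) : Prop := ∃ k : ℤ, D x = k * s * x

theorem LogDeriv.mul {D : RatDer (m + 1)} {s x y : RatFun (m + 1)} (hx : LogDeriv D s x)
    (hy : LogDeriv D s y) : LogDeriv D s (x * y) := by
  obtain ⟨a, ha⟩ := hx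
  obtain ⟨b, hb⟩ := hy
  refine ⟨a + b, ?_⟩
  rw [Derivation.leibniz, ha, hb]
  push_cast
  simp only [smul_eq_mul]
  ring

theorem LogDeriv.intCast (D : RatDer (m + 1)) (s : RatFun (m + 1)) (z : ℤ) : LogDeriv D s
    (z : RatFun (m + 1)) :=
  ⟨0, by simp⟩

theorem LogDeriv.prod {ι : Type*} {D : RatDer (m + 1)} {s : RatFun (m + 1)} {t : Finset ι}
    {f : ι → RatFun (m + 1)}
    (h : ∀ i ∈ t, LogDeriv D s (f i)) : LogDeriv D s (∏ i ∈ t, f i) :=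
  Finset.prod_induction f (LogDeriv D s) (fun _ _ => LogDeriv.mul)
    (by simpa using LogDeriv.intCast D s 1) h

theorem LogDeriv.hessT {D : RatDer (m + 1)} {s : RatFun (m + 1)} {H : RatMat (m + 1)}
    (h : ∀ j, LogDeriv D s (hessB H j)) (p : ℕ) : LogDeriv D s (hessT H p) :=
  LogDeriv.prod fun j _ => h j

theorem derivation_hessB (D : RatDer (m + 1)) (H : RatMat (m + 1)) (j : Fin (m + 1)) :
    D (hessB H j) = hessB (H.map D) j := rfl

theorem derivation_phiFun (D : RatDer (m + 1)) {k l : ℕ} (h : k + l ≤ m + 1) {t u : RatFun (m + 1)}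
    (ht : D (matX (m + 1)).det = t * (matX (m + 1)).det)
    (hu : D (phiMat (matU (m + 1)) h).det = u * (phiMat (matU (m + 1)) h).det) :
    D (phiFun (m + 1) k l) = (((m + 1 - k - l + 1 : ℕ) : ℤ) * t + u) * phiFun (m + 1) k l := by
  have h1 : D (signPhi (m + 1) k l : RatFun (m + 1)) = 0 := Derivation.map_intCast D _
  rw [phiFun_eq h, Derivation.leibniz, Derivation.leibniz, Derivation.leibniz_pow, h1, ht, hu]
  rw [Nat.add_sub_cancel, pow_succ]
  simp only [smul_eq_mul, nsmul_eq_mul]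
  push_cast
  ring

end Derivations

/-! ### The matrices `eL φ` and `eR φ`, and brackets of φ with minors. -/

section Phi

variable {m : ℕ}

/-- The factor of `ψ_{kl}` that is a minor of the normal form. -/
noncomputable def muFun {P a k : ℕ} (H : RatMat (m + 1)) (h : P + (a + k) = m + 1) (hP : 1 ≤ P) :
    RatFun (m + 1) :=
  (H.submatrix (muRow (P := P) (a := a) (by omega)) (muCol (by omega))).det

/-- The gradient of `muFun`. -/
noncomputable def muGrad {P a k : ℕ} (H : RatMat (m + 1)) (h : P + (a + k) = m + 1) (hP : 1 ≤ P) :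
    RatMat (m + 1) :=
  minorGrad H (muRow (P := P) (a := a) (by omega)) (muCol (by omega))

variable {N N' : RatMat (m + 1)} (hN : IsNormalizer N N') {P a k : ℕ} (h : P + (a + k) = m + 1)
  (hP : 1 ≤ P)

theorem derivation_muFun (D : RatDer (m + 1)) (H : RatMat (m + 1)) :
    D (muFun H h hP) = (muGrad H h hP * H.map D).trace :=
  derivation_minor D H _ _

theorem mem_range_muRow {j : Fin (m + 1)} (hPa : P + a ≤ m + 1) :
    j ∈ Set.range (muRow (P := P) (a := a) hPa) ↔ P ≤ (j : ℕ) ∧ (j : ℕ) < P + a := by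
  constructor
  · rintro ⟨i, rfl⟩
    simp only [muRow]
    omega
  · rintro ⟨h1, h2⟩
    exact ⟨⟨j - P, by omega⟩, Fin.ext (by simp only [muRow]; omega)⟩

theorem mem_range_muCol {j : Fin (m + 1)} (ha : a + 1 ≤ m + 1) :
    j ∈ Set.range (muCol (a := a) ha) ↔ m ≤ (j : ℕ) + a ∧ (j : ℕ) < m := by
  constructor
  · rintro ⟨i, rfl⟩
    simp only [muCol]
    omega
  · rintro ⟨h1, h2⟩
    exact ⟨⟨j - (m - a), by omega⟩, Fin.ext (by simp only [muCol]; omega)⟩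

theorem mul_muGrad_of_notMem (H : RatMat (m + 1)) {i j : Fin (m + 1)}
    (hj : ¬ (P ≤ (j : ℕ) ∧ (j : ℕ) < P + a)) :
    (H * muGrad H h hP) i j = 0 :=
  mul_minorGrad_apply_of_notMem _ _ _ fun h' => hj ((mem_range_muRow _).1 h')

theorem mul_muGrad_of_mem (H : RatMat (m + 1)) {i j : Fin (m + 1)}
    (hi : P ≤ (i : ℕ) ∧ (i : ℕ) < P + a) :
    (H * muGrad H h hP) i j = if i = j then muFun H h hP else 0 := by
  have hPa : P + a ≤ m + 1 := by clear hi; omega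
  obtain ⟨s, rfl⟩ := (mem_range_muRow hPa).2 hi
  exact mul_minorGrad_apply _ _ _ _ _

theorem muGrad_mul_of_notMem (H : RatMat (m + 1)) {i j : Fin (m + 1)}
    (hi : ¬ (m ≤ (i : ℕ) + a ∧ (i : ℕ) < m)) :
    (muGrad H h hP * H) i j = 0 :=
  minorGrad_mul_apply_of_notMem _ _ _ fun h' => hi ((mem_range_muCol _).1 h')

theorem muGrad_mul_of_mem (H : RatMat (m + 1)) {i j : Fin (m + 1)}
    (hj : m ≤ (j : ℕ) + a ∧ (j : ℕ) < m) :
    (muGrad H h hP * H) i j = if i = j then muFun H h hP else 0 := by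
  have ha : a + 1 ≤ m + 1 := by clear hj; omega
  obtain ⟨s, rfl⟩ := (mem_range_muCol ha).2 hj
  exact minorGrad_mul_apply _ _ _ _ _

theorem intMul_mul_muGrad (H : RatMat (m + 1)) (i : Fin (m + 1)) :
    IntMul (muFun H h hP) ((H * muGrad H h hP) i i) := by
  by_cases hi : P ≤ (i : ℕ) ∧ (i : ℕ) < P + a
  · rw [mul_muGrad_of_mem h hP H hi, if_pos rfl]
    exact IntMul.self
  · rw [mul_muGrad_of_notMem h hP H hi]
    exact IntMul.zero

theorem intMul_muGrad_mul (H : RatMat (m + 1)) (i : Fin (m + 1)) :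
    IntMul (muFun H h hP) ((muGrad H h hP * H) i i) := by
  by_cases hi : m ≤ (i : ℕ) + a ∧ (i : ℕ) < m
  · rw [muGrad_mul_of_mem h hP H hi, if_pos rfl]
    exact IntMul.self
  · rw [muGrad_mul_of_notMem h hP H hi]
    exact IntMul.zero

theorem commutator_single_apply (H : RatMat (m + 1)) (i j r c : Fin (m + 1)) :
    (H * single i j (1 : RatFun (m + 1)) - single i j (1 : RatFun (m + 1)) * H) r c =
      (if c = j then H r i else 0) - if r = i then H j c else 0 := by
  rw [Matrix.sub_apply, mul_apply, mul_apply]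
  congr 1
  · rw [Finset.sum_eq_single i]
    · by_cases hc : c = j
      · subst hc
        simp
      · simp [hc, Ne.symm hc]
    · intro b _ hb
      simp [single, hb.symm]
    · simp
  · rw [Finset.sum_eq_single j]
    · by_cases hr : r = i
      · subst hr
        simp
      · simp [hr, Ne.symm hr]
    · intro b _ hb
      simp [single, hb.symm]
    · simp

theorem trace_mul_commutator_single (G H : RatMat (m + 1)) (i j : Fin (m + 1)) :
    (G * (H * single i j (1 : RatFun (m + 1)) - single i j (1 : RatFun (m + 1)) * H)).trace =
      (G * H) j i - (H * G) j i := by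
  rw [Matrix.mul_sub, trace_sub, ← Matrix.mul_assoc, ← apply_eq_trace_mul_single, trace_mul_comm G,
    Matrix.mul_assoc, trace_mul_comm, ← apply_eq_trace_mul_single]

/-- The direction N E_{ij} N' is chosen because, in the frame N, it changes U by the commutator [H,
E_{ij}]; see `conj_map_matU_vf`. -/
theorem conj_eL_apply (i j : Fin (m + 1)) : (N' * eL (phiFun (m + 1) k (a + 1)) * N) j i =
    vf (matX (m + 1) * (N * single i j (1 : RatFun (m + 1)) * N'))
      (matY (m + 1) * (N * single i j (1 : RatFun (m + 1)) * N'))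
      (phiFun (m + 1) k (a + 1)) := by
  rw [← trace_eL_mul]
  refine (apply_eq_trace_mul_single (N' * eL (phiFun (m + 1) k (a + 1)) * N) j i).trans ?_
  rw [Matrix.mul_assoc, Matrix.mul_assoc, trace_mul_comm]
  simp only [Matrix.mul_assoc]

include hN

theorem conj_map_matU_vf (Z : RatMat (m + 1)) :
    N' * (matU (m + 1)).map (vf (matX (m + 1) * (N * Z * N')) (matY (m + 1) * (N * Z * N'))) * N =
      N' * matU (m + 1) * N * Z - Z * (N' * matU (m + 1) * N) := by
  rw [map_matU_vf_mul_right, Matrix.mul_sub, Matrix.sub_mul]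
  congr 1
  · calc N' * (matU (m + 1) * (N * Z * N')) * N = N' * matU (m + 1) * N * Z * (N' * N) := by
          simp only [Matrix.mul_assoc]
      _ = _ := by rw [hN.mul', Matrix.mul_one]
  · calc N' * (N * Z * N' * matU (m + 1)) * N = N' * N * Z * (N' * matU (m + 1) * N) := by
          simp only [Matrix.mul_assoc]
      _ = _ := by rw [hN.mul', Matrix.one_mul]

theorem derivation_det_matX_conj (Z : RatMat (m + 1)) :
    vf (matX (m + 1) * (N * Z * N')) (matY (m + 1) * (N * Z * N')) (matX (m + 1)).det =
      Z.trace * (matX (m + 1)).det := by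
  rw [derivation_det_mul_right _ (map_vf_matX _ _), trace_mul_comm, ← Matrix.mul_assoc, hN.mul',
    Matrix.one_mul]

theorem exists_psi_eq : ∃ ε : ℤˣ, (phiMat (matU (m + 1)) (k := k) (l := a + 1) (by omega)).det =
    ((ε : ℤ) : RatFun (m + 1)) * ((∏ p : Fin P, hessT (N' * matU (m + 1) * N) (p + 1)) *
      muFun (N' * matU (m + 1) * N) h hP) := by
  rw [hN.det_phiMat (by omega)]
  exact hN.hess.det_phiMat h hP

theorem muFun_ne_zero : muFun (N' * matU (m + 1) * N) h hP ≠ 0 := by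
  obtain ⟨ε, hε⟩ := exists_psi_eq hN h hP
  intro h0
  rw [h0, mul_zero, mul_zero] at hε
  exact det_phiMat_matU_ne_zero (by omega) _ hε

theorem logDeriv_psi {D : RatDer (m + 1)} {s : RatFun (m + 1)}
    (hb : ∀ j, LogDeriv D s (hessB (N' * matU (m + 1) * N) j))
    (hμ : LogDeriv D s (muFun (N' * matU (m + 1) * N) h hP)) :
    LogDeriv D s (phiMat (matU (m + 1)) (k := k) (l := a + 1) (by omega)).det := by
  obtain ⟨ε, hε⟩ := exists_psi_eq hN h hP
  rw [hε]
  exact (LogDeriv.intCast D s ε).mul ((LogDeriv.prod fun p _ => LogDeriv.hessT hb _).mul hμ)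

theorem derivation_psi_of_hessB {D : RatDer (m + 1)}
    (hb : ∀ j, D (hessB (N' * matU (m + 1) * N) j) = 0) :
    D (phiMat (matU (m + 1)) (k := k) (l := a + 1) (by omega)).det =
      D (muFun (N' * matU (m + 1) * N) h hP) / muFun (N' * matU (m + 1) * N) h hP *
        (phiMat (matU (m + 1)) (k := k) (l := a + 1) (by omega)).det := by
  obtain ⟨ε, hε⟩ := exists_psi_eq hN h hP
  have hμ := muFun_ne_zero hN h hP
  have h0 : LogDeriv D 0 (∏ p : Fin P, hessT (N' * matU (m + 1) * N) (p + 1)) :=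
    LogDeriv.prod fun p _ => LogDeriv.hessT (fun j => ⟨0, by rw [hb]; simp⟩) _
  obtain ⟨z, hz⟩ := h0
  rw [mul_zero, zero_mul] at hz
  rw [hε, Derivation.leibniz, Derivation.leibniz, hz, Derivation.map_intCast]
  simp only [smul_eq_mul]
  field_simp
  ring

theorem derivation_psi_of_map_eq_zero {D : RatDer (m + 1)}
    (hD : (N' * matU (m + 1) * N).map D = 0) :
    D (phiMat (matU (m + 1)) (k := k) (l := a + 1) (by omega)).det = 0 := by
  rw [derivation_psi_of_hessB hN h hP, derivation_muFun, hD, Matrix.mul_zero, trace_zero, zero_div,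
    zero_mul]
  intro j
  rw [derivation_hessB, hD]
  rfl

include h hP

/-- Left multiplication leaves U = X⁻¹Y unchanged, so only the factor (det X)^P contributes. -/
theorem eR_phiFun : eR (phiFun (m + 1) k (a + 1)) =
    (((P : ℤ) : RatFun (m + 1)) * phiFun (m + 1) k (a + 1)) • (1 : RatMat (m + 1)) := by
  refine eq_of_trace_mul_eq fun Z => ?_
  rw [trace_eR_mul, smul_mul, Matrix.one_mul, trace_smul, smul_eq_mul]
  have hH := hN.map_hess (vf (Z * matX (m + 1)) (Z * matY (m + 1))) (Z₀ := 0) (ν := 0)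
    (fun _ _ _ => rfl) ⟨fun _ _ _ => rfl, fun _ _ => rfl⟩ (by
      rw [map_matU_vf_mul_left]
      simp)
  have h1 := derivation_phiFun (vf (Z * matX (m + 1)) (Z * matY (m + 1))) (k := k) (l := a + 1)
    (by omega) (t := Z.trace) (u := 0)
    (derivation_det_mul_left _ (map_vf_matX _ _))
    (by rw [derivation_psi_of_map_eq_zero hN h hP hH, zero_mul])
  rw [h1, show m + 1 - k - (a + 1) + 1 = P by omega]
  ring

/-- E_{ij} is strictly lower triangular here, so its commutator is wholly absorbed by the correction
ν and H does not move. -/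
theorem conj_eL_phiFun_lower {i j : Fin (m + 1)} (hij : j < i) :
    (N' * eL (phiFun (m + 1) k (a + 1)) * N) j i = 0 := by
  rw [conj_eL_apply]
  have hH := hN.map_hess (vf (matX (m + 1) * (N * single i j (1 : RatFun (m + 1)) * N'))
    (matY (m + 1) * (N * single i j (1 : RatFun (m + 1)) * N')))
      (Z₀ := 0) (ν := single i j (1 : RatFun (m + 1)))
    (fun r c hrc => by
      rw [single_apply_of_ne]
      rintro ⟨rfl, rfl⟩
      exact absurd hrc (not_le_of_gt hij))
    ⟨fun _ _ _ => rfl, fun _ _ => rfl⟩ (by rw [conj_map_matU_vf hN, zero_add])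
  have h1 := derivation_phiFun _ (k := k) (l := a + 1) (by omega) (derivation_det_matX_conj hN _)
    (u := 0) (by rw [derivation_psi_of_map_eq_zero hN h hP hH, zero_mul])
  rw [h1, trace_single_eq_of_ne _ _ _ hij.ne']
  ring

/-- The commutator with E_{ii} multiplies each entry of H by -1, 0 or 1, so it respects the normal
form and rescales each b_j and μ. -/
theorem conj_eL_phiFun_diag (i : Fin (m + 1)) : IntMul (phiFun (m + 1) k (a + 1))
    ((N' * eL (phiFun (m + 1) k (a + 1)) * N) i i) := by
  rw [conj_eL_apply]
  set H := N' * matU (m + 1) * N with hHdef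
  have hHess : IsHess H := hN.hess
  set D := vf (matX (m + 1) * (N * single i i (1 : RatFun (m + 1)) * N'))
    (matY (m + 1) * (N * single i i (1 : RatFun (m + 1)) * N')) with hD
  have hent (r c : Fin (m + 1)) :
      ∃ z : ℤ, (H * single i i (1 : RatFun (m + 1)) -
        single i i (1 : RatFun (m + 1)) * H) r c = z * H r c := by
    rw [commutator_single_apply]
    by_cases h1 : c = i <;> by_cases h2 : r = i
    · exact ⟨0, by simp [h1, h2]⟩
    · exact ⟨1, by simp [h1, h2]⟩
    · exact ⟨-1, by simp [h1, h2]⟩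
    · exact ⟨0, by simp [h1, h2]⟩
  have hH : H.map D = H * single i i (1 : RatFun (m + 1)) -
      single i i (1 : RatFun (m + 1)) * H := by
    refine hN.map_hess D (ν := 0) (fun _ _ _ => rfl) ⟨fun r c hrc => ?_, fun r hr => ?_⟩ ?_
    · obtain ⟨z, hz⟩ := hent r c
      rw [hz, hHess.zero r c hrc, mul_zero]
    · obtain ⟨z, hz⟩ := hent r (Fin.last m)
      rw [hz, hHess.last r hr, mul_zero]
    · rw [hD, conj_map_matU_vf hN, ← hHdef]
      simp
  have hψ : LogDeriv D 1 (phiMat (matU (m + 1)) (k := k) (l := a + 1) (by omega)).det := by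
    refine logDeriv_psi hN h hP (fun j => ?_) ?_
    · rw [LogDeriv, derivation_hessB, ← hHdef, hH]
      obtain ⟨z, hz⟩ := hent j (if j = 0 then Fin.last m else j - 1)
      exact ⟨z, by rw [mul_one]; exact hz⟩
    · rw [LogDeriv, derivation_muFun, ← hHdef, hH, trace_mul_commutator_single]
      simp only [mul_one]
      exact (intMul_muGrad_mul h hP H i).sub (intMul_mul_muGrad h hP H i)
  obtain ⟨z, hz⟩ := hψ
  have h1 := derivation_phiFun D (k := k) (l := a + 1) (by omega) (derivation_det_matX_conj hN _) hz
  rw [h1, trace_single_eq_same]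
  exact ⟨(m + 1 - k - (a + 1) + 1 : ℕ) + z, by push_cast; ring⟩

/-- For i < j < m the commutator [H, E_{ij}] already has Hessenberg shape and leaves the b_j fixed,
so only μ varies. For j = m it could spoil the last column. -/
theorem conj_eL_phiFun_apply {i j : Fin (m + 1)} (hij : i < j) (hj : (j : ℕ) < m) :
    (N' * eL (phiFun (m + 1) k (a + 1)) * N) j i =
      phiFun (m + 1) k (a + 1) / muFun (N' * matU (m + 1) * N) h hP *
        ((muGrad (N' * matU (m + 1) * N) h hP * (N' * matU (m + 1) * N)) j i -
          (N' * matU (m + 1) * N * muGrad (N' * matU (m + 1) * N) h hP) j i) := by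
  rw [conj_eL_apply]
  set H := N' * matU (m + 1) * N with hHdef
  have hHess : IsHess H := hN.hess
  set D := vf (matX (m + 1) * (N * single i j (1 : RatFun (m + 1)) * N'))
    (matY (m + 1) * (N * single i j (1 : RatFun (m + 1)) * N')) with hD
  rw [Fin.lt_def] at hij
  have hj0 : j ≠ 0 := fun h0 => by simp [h0] at hij
  have hjl : Fin.last m ≠ j := fun h0 => by rw [← h0, Fin.val_last] at hj; omega
  have hH : H.map D = H * single i j (1 : RatFun (m + 1)) -
      single i j (1 : RatFun (m + 1)) * H := by
    refine hN.map_hess D (ν := 0) (fun _ _ _ => rfl) ⟨fun r c hrc => ?_, fun r hr => ?_⟩ ?_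
    · rw [commutator_single_apply]
      have e1 : (if c = j then H r i else 0) = 0 := by
        split_ifs with hc
        · subst hc
          exact hHess.zero r i (by omega)
        · rfl
      have e2 : (if r = i then H j c else 0) = 0 := by
        split_ifs with hr
        · subst hr
          exact hHess.zero j c (by omega)
        · rfl
      rw [e1, e2, sub_zero]
    · rw [commutator_single_apply, if_neg hjl, hHess.last j hj0, ite_self, sub_zero]
    · rw [hD, conj_map_matU_vf hN, ← hHdef]
      simp
  have hb (r : Fin (m + 1)) : D (hessB H r) = 0 := by
    rw [derivation_hessB, hH]
    induction r using Fin.cases with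
    | zero =>
      rw [hessB_zero, commutator_single_apply, if_neg hjl, hHess.last j hj0, ite_self, sub_zero]
    | succ r =>
      rw [hessB_succ, commutator_single_apply]
      have e1 : (if r.castSucc = j then H r.succ i else 0) = 0 := by
        split_ifs with hc
        · refine hHess.zero _ _ ?_
          rw [← hc, Fin.val_castSucc] at hij
          rw [Fin.val_succ]
          omega
        · rfl
      have e2 : (if r.succ = i then H j r.castSucc else 0) = 0 := by
        split_ifs with hr
        · refine hHess.zero _ _ ?_
          rw [← hr, Fin.val_succ] at hij
          rw [Fin.val_castSucc]
          omega
        · rfl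
      rw [e1, e2, sub_zero]
  have h1 := derivation_phiFun D (k := k) (l := a + 1) (by omega) (derivation_det_matX_conj hN _)
    (derivation_psi_of_hessB hN h hP hb)
  rw [h1, trace_single_eq_of_ne _ _ _ (Fin.lt_def.2 hij).ne, derivation_muFun, ← hHdef, hH,
    trace_mul_commutator_single]
  ring

/-- Conjugation by N preserves lower triangularity and the diagonal of lower triangular matrices. -/
theorem eL_phiFun : (∀ i j, i < j → eL (phiFun (m + 1) k (a + 1)) i j = 0) ∧
    ∀ i, IntMul (phiFun (m + 1) k (a + 1)) (eL (phiFun (m + 1) k (a + 1)) i i) := by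
  have e : eL (phiFun (m + 1) k (a + 1)) =
      N * (N' * eL (phiFun (m + 1) k (a + 1)) * N) * N' := by
    calc _ = N * N' * eL (phiFun (m + 1) k (a + 1)) * (N * N') := by
          rw [hN.mul, Matrix.one_mul, Matrix.mul_one]
      _ = _ := by simp only [Matrix.mul_assoc]
  have hN'low := hN.lower.of_mul_eq_one hN.mul
  have h1 := lower_mul hN.lower.zero (fun i j hij => conj_eL_phiFun_lower hN h hP (i := j) hij)
  have h2 := lower_mul h1.1 hN'low.zero
  rw [← e] at h2
  refine ⟨h2.1, fun i => ?_⟩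
  rw [h2.2, h1.2, hN.lower.one, hN'low.one, one_mul, mul_one]
  exact conj_eL_phiFun_diag hN h hP i

/-- The trace is the derivative along the Euler field of Y; it scales U, hence H, and ψ is
homogeneous in H. -/
theorem trace_y_phiFun : IntMul (phiFun (m + 1) k (a + 1))
    (matY (m + 1) * gradY (phiFun (m + 1) k (a + 1))).trace := by
  set H := N' * matU (m + 1) * N with hHdef
  have e : (matY (m + 1) * gradY (phiFun (m + 1) k (a + 1))).trace =
      vf 0 (matY (m + 1) * 1) (phiFun (m + 1) k (a + 1)) := by
    rw [vf_apply, Matrix.mul_zero, trace_zero, zero_add, trace_mul_comm, Matrix.mul_one]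
  rw [e]
  set D := vf 0 (matY (m + 1) * (1 : RatMat (m + 1))) with hD
  have hH : H.map D = H := by
    refine hN.map_hess D (ν := 0) (fun _ _ _ => rfl) hN.hess ?_
    rw [hD, map_matU_vf_zero, Matrix.mul_one, ← hHdef]
    simp
  have hψ : LogDeriv D 1 (phiMat (matU (m + 1)) (k := k) (l := a + 1) (by omega)).det := by
    refine logDeriv_psi hN h hP (fun j => ?_) ?_
    · rw [LogDeriv, derivation_hessB, ← hHdef, hH]
      exact ⟨1, by simp⟩
    · rw [LogDeriv, derivation_muFun, ← hHdef, hH]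
      simp only [mul_one]
      exact IntMul.sum fun i _ => intMul_muGrad_mul h hP H i
  obtain ⟨z, hz⟩ := hψ
  have hX : D (matX (m + 1)).det = 0 * (matX (m + 1)).det := by
    have h2 := derivation_det_mul_right D (M := matX (m + 1)) (Z := 0) (by
      rw [hD, map_vf_matX, Matrix.mul_zero])
    rwa [trace_zero] at h2
  rw [derivation_phiFun D (k := k) (l := a + 1) (by omega) hX hz]
  exact ⟨z, by ring⟩

/-- `eR φ` is scalar and `eL φ` lower triangular; since J' is a final segment, ∇_Y f · Y is lower
triangular as well, and the trace of the product sees only the diagonals. -/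
theorem logC_phiFun_minor {f : RatFun (m + 1)} {I J J' : Fin (m + 1) → Prop} (hf : IsMinor f I J J')
    (hJ' : ∀ a b, a < b → J' a → J' b) :
    LogC (phiFun (m + 1) k (a + 1)) f (bracket (phiFun (m + 1) k (a + 1)) f) := by
  have hL := eL_phiFun hN h hP
  rw [bracket, eR_phiFun hN h hP, traceForm_rPlus_smul_one]
  have hPφ : IntMul (phiFun (m + 1) k (a + 1))
      (((P : ℤ) : RatFun (m + 1)) * phiFun (m + 1) k (a + 1)) :=
    IntMul.self.intCast_mul _
  refine (((logC_rPlus (fun i j hij => ?_) hL.2 hf.intMul_eL).sub ?_).add ?_).sub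
    (logC_trace_mul (fun i j hij => ?_) hL.2 hf.y_diag)
  · rw [hL.1 i j hij, zero_mul]
  · exact LogC.half hPφ (IntMul.sum fun i _ => hf.intMul_eR i)
  · rw [traceForm, smul_mul, Matrix.one_mul, trace_smul, smul_eq_mul]
    exact LogC.of_intMul hPφ hf.intMul_trace_y
  · rcases lt_or_gt_of_ne hij with h' | h'
    · rw [hL.1 i j h', zero_mul]
    · rw [hf.y_eq_zero h'.ne (hJ' _ _ h'), mul_zero]

end Phi

/-! ### Brackets between two functions φ. -/

section PhiPhi

variable {m : ℕ} {N N' : RatMat (m + 1)} (hN : IsNormalizer N N') {P₁ a₁ k₁ P₂ a₂ k₂ : ℕ}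
  (h₁ : P₁ + (a₁ + k₁) = m + 1) (hP₁ : 1 ≤ P₁) (h₂ : P₂ + (a₂ + k₂) = m + 1) (hP₂ : 1 ≤ P₂)

/-- A nonzero product needs j in the first row interval but not in the second, and i in the second
but not in the first. With j < i this forces the position excluded by `hc`. -/
theorem trace_muGrad_eq_zero (H : RatMat (m + 1)) (hc : ¬ (P₁ < P₂ ∧ P₁ + a₁ < P₂ + a₂))
    {i j : Fin (m + 1)} (hij : j < i) :
    (H * muGrad H h₁ hP₁) i j * (H * muGrad H h₂ hP₂) j i = 0 := by
  rw [Fin.lt_def] at hij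
  by_cases e1 : P₁ ≤ (j : ℕ) ∧ (j : ℕ) < P₁ + a₁
  · by_cases e2 : P₁ ≤ (i : ℕ) ∧ (i : ℕ) < P₁ + a₁
    · rw [mul_muGrad_of_mem h₁ hP₁ H e2, if_neg (Fin.ne_of_gt hij), zero_mul]
    · by_cases e3 : P₂ ≤ (i : ℕ) ∧ (i : ℕ) < P₂ + a₂
      · by_cases e4 : P₂ ≤ (j : ℕ) ∧ (j : ℕ) < P₂ + a₂
        · rw [mul_muGrad_of_mem h₂ hP₂ H e4, if_neg (Fin.ne_of_lt hij), mul_zero]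
        · omega
      · rw [mul_muGrad_of_notMem h₂ hP₂ H e3, mul_zero]
  · rw [mul_muGrad_of_notMem h₁ hP₁ H e1, zero_mul]

include hN h₁ hP₁ h₂ hP₂

/-- The trace is the derivative of φ₂ along δU = U · `eL φ₁`, which reads HL in the frame N, with L
= N'(`eL φ₁`)N. Adding to L the strictly lower part ν of cHG₁ leaves cG₁H below the diagonal. By
H(G₁H) = (HG₁)H the unwanted parts of H(L + ν) - νH then cancel and it has Hessenberg shape. -/
theorem intMul_trace_phi_phi (hc : ¬ (P₁ < P₂ ∧ P₁ + a₁ < P₂ + a₂)) :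
    IntMul (phiFun (m + 1) k₁ (a₁ + 1) * phiFun (m + 1) k₂ (a₂ + 1))
      (traceForm (eL (phiFun (m + 1) k₁ (a₁ + 1)))
        (gradY (phiFun (m + 1) k₂ (a₂ + 1)) * matY (m + 1))) := by
  set f₁ := phiFun (m + 1) k₁ (a₁ + 1) with hf₁
  set f₂ := phiFun (m + 1) k₂ (a₂ + 1) with hf₂
  set H := N' * matU (m + 1) * N with hHdef
  have hHess : IsHess H := hN.hess
  have e : traceForm (eL f₁) (gradY f₂ * matY (m + 1)) = vf 0 (matY (m + 1) * eL f₁) f₂ := by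
    rw [traceForm, vf_apply, Matrix.mul_zero, trace_zero, zero_add, trace_mul_comm,
      Matrix.mul_assoc]
  rw [e]
  set D := vf 0 (matY (m + 1) * eL f₁) with hD
  set L := N' * eL f₁ * N with hL
  set G₁ := muGrad H h₁ hP₁ with hG₁
  set G₂ := muGrad H h₂ hP₂ with hG₂
  set μ₁ := muFun H h₁ hP₁ with hμ₁
  have hμ₁0 : μ₁ ≠ 0 := muFun_ne_zero hN h₁ hP₁
  set c := f₁ / μ₁ with hc₁
  have hcμ : c * μ₁ = f₁ := div_mul_cancel₀ _ hμ₁0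
  have hLlow {r s : Fin (m + 1)} (hrs : r < s) : L r s = 0 := conj_eL_phiFun_lower hN h₁ hP₁ hrs
  have hLdiag (r : Fin (m + 1)) : IntMul f₁ (L r r) := conj_eL_phiFun_diag hN h₁ hP₁ r
  have hLapp {r s : Fin (m + 1)} (hsr : s < r) (hr : (r : ℕ) < m) :
      L r s = c * ((G₁ * H) r s - (H * G₁) r s) := conj_eL_phiFun_apply hN h₁ hP₁ hsr hr
  let ν : RatMat (m + 1) := of fun r s => if s < r then c * (H * G₁) r s else 0
  have hν_lt {r s : Fin (m + 1)} (hrs : s < r) : ν r s = c * (H * G₁) r s := if_pos hrs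
  have hν_ge {r s : Fin (m + 1)} (hrs : r ≤ s) : ν r s = 0 := if_neg (not_lt_of_ge hrs)
  -- `M` agrees with L + ν except perhaps in the last row, where the formula for L is not available.
  -- That row meets only the last column of H, which vanishes outside row 0.
  let M : RatMat (m + 1) := of fun r s =>
    if r < s then 0 else if r = s then L r r else c * (G₁ * H) r s
  have hM_lt {r s : Fin (m + 1)} (hrs : r < s) : M r s = 0 := if_pos hrs
  have hM_eq (r : Fin (m + 1)) : M r r = L r r := by simp [M]
  have hM_gt {r s : Fin (m + 1)} (hrs : s < r) : M r s = c * (G₁ * H) r s := by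
    simp [M, not_lt_of_gt hrs, hrs.ne']
  have hLν {r s : Fin (m + 1)} (hr : (r : ℕ) < m) : (L + ν) r s = M r s := by
    rw [Matrix.add_apply]
    rcases lt_trichotomy r s with h' | h' | h'
    · rw [hLlow h', hν_ge h'.le, hM_lt h', add_zero]
    · subst h'
      rw [hν_ge le_rfl, hM_eq, add_zero]
    · rw [hLapp h' hr, hν_lt h', hM_gt h']
      ring
  have hHM {i s : Fin (m + 1)} (hi : i ≠ 0) : (H * (L + ν)) i s = (H * M) i s := by
    rw [mul_apply, mul_apply]
    refine Finset.sum_congr rfl fun r _ => ?_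
    by_cases hr : (r : ℕ) < m
    · rw [hLν hr]
    · have : r = Fin.last m := Fin.ext (by rw [Fin.val_last]; omega)
      rw [this, hHess.last i hi, zero_mul, zero_mul]
  have hassoc : H * (G₁ * H) = H * G₁ * H := (Matrix.mul_assoc _ _ _).symm
  -- The entries on and below the subdiagonal.
  have hsub (i s : Fin (m + 1)) (his : (s : ℕ) + 1 ≤ i) : (H * (L + ν) - ν * H) i s =
      H i s * (L s s - c * (G₁ * H) s s + c * (H * G₁) i i) := by
    have hi : i ≠ 0 := fun h0 => by simp [h0] at his
    have e1 : (H * M) i s = c * (H * (G₁ * H)) i s + H i s * (L s s - c * (G₁ * H) s s) := by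
      rw [mul_apply, mul_apply, Finset.mul_sum]
      rw [← Finset.add_sum_erase _ _ (Finset.mem_univ s),
        ← Finset.add_sum_erase (a := s) _ (fun r => c * (H i r * (G₁ * H) r s)) (Finset.mem_univ s),
        hM_eq]
      have : ∑ r ∈ Finset.univ.erase s, H i r * M r s =
          ∑ r ∈ Finset.univ.erase s, c * (H i r * (G₁ * H) r s) := by
        refine Finset.sum_congr rfl fun r hr => ?_
        rcases lt_or_gt_of_ne (Finset.ne_of_mem_erase hr) with h' | h'
        · rw [Fin.lt_def] at h'
          rw [hHess.zero i r (by omega)]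
          ring
        · rw [hM_gt h']
          ring
      rw [this]
      ring
    have e2 : (ν * H) i s = c * (H * G₁ * H) i s - c * (H * G₁) i i * H i s := by
      rw [mul_apply, mul_apply, Finset.mul_sum]
      rw [← Finset.add_sum_erase _ _ (Finset.mem_univ i),
        ← Finset.add_sum_erase (a := i) _ (fun r => c * ((H * G₁) i r * H r s)) (Finset.mem_univ i),
        hν_ge le_rfl]
      have : ∑ r ∈ Finset.univ.erase i, ν i r * H r s =
          ∑ r ∈ Finset.univ.erase i, c * ((H * G₁) i r * H r s) := by
        refine Finset.sum_congr rfl fun r hr => ?_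
        rcases lt_or_gt_of_ne (Finset.ne_of_mem_erase hr) with h' | h'
        · rw [hν_lt h']
          ring
        · rw [Fin.lt_def] at h'
          rw [hHess.zero r s (by omega)]
          ring
      rw [this]
      ring
    rw [Matrix.sub_apply, hHM hi, e1, e2, hassoc]
    ring
  have hν0 (r : Fin (m + 1)) : ν r 0 = 0 := by
    by_cases hr : (0 : Fin (m + 1)) < r
    · rw [hν_lt hr, hG₁, mul_muGrad_of_notMem h₁ hP₁ H, mul_zero]
      simp only [Fin.val_zero]
      omega
    · exact hν_ge (not_lt.1 hr)
  have hMlast {r : Fin (m + 1)} (hr : r ≠ Fin.last m) : (L + ν) r (Fin.last m) = 0 := by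
    have hr' : r < Fin.last m := Fin.lt_last_iff_ne_last.2 hr
    rw [Matrix.add_apply, hLlow hr', hν_ge hr'.le, add_zero]
  have hlast (i : Fin (m + 1)) : (H * (L + ν) - ν * H) i (Fin.last m) =
      H i (Fin.last m) * L (Fin.last m) (Fin.last m) := by
    rw [Matrix.sub_apply, mul_apply, mul_apply, Finset.sum_eq_single (Fin.last m),
      Finset.sum_eq_zero, sub_zero, Matrix.add_apply, hν_ge le_rfl, add_zero]
    · intro r _
      by_cases hr : r = 0
      · rw [hr, hν0, zero_mul]
      · rw [hHess.last r hr, mul_zero]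
    · intro r _ hr
      rw [hMlast hr, mul_zero]
    · simp
  have hH : H.map D = H * (L + ν) - ν * H := by
    -- HL = (H(L + ν) - νH) + [H, -ν].
    refine hN.map_hess D (ν := -ν) (fun r s hrs => ?_) ⟨fun i s his => ?_, fun i hi => ?_⟩ ?_
    · rw [Matrix.neg_apply, hν_ge hrs, neg_zero]
    · rw [hsub i s (by omega), hHess.zero i s his, zero_mul]
    · rw [hlast, hHess.last i hi, zero_mul]
    · have e3 : N' * (matU (m + 1)).map D * N = H * L := by
        rw [hD, map_matU_vf_zero, hHdef, hL]
        calc N' * (matU (m + 1) * eL f₁) * N = N' * matU (m + 1) * 1 * eL f₁ * N := by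
              simp only [Matrix.mul_assoc, Matrix.one_mul]
          _ = _ := by
              rw [← hN.mul]
              simp only [Matrix.mul_assoc]
      rw [e3, ← hHdef, Matrix.mul_add, Matrix.mul_neg, Matrix.neg_mul]
      abel
  have hcQ (s : Fin (m + 1)) : IntMul f₁ (c * (G₁ * H) s s) := by
    have := (intMul_muGrad_mul h₁ hP₁ H s).mul c
    rwa [mul_comm, hcμ, mul_comm] at this
  have hcP (s : Fin (m + 1)) : IntMul f₁ (c * (H * G₁) s s) := by
    have := (intMul_mul_muGrad h₁ hP₁ H s).mul c
    rwa [mul_comm, hcμ, mul_comm] at this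
  have hψ : LogDeriv D f₁ (phiMat (matU (m + 1)) (k := k₂) (l := a₂ + 1) (by omega)).det := by
    refine logDeriv_psi hN h₂ hP₂ (fun j => ?_) ?_
    · rw [LogDeriv, derivation_hessB, ← hHdef, hH]
      induction j using Fin.cases with
      | zero =>
        rw [hessB_zero, hessB_zero, hlast]
        obtain ⟨z, hz⟩ := hLdiag (Fin.last m)
        exact ⟨z, by rw [hz]; ring⟩
      | succ j =>
        rw [hessB_succ, hessB_succ, hsub _ _ (by rw [Fin.val_succ, Fin.val_castSucc])]
        obtain ⟨z, hz⟩ := ((hLdiag j.castSucc).sub (hcQ j.castSucc)).add (hcP j.succ)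
        exact ⟨z, by rw [hz]; ring⟩
    · rw [LogDeriv, derivation_muFun, ← hHdef, hH, ← hG₂]
      have e4 : (G₂ * (H * (L + ν) - ν * H)).trace =
          (G₂ * H * (L + ν)).trace - (ν * (H * G₂)).trace := by
        rw [Matrix.mul_sub, trace_sub, trace_mul_comm G₂ (ν * H)]
        simp only [Matrix.mul_assoc]
      -- The only point at which the relative position of the two minors matters.
      have e5 : (ν * (H * G₂)).trace = 0 := by
        rw [trace_mul_eq_sum]
        refine Finset.sum_eq_zero fun i _ => Finset.sum_eq_zero fun j _ => ?_
        rcases lt_or_ge j i with h' | h'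
        · rw [hν_lt h', mul_assoc, trace_muGrad_eq_zero h₁ hP₁ h₂ hP₂ H hc h', mul_zero]
        · rw [hν_ge h', zero_mul]
      rw [e4, e5, sub_zero]
      -- Both G₂H and L + ν are lower triangular, so only diagonal products remain.
      have key : IntMul (muFun H h₂ hP₂ * f₁) (G₂ * H * (L + ν)).trace := by
        rw [trace_mul_eq_sum]
        refine IntMul.sum fun i _ => IntMul.sum fun j _ => ?_
        rcases lt_trichotomy i j with h' | h' | h'
        · have e6 : (G₂ * H) i j = 0 := by
            by_cases hj : m ≤ (j : ℕ) + a₂ ∧ (j : ℕ) < m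
            · rw [hG₂, muGrad_mul_of_mem h₂ hP₂ H hj, if_neg h'.ne]
            · by_cases hi : m ≤ (i : ℕ) + a₂ ∧ (i : ℕ) < m
              · have hj' : j = Fin.last m := Fin.ext (by
                  rw [Fin.lt_def] at h'
                  rw [Fin.val_last]
                  omega)
                rw [hj', mul_apply]
                refine Finset.sum_eq_zero fun r _ => ?_
                by_cases hr : r = 0
                · rw [hr, hG₂, muGrad, minorGrad_apply_of_notMem_right, zero_mul]
                  rw [mem_range_muRow]
                  simp only [Fin.val_zero]
                  omega
                · rw [hHess.last r hr, mul_zero]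
              · rw [hG₂, muGrad_mul_of_notMem h₂ hP₂ H hi]
          rw [e6, zero_mul]
          exact IntMul.zero
        · subst h'
          rw [Matrix.add_apply, hν_ge le_rfl, add_zero]
          obtain ⟨z, hz⟩ := intMul_muGrad_mul h₂ hP₂ H i
          obtain ⟨z', hz'⟩ := hLdiag i
          refine ⟨z * z', ?_⟩
          rw [hG₂, hz, hz']
          push_cast
          ring
        · rw [Matrix.add_apply, hLlow h', hν_ge h'.le, add_zero, mul_zero]
          exact IntMul.zero
      obtain ⟨z, hz⟩ := key
      exact ⟨z, by rw [hz]; ring⟩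
  obtain ⟨z, hz⟩ := hψ
  have hX : D (matX (m + 1)).det = 0 * (matX (m + 1)).det := by
    have h2 := derivation_det_mul_right D (M := matX (m + 1)) (Z := 0) (by
      rw [hD, map_vf_matX, Matrix.mul_zero])
    rwa [trace_zero] at h2
  rw [hf₂, derivation_phiFun D (k := k₂) (l := a₂ + 1) (by omega) hX hz]
  exact ⟨z, by ring⟩

theorem logC_phiFun_phiFun_of (hc : ¬ (P₁ < P₂ ∧ P₁ + a₁ < P₂ + a₂)) :
    LogC (phiFun (m + 1) k₁ (a₁ + 1)) (phiFun (m + 1) k₂ (a₂ + 1))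
      (bracket (phiFun (m + 1) k₁ (a₁ + 1)) (phiFun (m + 1) k₂ (a₂ + 1))) := by
  have hL₁ := eL_phiFun hN h₁ hP₁
  have hL₂ := eL_phiFun hN h₂ hP₂
  have hPφ : IntMul (phiFun (m + 1) k₁ (a₁ + 1)) (((P₁ : ℤ) : RatFun (m + 1)) *
    phiFun (m + 1) k₁ (a₁ + 1)) := IntMul.self.intCast_mul _
  rw [bracket, eR_phiFun hN h₁ hP₁, traceForm_rPlus_smul_one]
  refine (((logC_rPlus (fun i j hij => ?_) hL₁.2 hL₂.2).sub ?_).add ?_).sub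
    (LogC.of_intMul_mul (intMul_trace_phi_phi hN h₁ hP₁ h₂ hP₂ hc))
  · rw [hL₁.1 i j hij, zero_mul]
  · refine LogC.half hPφ ?_
    rw [eR_phiFun hN h₂ hP₂, trace_smul, trace_one, smul_eq_mul]
    exact ⟨P₂ * (m + 1), by simp; ring⟩
  · rw [traceForm, smul_mul, Matrix.one_mul, trace_smul, smul_eq_mul]
    exact LogC.of_intMul hPφ (trace_y_phiFun hN h₂ hP₂)

end PhiPhi

theorem logC_phiFun_phiFun {m k₁ l₁ k₂ l₂ : ℕ} (h₁ : 1 ≤ k₁ ∧ 1 ≤ l₁ ∧ k₁ + l₁ ≤ m + 1)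
    (h₂ : 1 ≤ k₂ ∧ 1 ≤ l₂ ∧ k₂ + l₂ ≤ m + 1) :
    LogC (phiFun (m + 1) k₁ l₁) (phiFun (m + 1) k₂ l₂)
      (bracket (phiFun (m + 1) k₁ l₁) (phiFun (m + 1) k₂ l₂)) := by
  obtain ⟨N, N', hN⟩ := exists_isNormalizer m
  obtain ⟨a₁, rfl⟩ : ∃ a, l₁ = a + 1 := ⟨l₁ - 1, by omega⟩
  obtain ⟨a₂, rfl⟩ : ∃ a, l₂ = a + 1 := ⟨l₂ - 1, by omega⟩
  have e₁ : (m + 1 - k₁ - a₁) + (a₁ + k₁) = m + 1 := by omega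
  have e₂ : (m + 1 - k₂ - a₂) + (a₂ + k₂) = m + 1 := by omega
  -- If the row intervals are in the excluded position, the reversed pair is not.
  by_cases hc : m + 1 - k₁ - a₁ < m + 1 - k₂ - a₂ ∧
      m + 1 - k₁ - a₁ + a₁ < m + 1 - k₂ - a₂ + a₂
  · exact (logC_phiFun_phiFun_of hN e₂ (by omega) e₁ (by omega) (by omega)).bracket_swap
  · exact logC_phiFun_phiFun_of hN e₁ (by omega) e₂ (by omega) hc

theorem logC_phiFun_isMinor {m k l : ℕ} (h : 1 ≤ k ∧ 1 ≤ l ∧ k + l ≤ m + 1) {f : RatFun (m + 1)}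
    {I J J' : Fin (m + 1) → Prop} (hf : IsMinor f I J J') (hJ' : ∀ a b, a < b → J' a → J' b) :
    LogC (phiFun (m + 1) k l) f (bracket (phiFun (m + 1) k l) f) := by
  obtain ⟨N, N', hN⟩ := exists_isNormalizer m
  obtain ⟨a, rfl⟩ : ∃ a, l = a + 1 := ⟨l - 1, by omega⟩
  exact logC_phiFun_minor hN (P := m + 1 - k - a) (by omega) (by omega) hf hJ'

theorem logC_family {n : ℕ} (hn : 1 ≤ n) (a b : Label n) :
    LogC (family n a) (family n b) (bracket (family n a) (family n b)) := by
  obtain ⟨m, rfl⟩ : ∃ m, n = m + 1 := ⟨n - 1, by omega⟩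
  have hc (i : ℕ) (f : RatFun (m + 1)) : LogC (cFun (m + 1) i) f (bracket (cFun (m + 1) i) f) := by
    rw [bracket_cFun]
    exact LogC.zero
  have hpg {k l i j : ℕ} (h : 1 ≤ k ∧ 1 ≤ l ∧ k + l ≤ m + 1) (h' : 1 ≤ j ∧ j ≤ i ∧ i ≤ m + 1) :
      LogC (phiFun (m + 1) k l) (gFun (m + 1) i j)
        (bracket (phiFun (m + 1) k l) (gFun (m + 1) i j)) :=
    logC_phiFun_isMinor h (isMinor_gFun h') fun _ _ _ h'' => h''
  have hph {k l i j : ℕ} (h : 1 ≤ k ∧ 1 ≤ l ∧ k + l ≤ m + 1) (h' : 1 ≤ i ∧ i ≤ j ∧ j ≤ m + 1) :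
      LogC (phiFun (m + 1) k l) (hFun (m + 1) i j)
        (bracket (phiFun (m + 1) k l) (hFun (m + 1) i j)) :=
    logC_phiFun_isMinor h (isMinor_hFun h') fun a b hab h'' => by
      rw [Fin.lt_def] at hab
      omega
  have hpf {k l i j : ℕ} (h : 1 ≤ k ∧ 1 ≤ l ∧ k + l ≤ m + 1) (h' : i + j ≤ m + 1) :
      LogC (phiFun (m + 1) k l) (fFun (m + 1) i j)
        (bracket (phiFun (m + 1) k l) (fFun (m + 1) i j)) :=
    logC_phiFun_isMinor h (isMinor_fFun h') fun a b hab h'' => by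
      rw [Fin.lt_def] at hab
      omega
  match a, b with
  | .c i _, b => exact hc i _
  | a, .c i _ => exact (hc i _).bracket_swap
  | .g _ _ h, .g _ _ h' => exact logC_gFun_gFun h h'
  | .g _ _ h, .h _ _ h' => exact logC_gFun_hFun h h'
  | .g _ _ h, .f _ _ h' => exact (logC_fFun_gFun (by omega) h).bracket_swap
  | .g _ _ h, .phi _ _ h' => exact (hpg h' h).bracket_swap
  | .h _ _ h, .g _ _ h' => exact (logC_gFun_hFun h' h).bracket_swap
  | .h _ _ h, .h _ _ h' => exact logC_hFun_hFun h h'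
  | .h _ _ h, .f _ _ h' => exact (logC_fFun_hFun (by omega) h).bracket_swap
  | .h _ _ h, .phi _ _ h' => exact (hph h' h).bracket_swap
  | .f _ _ h, .g _ _ h' => exact logC_fFun_gFun (by omega) h'
  | .f _ _ h, .h _ _ h' => exact logC_fFun_hFun (by omega) h'
  | .f _ _ h, .f _ _ h' => exact logC_fFun_fFun (by omega) (by omega)
  | .f _ _ h, .phi _ _ h' => exact (hpf h' (by omega)).bracket_swap
  | .phi _ _ h, .g _ _ h' => exact hpg h h'
  | .phi _ _ h, .h _ _ h' => exact hph h h'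
  | .phi _ _ h, .f _ _ h' => exact hpf h (by omega)
  | .phi _ _ h, .phi _ _ h' => exact logC_phiFun_phiFun h h'

/-! ### Reconstructing a Hessenberg matrix -/

section Reconstruction

variable {R : Type*} [CommRing R]

theorem det_sub_det_of_eq_off_zero {a : ℕ} {A B : Matrix (Fin (a + 1)) (Fin (a + 1)) R}
    (h : ∀ i j, ¬ (i = 0 ∧ j = 0) → A i j = B i j) :
    A.det - B.det = (A 0 0 - B 0 0) * (A.submatrix Fin.succ Fin.succ).det := by
  have hs (j : Fin (a + 1)) :
      B.submatrix Fin.succ j.succAbove = A.submatrix Fin.succ j.succAbove := by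
    ext s t
    exact (h _ _ fun h' => Fin.succ_ne_zero s h'.1).symm
  rw [det_succ_row_zero A, det_succ_row_zero B, ← Finset.sum_sub_distrib, Finset.sum_eq_single 0]
  · rw [hs, Fin.succAbove_zero]
    simp only [Fin.val_zero, pow_zero, one_mul]
    ring
  · intro j _ hj
    rw [hs, h 0 j fun h' => hj h'.2, sub_self]
  · simp

variable {m : ℕ}

/-- Induction from the bottom right corner. An entry on or above the diagonal is the top left corner
of one of the minors; the other entries of that minor are already known, and the cofactor of the
corner is again one of the minors, hence a unit. -/
theorem IsHess.eq_of_minors {A B : Matrix (Fin (m + 1)) (Fin (m + 1)) R} (hA : IsHess A)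
    (hB : IsHess B) (hb : ∀ j, hessB A j = hessB B j)
    (hmu : ∀ P a (_ : 1 ≤ P) (h : P + a ≤ m),
      (A.submatrix (muRow (P := P) (a := a) (by omega)) (muCol (by omega))).det =
        (B.submatrix (muRow (P := P) (a := a) (by omega)) (muCol (by omega))).det)
    (hu : ∀ P a (_ : 1 ≤ P) (h : P + a ≤ m),
      IsUnit (A.submatrix (muRow (P := P) (a := a) (by omega)) (muCol (by omega))).det)
    (i j : Fin (m + 1)) (hi : i ≠ 0) : A i j = B i j := by
  obtain ⟨d, hd⟩ : ∃ d, (i : ℕ) + j + d = 2 * m := ⟨2 * m - (i + j), by omega⟩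
  induction d using Nat.strong_induction_on generalizing i j with
  | _ d ih =>
    have hi0 : (i : ℕ) ≠ 0 := fun h => hi (Fin.ext h)
    by_cases hj : j = Fin.last m
    · rw [hj, hA.last i hi, hB.last i hi]
    have hjm : (j : ℕ) < m := lt_of_le_of_ne (by omega) fun h => hj (Fin.ext h)
    rcases lt_trichotomy ((j : ℕ) + 1) i with h | h | h
    · rw [hA.zero i j h, hB.zero i j h]
    · have h1 : i = (⟨j, hjm⟩ : Fin m).succ := Fin.ext h.symm
      have h3 := hb i
      rw [h1, hessB_succ, hessB_succ] at h3
      rw [h1]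
      exact h3
    · obtain ⟨a, ha⟩ : ∃ a, m = j + a + 1 := ⟨m - j - 1, by omega⟩
      have hr : muRow (m := m) (P := i) (a := a + 1) (by omega) 0 = i := Fin.ext (by simp [muRow])
      have hc : muCol (m := m) (a := a + 1) (by omega) 0 = j :=
        Fin.ext (by simp only [muCol, Fin.val_zero]; omega)
      have h1 := det_sub_det_of_eq_off_zero
        (A := A.submatrix (muRow (P := i) (a := a + 1) (by omega)) (muCol (by omega)))
        (B := B.submatrix (muRow (P := i) (a := a + 1) (by omega)) (muCol (by omega))) (by
          intro s t hst
          rw [submatrix_apply, submatrix_apply]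
          have hst' : 0 < (s : ℕ) + t := by
            by_contra h0
            exact hst ⟨Fin.ext (by simp only [Fin.val_zero]; omega),
              Fin.ext (by simp only [Fin.val_zero]; omega)⟩
          refine ih (d - s - t) (by omega) _ _ (fun h0 => ?_) ?_
          · have := congrArg Fin.val h0
            simp only [muRow, Fin.val_zero] at this
            omega
          · simp only [muRow, muCol]
            omega)
      rw [hmu i (a + 1) (by omega) (by omega), sub_self, submatrix_apply, submatrix_apply, hr, hc,
        submatrix_submatrix] at h1
      have h2 := hu (i + 1) a (by omega) (by omega)
      have h3 : (muRow (m := m) (P := i) (a := a + 1) (by omega)) ∘ Fin.succ =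
          muRow (P := i + 1) (a := a) (by omega) := by
        funext s
        apply Fin.ext
        simp only [Function.comp, muRow, Fin.val_succ]
        omega
      have h4 : (muCol (m := m) (a := a + 1) (by omega)) ∘ Fin.succ =
          muCol (a := a) (by omega) := by
        funext s
        apply Fin.ext
        simp only [Function.comp, muCol, Fin.val_succ]
        omega
      rw [h3, h4] at h1
      exact sub_eq_zero.1 ((h2.mul_left_eq_zero).1 h1.symm)

theorem pencil_apply (A B : Matrix (Fin m) (Fin m) R) (i j : Fin m) :
    pencil A B i j = Polynomial.C (A i j) + Polynomial.X * Polynomial.C (B i j) := rfl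

/-- Expanding det(1 + λA) along row 0 gives linear equations for that row, with the cofactors v_j as
coefficients. The lowest term of v_j is a unit times λ^j, so the equations are triangular. -/
theorem IsHess.eq_of_det_pencil {A B : Matrix (Fin (m + 1)) (Fin (m + 1)) R} (hA : IsHess A)
    (hb : ∀ j : Fin m, IsUnit (A j.succ j.castSucc)) (h : ∀ i j, i ≠ 0 → A i j = B i j)
    (hd : (pencil 1 A).det = (pencil 1 B).det) : A = B := by
  set v : Fin (m + 1) → Polynomial R := fun j => (pencil 1 A).adjugate j 0 with hv
  -- These cofactors do not involve row 0, in which alone A and B may differ.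
  have hvB (j : Fin (m + 1)) : (pencil 1 B).adjugate j 0 = v j := by
    rw [hv]
    simp only
    rw [adjugate_apply, adjugate_apply]
    congr 1
    ext i t : 2
    by_cases hi : i = 0
    · rw [hi, updateRow_self, updateRow_self]
    · rw [updateRow_ne hi, updateRow_ne hi, pencil_apply, pencil_apply, h i t hi]
  have hsum (q : ℕ) : ∑ j, (A 0 j - B 0 j) * (v j).coeff q = 0 := by
    have h1 := det_eq_sum_mul_adjugate_row (pencil 1 A) 0
    have h2 := det_eq_sum_mul_adjugate_row (pencil 1 B) 0
    rw [← hd, h1, ← sub_eq_zero, ← Finset.sum_sub_distrib] at h2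
    have h3 : Polynomial.X * ∑ j, Polynomial.C (A 0 j - B 0 j) * v j = 0 := by
      rw [← h2, Finset.mul_sum]
      refine Finset.sum_congr rfl fun j _ => ?_
      rw [hvB, pencil_apply, pencil_apply, map_sub]
      simp only [hv]
      ring
    have h4 := congrArg (Polynomial.coeff · (q + 1)) h3
    simpa only [Polynomial.coeff_X_mul, Polynomial.finsetSum_coeff, Polynomial.coeff_C_mul,
      Polynomial.coeff_zero] using h4
  have h0 (j : Fin (m + 1)) : (v j).coeff 0 = if j = 0 then 1 else 0 := by
    have h1 := RingHom.map_adjugate (Polynomial.evalRingHom (0 : R)) (pencil 1 A)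
    have h2 : (Polynomial.evalRingHom (0 : R)).mapMatrix (pencil 1 A) = 1 := by
      ext i j
      simp [pencil_apply]
    rw [h2, adjugate_one] at h1
    have h3 := congr_fun (congr_fun h1 j) 0
    rw [Polynomial.coeff_zero_eq_eval_zero, ← one_apply, ← h3]
    rfl
  have hrec (q : ℕ) (i : Fin (m + 1)) (hi : i ≠ 0) :
      (v i).coeff (q + 1) = -∑ j, A i j * (v j).coeff q := by
    have h1 := congr_fun (congr_fun (mul_adjugate (pencil 1 A)) i) 0
    have h2 : v i + Polynomial.X * ∑ j, Polynomial.C (A i j) * v j = 0 := by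
      rw [Matrix.smul_apply, one_apply_ne hi, smul_zero] at h1
      nth_rw 1 [pencil] at h1
      rw [Matrix.map_one _ (map_zero _) (map_one _), Matrix.add_mul, Matrix.one_mul, smul_mul,
        Matrix.add_apply, Matrix.smul_apply, mul_apply] at h1
      exact h1
    have h4 := congrArg (Polynomial.coeff · (q + 1)) h2
    simp only [Polynomial.coeff_add, Polynomial.coeff_X_mul, Polynomial.finsetSum_coeff,
      Polynomial.coeff_C_mul, Polynomial.coeff_zero] at h4
    exact eq_neg_of_add_eq_zero_left h4
  have key (q : ℕ) : (∀ i : Fin (m + 1), q < i → (v i).coeff q = 0) ∧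
      ∀ i : Fin (m + 1), (i : ℕ) = q → IsUnit ((v i).coeff q) := by
    induction q with
    | zero =>
      refine ⟨fun i hi => ?_, fun i hi => ?_⟩
      · rw [h0, if_neg]
        rintro rfl
        simp at hi
      · rw [h0, if_pos (Fin.ext hi)]
        exact isUnit_one
    | succ q ih =>
      refine ⟨fun i hi => ?_, fun i hi => ?_⟩
      · rw [hrec q i fun h => by simp [h] at hi, neg_eq_zero]
        refine Finset.sum_eq_zero fun j _ => ?_
        by_cases hj : q < j
        · rw [ih.1 j hj, mul_zero]
        · rw [hA.zero i j (by omega), zero_mul]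
      · rw [hrec q i fun h => by simp [h] at hi]
        have hqm : q < m := by omega
        rw [Finset.sum_eq_single (⟨q, hqm⟩ : Fin m).castSucc]
        · have : i = (⟨q, hqm⟩ : Fin m).succ := Fin.ext hi
          rw [this]
          exact ((hb _).mul (ih.2 _ rfl)).neg
        · intro j _ hj
          have hj' : (j : ℕ) ≠ q := fun h => hj (Fin.ext h)
          by_cases hq : q < j
          · rw [ih.1 j hq, mul_zero]
          · rw [hA.zero i j (by omega), zero_mul]
        · simp
  have hz (j : Fin (m + 1)) : A 0 j - B 0 j = 0 := by
    induction j using WellFoundedLT.induction with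
    | ind j ih =>
      have h1 := hsum j
      rw [Finset.sum_eq_single j] at h1
      · exact (((key j).2 j rfl).mul_left_eq_zero).1 h1
      · intro t _ ht
        rcases lt_or_gt_of_ne ht with h' | h'
        · rw [ih t h', zero_mul]
        · rw [(key j).1 t h', mul_zero]
      · simp
  ext i j
  by_cases hi : i = 0
  · rw [hi]
    exact sub_eq_zero.1 (hz j)
  · exact h i j hi

end Reconstruction

/-! ### Unipotent matrices that preserve minors -/

section Unipotent

variable {R : Type*} [CommRing R]

/-- Multilinearity: a column of `X` that already occurs at another place of `M` contributes a
determinant with two equal columns. -/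
theorem det_updateCol_mulVec {ι κ : Type*} [Fintype ι] [DecidableEq ι] [Fintype κ]
    {M : Matrix ι ι R} {X : Matrix ι κ R} {a : κ → R} {s : ι} {t : κ}
    (ht : ∀ i, X i t = M i s) (h : ∀ j, j ≠ t → a j = 0 ∨ ∃ u, u ≠ s ∧ ∀ i, X i j = M i u) :
    (M.updateCol s (X *ᵥ a)).det = a t * M.det := by
  rw [← cramer_apply, mulVec_eq_sum, map_sum, Finset.sum_apply, Finset.sum_eq_single t]
  · simp only [op_smul_eq_smul, map_smul, Pi.smul_apply, smul_eq_mul]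
    rw [cramer_apply, show Xᵀ t = fun i => M i s from funext ht, updateCol_eq_self]
  · intro j _ hj
    simp only [op_smul_eq_smul, map_smul, Pi.smul_apply, smul_eq_mul]
    rcases h j hj with h0 | ⟨u, hu, h1⟩
    · rw [h0, zero_mul]
    · rw [cramer_apply, show Xᵀ j = fun i => M i u from funext h1,
        det_updateCol_eq_zero hu, mul_zero]
  · simp

theorem det_updateRow_vecMul {ι κ : Type*} [Fintype ι] [DecidableEq ι] [Fintype κ]
    {M : Matrix ι ι R} {X : Matrix κ ι R} {a : κ → R} {s : ι} {t : κ}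
    (ht : ∀ i, X t i = M s i) (h : ∀ j, j ≠ t → a j = 0 ∨ ∃ u, u ≠ s ∧ ∀ i, X j i = M u i) :
    (M.updateRow s (a ᵥ* X)).det = a t * M.det := by
  rw [← det_transpose, ← updateCol_transpose, ← mulVec_transpose, ← M.det_transpose]
  exact det_updateCol_mulVec ht h

theorem det_updateCol_single_zero {n : ℕ} (M : Matrix (Fin (n + 1)) (Fin (n + 1)) R) :
    (M.updateCol 0 (Pi.single 0 1)).det = (M.submatrix Fin.succ Fin.succ).det := by
  rw [det_succ_column_zero, Finset.sum_eq_single 0]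
  · have : (M.updateCol 0 (Pi.single 0 1)).submatrix Fin.succ Fin.succ =
        M.submatrix Fin.succ Fin.succ := by
      ext i j
      simp
    simp [this]
  · intro i _ hi
    simp [hi]
  · simp

/-- The minor of `[X Y]` on the last `k + l` rows, the last `k` columns of `X` and the last `l`
columns of `Y`. -/
noncomputable def trailMinor (X Y : Matrix (Fin n) (Fin n) R) {k l : ℕ} (h : k + l ≤ n) : R :=
  ((fromCols X Y).submatrix (fRow h) (fCol h)).det

/-- The columns `X^{n-k}, …, X^{n-1}, Y^k, …, Y^{n-1}` of `[X Y]`. -/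
def mixCol {k : ℕ} (hk : k ≤ n) (t : Fin n) : Fin n ⊕ Fin n :=
  if h : (t : ℕ) < k then Sum.inl ⟨n - k + t, by omega⟩ else Sum.inr t

theorem trailMinor_eq_mixCol (X Y : Matrix (Fin n) (Fin n) R) {k l : ℕ} (h : k + l = n) :
    trailMinor X Y h.le = ((fromCols X Y).submatrix id (mixCol (k := k) (by omega))).det := by
  subst h
  rw [trailMinor]
  congr 2
  · funext s
    exact Fin.ext (by simp only [fRow, id]; omega)
  · funext t
    rw [fCol, mixCol]
    split_ifs
    · rfl
    · exact congrArg Sum.inr (Fin.ext (by simp only; omega))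

theorem trailMinor_eq_det_succ (X Y : Matrix (Fin (n + 1)) (Fin (n + 1)) R) {k l : ℕ}
    (h : k + l = n) : trailMinor X Y (k := k) (l := l) (by omega) =
      (((fromCols X Y).submatrix id (mixCol (k := k + 1) (by omega))).submatrix
        Fin.succ Fin.succ).det := by
  subst h
  rw [trailMinor, submatrix_submatrix]
  congr 2
  · funext s
    exact Fin.ext (by simp only [fRow, Function.comp, id, Fin.val_succ]; omega)
  · funext t
    simp only [fCol, mixCol, Function.comp, Fin.val_succ, Nat.add_lt_add_iff_right]
    split_ifs
    · exact congrArg Sum.inl (Fin.ext (by simp only; omega))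
    · exact congrArg Sum.inr (Fin.ext (by simp only [Fin.val_succ]; omega))

theorem trailMinor_succ (X Y : Matrix (Fin (n + 1)) (Fin (n + 1)) R) {k l : ℕ} (h : k + l ≤ n) :
    trailMinor X Y (k := k) (l := l) (by omega) =
      trailMinor (X.submatrix Fin.succ Fin.succ) (Y.submatrix Fin.succ Fin.succ) h := by
  rw [trailMinor, trailMinor]
  congr 1
  ext s t
  have hr : fRow (n := n + 1) (k := k) (l := l) (by omega) s = (fRow h s).succ :=
    Fin.ext (by simp only [fRow, Fin.val_succ]; omega)
  rw [submatrix_apply, submatrix_apply, hr, fCol, fCol]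
  split_ifs
  · exact congrArg (X _) (Fin.ext (by simp only [Fin.val_succ]; omega))
  · exact congrArg (Y _) (Fin.ext (by simp only [Fin.val_succ]; omega))

/-- Induction on the size, by showing Qe_0 = e_0. `M k` has the last k + 1 columns of X followed by
the last n - k columns of Y; the invariant minors make its determinant vanish once column 0 is
replaced by η = Q⁻¹e_0 - e_0. Letting k decrease kills the coordinates of η in the columns of X one
after another. -/
theorem isLowerUni_transpose_of_trailMinor (X Y Q : Matrix (Fin n) (Fin n) R)
    (hf : ∀ k l (h : k + l ≤ n), trailMinor (Q * X) (Q * Y) h = trailMinor X Y h)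
    (hu : ∀ k l (h : k + l ≤ n), IsUnit (trailMinor X Y h)) : IsLowerUni Qᵀ := by
  induction n with
  | zero => exact ⟨fun i => i.elim0, fun i => i.elim0⟩
  | succ n ih =>
    set M : ∀ k : ℕ, k ≤ n → Matrix (Fin (n + 1)) (Fin (n + 1)) R := fun k hk =>
      (fromCols X Y).submatrix id (mixCol (k := k + 1) (by omega)) with hM
    have hX : M n le_rfl = X := by
      ext s t
      simp only [hM, submatrix_apply, mixCol, dif_pos t.2, id, fromCols_apply_inl]
      exact congrArg (X s) (Fin.ext (by simp only; omega))
    have hMu (k : ℕ) (hk : k ≤ n) : IsUnit (M k hk).det := by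
      have := hu (k + 1) (n - k) (by omega)
      rwa [trailMinor_eq_mixCol X Y (by omega)] at this
    have hMX (k : ℕ) (hk : k ≤ n) (s t j : Fin (n + 1)) (ht : (t : ℕ) ≤ k)
        (hj : (j : ℕ) = n - k + t) : X s j = M k hk s t := by
      simp only [hM, submatrix_apply, mixCol, id]
      rw [dif_pos (Nat.lt_succ_of_le ht), fromCols_apply_inl]
      exact congrArg (X s) (Fin.ext (by simp only; omega))
    have hQM (k : ℕ) (hk : k ≤ n) : Q * M k hk =
        (fromCols (Q * X) (Q * Y)).submatrix id (mixCol (k := k + 1) (by omega)) := by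
      rw [← mul_fromCols]
      rfl
    have hXu : IsUnit X.det := hX ▸ hMu n le_rfl
    have hQ : Q.det = 1 := by
      have := hf (n + 1) 0 (by omega)
      rw [trailMinor_eq_mixCol _ _ (by omega), trailMinor_eq_mixCol _ _ (by omega),
        ← hQM n le_rfl, det_mul] at this
      exact (hMu n le_rfl).mul_right_cancel (this.trans (one_mul _).symm)
    have hQu : IsUnit Q.det := hQ ▸ isUnit_one
    set e : Fin (n + 1) → R := Pi.single 0 1 with he
    -- Deleting row 0 and column 0 amounts to replacing column 0 by e_0; taking Q out of the
    -- determinant turns e_0 into Q⁻¹e_0.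
    have h1 (k : ℕ) (hk : k ≤ n) :
        ((M k hk).updateCol 0 (Q⁻¹ *ᵥ e - e)).det = 0 := by
      have h2 := hf k (n - k) (by omega)
      rw [trailMinor_eq_det_succ _ _ (by omega), trailMinor_eq_det_succ _ _ (by omega), ← hQM k hk,
        ← det_updateCol_single_zero, ← det_updateCol_single_zero] at h2
      have h3 : (Q * M k hk).updateCol 0 e = Q * (M k hk).updateCol 0 (Q⁻¹ *ᵥ e) := by
        rw [mul_updateCol, mulVec_mulVec, mul_nonsing_inv _ hQu, one_mulVec]
      rw [← he, h3, det_mul, hQ, one_mul] at h2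
      rw [← cramer_apply, map_sub, Pi.sub_apply, cramer_apply, cramer_apply, h2]
      exact sub_self _
    set η := Q⁻¹ *ᵥ e - e with hη
    have hηX : η = X *ᵥ (X⁻¹ *ᵥ η) := by
      rw [mulVec_mulVec, mul_nonsing_inv _ hXu, one_mulVec]
    have ha (i : Fin (n + 1)) : (X⁻¹ *ᵥ η) i = 0 := by
      induction i using WellFoundedLT.induction with
      | ind i ihi =>
        -- Column i of X is column 0 of `M (n - i)`, and the later columns of X stand elsewhere in
        -- the same matrix.
        have h2 := h1 (n - i) (by omega)
        rw [hηX, det_updateCol_mulVec (t := i)] at h2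
        · exact ((hMu (n - i) (by omega)).mul_left_eq_zero).1 h2
        · exact fun s => hMX (n - i) (by omega) _ _ _ (Nat.zero_le _)
            (by simp only [Fin.val_zero]; omega)
        · intro j hj
          rcases lt_or_gt_of_ne hj with h' | h'
          · exact Or.inl (ihi j h')
          · rw [Fin.lt_def] at h'
            refine Or.inr ⟨⟨j - i, by omega⟩, fun h => ?_, fun s =>
              hMX (n - i) (by omega) _ _ _ (by simp only; omega) (by simp only; omega)⟩
            have := congrArg Fin.val h
            simp only [Fin.val_zero] at this
            omega
    have hη0 : η = 0 := by
      rw [hηX, funext ha]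
      exact mulVec_zero X
    have hQe : Q *ᵥ e = e := by
      have h2 : Q⁻¹ *ᵥ e = e := sub_eq_zero.1 (hη.symm.trans hη0)
      rw [← h2, mulVec_mulVec, mul_nonsing_inv _ hQu, one_mulVec, h2]
    have hcol (i : Fin (n + 1)) : Q i 0 = if i = 0 then 1 else 0 := by
      have := congr_fun hQe i
      rw [he, mulVec_single_one] at this
      rw [← Pi.single_apply, ← this]
      rfl
    have hsub (Z : Matrix (Fin (n + 1)) (Fin (n + 1)) R) :
        (Q * Z).submatrix Fin.succ Fin.succ =
          Q.submatrix Fin.succ Fin.succ * Z.submatrix Fin.succ Fin.succ := by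
      ext i j
      simp [mul_apply, Fin.sum_univ_succ, hcol]
    have hIH := ih (X.submatrix Fin.succ Fin.succ) (Y.submatrix Fin.succ Fin.succ)
      (Q.submatrix Fin.succ Fin.succ)
      (fun k l h => by
        rw [← hsub, ← hsub, ← trailMinor_succ, ← trailMinor_succ]
        exact hf k l (by omega))
      (fun k l h => by
        rw [← trailMinor_succ]
        exact hu k l (by omega))
    refine ⟨fun i j hij => ?_, fun i => ?_⟩
    · rw [transpose_apply]
      induction i using Fin.cases with
      | zero => rw [hcol, if_neg hij.ne']
      | succ i =>
        induction j using Fin.cases with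
        | zero => exact absurd hij (Fin.not_lt_zero _)
        | succ j => exact hIH.zero i j (Fin.succ_lt_succ_iff.1 hij)
    · rw [transpose_apply]
      induction i using Fin.cases with
      | zero => rw [hcol, if_pos rfl]
      | succ i => exact hIH.one i

/-- The minor of `A` on `d` consecutive rows starting at `i` and the last `d` columns. -/
noncomputable def colMinor (A : Matrix (Fin n) (Fin n) R) {i d : ℕ} (h : i + d ≤ n) : R :=
  (A.submatrix (fun s : Fin d => ⟨i + s, by omega⟩) fun t : Fin d => ⟨n - d + t, by omega⟩).det

theorem colMinor_succ (A : Matrix (Fin (n + 1)) (Fin (n + 1)) R) {i d : ℕ} (h : i + d ≤ n) :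
    colMinor A (i := i + 1) (d := d) (by omega) =
      colMinor (A.submatrix Fin.succ Fin.succ) h := by
  rw [colMinor, colMinor, submatrix_submatrix]
  congr 2
  · funext s
    exact Fin.ext (by simp only [Function.comp, Fin.val_succ]; omega)
  · funext s
    exact Fin.ext (by simp only [Function.comp, Fin.val_succ]; omega)

/-- Induction on the size: only row 0 of V is in question. Its entries beyond the diagonal vanish
from right to left; the minor on rows 0, …, j isolates `p j`, multiplied by the minor on rows 1, …,
j + 1. -/
theorem eq_one_of_colMinor (A V : Matrix (Fin n) (Fin n) R) (hV : IsLowerUni Vᵀ)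
    (ht : ∀ i d (h : i + d ≤ n), colMinor (V * A) h = colMinor A h)
    (hu : ∀ i d (h : i + d ≤ n), IsUnit (colMinor A h)) : V = 1 := by
  induction n with
  | zero => exact Subsingleton.elim _ _
  | succ n ih =>
    have hcol (i : Fin n) : V i.succ 0 = 0 := hV.zero 0 i.succ (Fin.succ_pos i)
    have hsub : (V * A).submatrix Fin.succ Fin.succ =
          V.submatrix Fin.succ Fin.succ * A.submatrix Fin.succ Fin.succ := by
      ext i j
      simp [mul_apply, Fin.sum_univ_succ, hcol]
    have hIH := ih (A.submatrix Fin.succ Fin.succ) (V.submatrix Fin.succ Fin.succ)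
      ⟨fun i j hij => hV.zero _ _ (Fin.succ_lt_succ_iff.2 hij), fun i => hV.one _⟩
      (fun i d h => by
        rw [← hsub, ← colMinor_succ, ← colMinor_succ]
        exact ht _ _ _)
      (fun i d h => by
        rw [← colMinor_succ]
        exact hu _ _ _)
    have hsucc (i : Fin n) (t : Fin (n + 1)) : (V * A) i.succ t = A i.succ t := by
      rw [mul_apply, Fin.sum_univ_succ, hcol, zero_mul, zero_add, Finset.sum_eq_single i]
      · have := congr_fun (congr_fun hIH i) i
        rw [submatrix_apply, one_apply_eq] at this
        rw [this, one_mul]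
      · intro j _ hj
        have := congr_fun (congr_fun hIH i) j
        rw [submatrix_apply, one_apply_ne hj.symm] at this
        rw [this, zero_mul]
      · simp
    have h0 : V 0 0 = 1 := hV.one 0
    set p : Fin n → R := fun j => V 0 j.succ with hp
    have hp0 (j : Fin n) : p j = 0 := by
      induction j using WellFoundedGT.induction with
      | ind j ihj =>
        set c : Fin (j + 1) → Fin (n + 1) := fun t => ⟨n + 1 - (j + 1) + t, by omega⟩ with hc
        set N₀ := A.submatrix (fun s : Fin (j + 1) => (⟨s, by omega⟩ : Fin (n + 1))) c with hN₀
        set N₁ := A.submatrix (fun s : Fin (j + 1) => (⟨s, by omega⟩ : Fin n).succ) c with hN₁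
        set B := A.submatrix Fin.succ c with hB
        have hN₁u : IsUnit N₁.det := by
          have e1 : N₁.det = colMinor A (i := 1) (d := j + 1) (by omega) := by
            rw [colMinor, hN₁]
            congr 2
            funext s
            exact Fin.ext (by simp only [Fin.val_succ]; omega)
          rw [e1]
          exact hu _ _ _
        have h1 := ht 0 (j + 1) (by omega)
        have h2 : colMinor A (i := 0) (d := j + 1) (by omega) = N₀.det := by
          rw [colMinor, hN₀]
          congr 2
          funext s
          exact Fin.ext (by simp)
        have h3 : colMinor (V * A) (i := 0) (d := j + 1) (by omega) =
            (N₀.updateRow 0 (N₀ 0 + p ᵥ* B)).det := by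
          rw [colMinor]
          congr 1
          ext s t
          induction s using Fin.cases with
          | zero =>
            rw [updateRow_self, submatrix_apply, mul_apply, Fin.sum_univ_succ]
            simp only [Fin.val_zero, add_zero]
            change V 0 0 * A 0 (c t) + ∑ i, V 0 (Fin.succ i) * A i.succ (c t) = _
            rw [h0, one_mul]
            rfl
          | succ s =>
            rw [updateRow_ne (Fin.succ_ne_zero s), hN₀, submatrix_apply, submatrix_apply]
            have e1 : (⟨0 + (s.succ : Fin (j + 1)), by omega⟩ : Fin (n + 1)) =
              (⟨s, by omega⟩ : Fin n).succ := Fin.ext (by simp)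
            rw [e1, hsucc]
            rfl
        have h4 : (N₀.updateRow 0 (p ᵥ* B)).det = 0 := by
          rw [h2, h3, det_updateRow_add, updateRow_eq_self, add_eq_left] at h1
          exact h1
        -- A cyclic rotation moves row 0 to the bottom, so the determinant can be compared with
        -- `N₁`.
        have h5 : N₁.updateRow (Fin.last j) (p ᵥ* B) =
            (N₀.updateRow 0 (p ᵥ* B)).submatrix (finRotate (j + 1)) id := by
          ext s t
          induction s using Fin.lastCases with
          | last => rw [updateRow_self, submatrix_apply, finRotate_last, updateRow_self, id]
          | cast s =>
            rw [updateRow_ne (Fin.castSucc_lt_last s).ne, submatrix_apply, finRotate_apply,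
              Fin.coeSucc_eq_succ, updateRow_ne (Fin.succ_ne_zero s)]
            rfl
        have h6 : (N₁.updateRow (Fin.last j) (p ᵥ* B)).det = 0 := by
          rw [h5, det_permute, h4, mul_zero]
        rw [det_updateRow_vecMul (t := j)] at h6
        · exact (hN₁u.mul_left_eq_zero).1 h6
        · intro i
          rfl
        · intro i hi
          rcases lt_or_gt_of_ne hi with h' | h'
          · rw [Fin.lt_def] at h'
            exact Or.inr ⟨⟨i, by omega⟩, fun h => by
              have := congrArg Fin.val h
              simp only [Fin.val_last] at this
              omega, fun t => rfl⟩
          · exact Or.inl (ihj i h')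
    ext i j
    induction i using Fin.cases with
    | zero =>
      induction j using Fin.cases with
      | zero => rw [h0, one_apply_eq]
      | succ j => rw [one_apply_ne (Fin.succ_ne_zero j).symm]; exact hp0 j
    | succ i =>
      induction j using Fin.cases with
      | zero => rw [hcol, one_apply_ne (Fin.succ_ne_zero i)]
      | succ j =>
        have := congr_fun (congr_fun hIH i) j
        rw [submatrix_apply] at this
        rw [this]
        simp only [one_apply, Fin.succ_inj]

end Unipotent

/-! ### Invariance of minors -/

section Invariance

variable {R : Type*} [CommRing R] {n : ℕ}

theorem IsLowerUni.map {ι S : Type*} [LinearOrder ι] [CommRing S] {N : Matrix ι ι R}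
    (hN : IsLowerUni N) (σ : R →+* S) : IsLowerUni (N.map σ) :=
  ⟨fun i j h => by rw [map_apply, hN.zero i j h, map_zero],
    fun i => by rw [map_apply, hN.one, map_one]⟩

/-- The selected columns form a final segment in X and in Y, so lower unitriangular mixing does not
change the minor. -/
theorem trailMinor_mul (X Y : Matrix (Fin n) (Fin n) R) {N : Matrix (Fin n) (Fin n) R}
    (hN : IsLowerUni N) {k l : ℕ} (h : k + l ≤ n) :
    trailMinor (X * N) (Y * N) h = trailMinor X Y h := by
  have hW : fromCols (X * N) (Y * N) = fromCols X Y * fromBlocks N 0 0 N := by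
    rw [fromCols_mul_fromBlocks, Matrix.mul_zero, Matrix.mul_zero, add_zero, zero_add]
  rw [trailMinor, hW, det_submatrix_mul _ _ _ (fCol_injective h),
    IsLowerUni.det (N := (fromBlocks N 0 0 N).submatrix (fCol h) (fCol h)), mul_one]
  · rfl
  · refine ⟨fun i j hij => ?_, fun i => ?_⟩
    · rw [Fin.lt_def] at hij
      rw [submatrix_apply, fCol, fCol]
      split_ifs
      · exact hN.zero _ _ (by rw [Fin.lt_def]; simp only; omega)
      · rfl
      · rfl
      · exact hN.zero _ _ (by rw [Fin.lt_def]; simp only; omega)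
    · rw [submatrix_apply, fCol]
      split_ifs
      · exact hN.one _
      · exact hN.one _
  · intro j hj t
    rw [fCol]
    rcases j with j | j <;> split_ifs with ht
    · refine hN.zero _ _ (lt_of_not_ge fun hge => hj ⟨⟨j + k - n, ?_⟩, ?_⟩)
      · rw [Fin.le_def] at hge
        simp only at hge
        omega
      · rw [Fin.le_def] at hge
        simp only at hge
        rw [fCol, dif_pos (by simp only; omega)]
        exact congrArg Sum.inl (Fin.ext (by simp only; omega))
    · rfl
    · rfl
    · refine hN.zero _ _ (lt_of_not_ge fun hge => hj ⟨⟨k + (j + l - n), ?_⟩, ?_⟩)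
      · rw [Fin.le_def] at hge
        simp only at hge
        omega
      · rw [Fin.le_def] at hge
        simp only at hge
        rw [fCol, dif_neg (by simp only; omega)]
        exact congrArg Sum.inr (Fin.ext (by simp only; omega))

theorem colMinor_mul (A : Matrix (Fin n) (Fin n) R) {N : Matrix (Fin n) (Fin n) R}
    (hN : IsLowerUni N) {i d : ℕ} (h : i + d ≤ n) : colMinor (A * N) h = colMinor A h := by
  rw [colMinor, det_submatrix_mul _ _ _ _ _, IsLowerUni.det (N := N.submatrix _ _), mul_one]
  · rfl
  · refine ⟨fun i j hij => hN.zero _ _ ?_, fun i => hN.one _⟩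
    rw [Fin.lt_def] at hij ⊢
    simp only
    omega
  · intro s t hst
    have := congrArg Fin.val hst
    simp only at this
    exact Fin.ext (by omega)
  · intro j hj t
    refine hN.zero _ _ (lt_of_not_ge fun hge => hj ⟨⟨j + d - n, ?_⟩, Fin.ext ?_⟩) <;>
    · rw [Fin.le_def] at hge
      simp only at hge ⊢
      omega

theorem trailMinor_map {S : Type*} [CommRing S] (σ : R →+* S) (X Y : Matrix (Fin n) (Fin n) R)
    {k l : ℕ} (h : k + l ≤ n) :
    trailMinor (σ.mapMatrix X) (σ.mapMatrix Y) h = σ (trailMinor X Y h) := by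
  rw [trailMinor, trailMinor, RingHom.map_det]
  congr 1
  ext s t
  change fromCols (σ.mapMatrix X) (σ.mapMatrix Y) (fRow h s) (fCol h t) =
    σ (fromCols X Y (fRow h s) (fCol h t))
  rcases fCol h t with j | j <;> rfl

theorem colMinor_map {S : Type*} [CommRing S] (σ : R →+* S) (A : Matrix (Fin n) (Fin n) R)
    {i d : ℕ} (h : i + d ≤ n) : colMinor (σ.mapMatrix A) h = σ (colMinor A h) := by
  rw [colMinor, colMinor, RingHom.map_det]
  rfl

theorem det_eq_of_cast {a b : ℕ} (e : a = b) {A : Matrix (Fin a) (Fin a) R}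
    {B : Matrix (Fin b) (Fin b) R} (h : ∀ s t, A s t = B (Fin.cast e s) (Fin.cast e t)) :
    A.det = B.det := by
  subst e
  exact congrArg Matrix.det (Matrix.ext h)

end Invariance

/-! ### The minors in terms of the family, boundary cases included. -/

section Values

theorem trailMinor_matX_matY {k l : ℕ} (h : k + l ≤ n) :
    trailMinor (matX n) (matY n) h = fFun n k l := (fFun_eq h).symm

theorem colMinor_matY {i d : ℕ} (h : i + d ≤ n) (hd : 1 ≤ d) :
    colMinor (matY n) h = hFun n (i + 1) (n - d + 1) := by
  rw [colMinor, hFun_eq (by omega)]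
  refine det_eq_of_cast (by omega) fun s t => ?_
  rw [submatrix_apply, submatrix_apply]
  congr 1

theorem colMinor_transpose_matX {i d : ℕ} (h : i + d ≤ n) (hd : 1 ≤ d) :
    colMinor (matX n)ᵀ h = gFun n (n - d + 1) (i + 1) := by
  rw [colMinor, gFun_eq (by omega), ← det_transpose]
  refine det_eq_of_cast (by omega) fun s t => ?_
  rw [transpose_apply, submatrix_apply, submatrix_apply, transpose_apply]
  congr 1

theorem fFun_zero_left {l : ℕ} (h : l ≤ n) (hl : 1 ≤ l) :
    fFun n 0 l = hFun n (n - l + 1) (n - l + 1) := by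
  rw [fFun, hFun]
  exact det_eq_of_cast (by omega) fun s t => by simp

theorem fFun_zero_right {k : ℕ} (h : k ≤ n) (hk : 1 ≤ k) :
    fFun n k 0 = gFun n (n - k + 1) (n - k + 1) := by
  rw [fFun, gFun]
  exact det_eq_of_cast (by omega) fun s t => by simp

theorem fFun_eq_det_matX : fFun n n 0 = (matX n).det := by
  rw [← trailMinor_matX_matY (by omega), trailMinor_eq_mixCol _ _ (by omega)]
  congr 1
  ext s t
  rw [submatrix_apply, mixCol, dif_pos t.2]
  exact congrArg (matX n s) (Fin.ext (by simp))

theorem fFun_eq_det_matY : fFun n 0 n = (matY n).det := by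
  rw [← trailMinor_matX_matY (by omega), trailMinor_eq_mixCol _ _ (by omega)]
  congr 1

/-- X sends columns of 1 and U to columns of X and Y. So the maximal trailing minors, not listed
among the f_{kl}, are supplied by the φ_{kl} with k + l = n. -/
theorem fFun_eq_det_phiMat {m k l : ℕ} (h : k + l = m + 1) :
    fFun (m + 1) k l = (matX (m + 1)).det * (phiMat (matU (m + 1)) h.le).det := by
  rw [← trailMinor_matX_matY h.le, trailMinor_eq_mixCol _ _ h, ← det_mul]
  congr 1
  have hU : matX (m + 1) * matU (m + 1) = matY (m + 1) := by
    rw [matU, ← Matrix.mul_assoc, mul_nonsing_inv _ (isUnit_det_matX _), Matrix.one_mul]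
  ext s t
  rw [submatrix_apply, mixCol]
  have hmul (B : RatMat (m + 1)) (c : Fin (m + 1))
      (hB : ∀ i, phiMat (matU (m + 1)) h.le i t = B i c) :
      (matX (m + 1) * phiMat (matU (m + 1)) h.le) s t = (matX (m + 1) * B) s c := by
    rw [mul_apply, mul_apply]
    exact Finset.sum_congr rfl fun i _ => by rw [hB]
  split_ifs with ht
  · rw [hmul 1 ⟨m + 1 - k + t, by omega⟩, Matrix.mul_one]
    · rfl
    · intro i
      simp only [phiMat, of_apply, phiExp, phiCol, if_pos ht, pow_zero]
  · rw [hmul (matU (m + 1)) t, hU]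
    · rfl
    · intro i
      have ht' : (t : ℕ) < k + l := by omega
      simp only [phiMat, of_apply, phiExp, phiCol, if_neg ht, if_pos ht', pow_one]
      exact congrArg (matU (m + 1) i) (Fin.ext (by simp only; omega))

/-- Supplies det Φ_{0,1}, which has no φ of its own, as det U · det Φ_{1,1}. -/
theorem phiMat_zero_one {R : Type*} [CommRing R] {m : ℕ}
    (A : Matrix (Fin (m + 2)) (Fin (m + 2)) R) :
    phiMat A (k := 0) (l := 1) (by omega) = A * phiMat A (k := 1) (l := 1) (by omega) := by
  ext s t
  have h1 : phiExp 0 1 t = phiExp 1 1 t + 1 := by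
    simp only [phiExp]
    split_ifs <;> omega
  have h2 : phiCol (m := m + 1) (k := 0) (l := 1) (by omega) t = Fin.last _ :=
    Fin.ext (by simp only [phiCol, Fin.val_last]; split_ifs <;> omega)
  have h3 : phiCol (m := m + 1) (k := 1) (l := 1) (by omega) t = Fin.last _ :=
    Fin.ext (by simp only [phiCol, Fin.val_last]; split_ifs <;> omega)
  rw [mul_apply]
  simp only [phiMat, of_apply, h1, h2, h3]
  rw [pow_succ', mul_apply]

end Values

/-! ### Subfields that contain the family -/

section Subfield

variable {m : ℕ} {E : Subfield (RatFun (m + 1))} (hE : ∀ a, family (m + 1) a ∈ E)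
include hE

theorem mem_of_sign_mul_mem {s : ℤ} {x : RatFun (m + 1)} (hs : (s : RatFun (m + 1)) ≠ 0)
    (h : (s : RatFun (m + 1)) * x ∈ E) : x ∈ E := by
  have := E.mul_mem (E.inv_mem (intCast_mem E s)) h
  rwa [inv_mul_cancel_left₀ hs] at this

theorem det_matX_mem : (matX (m + 1)).det ∈ E := by
  rw [← fFun_eq_det_matX, fFun_zero_right le_rfl (by omega)]
  exact hE (.g _ _ (by omega))

theorem det_matY_mem : (matY (m + 1)).det ∈ E := by
  rw [← fFun_eq_det_matY, fFun_zero_left le_rfl (by omega)]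
  exact hE (.h _ _ (by omega))

theorem det_matU_mem : (matU (m + 1)).det ∈ E := by
  have h := isUnit_det_matX (m + 1)
  have h1 : (matX (m + 1)).det * (matU (m + 1)).det = (matY (m + 1)).det := by
    rw [← det_mul, matU, ← Matrix.mul_assoc, mul_nonsing_inv _ h, Matrix.one_mul]
  rw [← inv_mul_cancel_left₀ h.ne_zero (matU (m + 1)).det, h1]
  exact E.mul_mem (E.inv_mem (det_matX_mem hE)) (det_matY_mem hE)

theorem det_phiMat_matU_mem {k l : ℕ} (hk : 1 ≤ k) (hl : 1 ≤ l) (h : k + l ≤ m + 1) :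
    (phiMat (matU (m + 1)) h).det ∈ E := by
  have h1 : phiFun (m + 1) k l ∈ E := hE (.phi k l ⟨hk, hl, h⟩)
  have h2 := pow_ne_zero (m + 1 - k - l + 1) (isUnit_det_matX (m + 1)).ne_zero
  rw [phiFun_eq h, mul_assoc] at h1
  have h3 := E.mul_mem (E.inv_mem (pow_mem (det_matX_mem hE) (m + 1 - k - l + 1)))
    (mem_of_sign_mul_mem hE (signPhi_ne_zero k l) h1)
  rwa [inv_mul_cancel_left₀ h2] at h3

theorem det_phiMat_matU_one_mem {k : ℕ} (h : k + 1 ≤ m + 1) :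
    (phiMat (matU (m + 1)) h).det ∈ E := by
  rcases Nat.eq_zero_or_pos k with rfl | hk
  · cases m with
    | zero =>
      have : phiMat (matU 1) h = matU 1 := by
        ext s t
        rw [Fin.eq_zero t]
        simp only [phiMat, of_apply, phiExp]
        rw [if_neg (by simp), if_pos (by simp), pow_one]
        congr 1
      rw [this]
      exact det_matU_mem hE
    | succ m =>
      rw [phiMat_zero_one, det_mul]
      exact E.mul_mem (det_matU_mem hE) (det_phiMat_matU_mem hE le_rfl le_rfl (by omega))
  · exact det_phiMat_matU_mem hE hk le_rfl h

theorem fFun_mem {k l : ℕ} (h : k + l ≤ m + 1) : fFun (m + 1) k l ∈ E := by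
  rcases Nat.eq_zero_or_pos k with rfl | hk
  · rcases Nat.eq_zero_or_pos l with rfl | hl
    · have : IsEmpty (Fin (0 + 0)) := Fin.isEmpty
      rw [fFun, det_isEmpty]
      exact E.one_mem
    · rw [fFun_zero_left (by omega) hl]
      exact hE (.h _ _ (by omega))
  · rcases Nat.eq_zero_or_pos l with rfl | hl
    · rw [fFun_zero_right (by omega) hk]
      exact hE (.g _ _ (by omega))
    · rcases h.lt_or_eq with h' | h'
      · exact hE (.f k l (by omega))
      · rw [fFun_eq_det_phiMat h']
        exact E.mul_mem (det_matX_mem hE) (det_phiMat_matU_mem hE hk hl _)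

theorem colMinor_matY_mem {i d : ℕ} (h : i + d ≤ m + 1) : colMinor (matY (m + 1)) h ∈ E := by
  rcases Nat.eq_zero_or_pos d with rfl | hd
  · rw [colMinor, det_isEmpty]
    exact E.one_mem
  · rw [colMinor_matY h hd]
    exact hE (.h _ _ (by omega))

theorem colMinor_transpose_matX_mem {i d : ℕ} (h : i + d ≤ m + 1) :
    colMinor (matX (m + 1))ᵀ h ∈ E := by
  rcases Nat.eq_zero_or_pos d with rfl | hd
  · rw [colMinor, det_isEmpty]
    exact E.one_mem
  · rw [colMinor_transpose_matX h hd]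
    exact hE (.g _ _ (by omega))

theorem coeff_det_pencil_mem (i : ℕ) : (pencil (matX (m + 1)) (matY (m + 1))).det.coeff i ∈ E := by
  have hp : pencil (matX (m + 1)) (matY (m + 1)) =
      (Polynomial.X : Polynomial (RatFun (m + 1))) • (matY (m + 1)).map Polynomial.C +
        (matX (m + 1)).map Polynomial.C := add_comm _ _
  rcases Nat.eq_zero_or_pos i with rfl | hi
  · rw [hp, Polynomial.coeff_det_X_add_C_zero]
    exact det_matX_mem hE
  rcases lt_trichotomy i (m + 1) with h | h | h
  · have h1 : cFun (m + 1) i ∈ E := hE (.c i ⟨hi, h⟩)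
    rw [cFun_eq] at h1
    refine mem_of_sign_mul_mem hE (s := (-1) ^ (i * (m + 1 - 1))) ?_ (by exact_mod_cast h1)
    simp
  · have := Polynomial.coeff_det_X_add_C_card (matY (m + 1)) (matX (m + 1))
    rw [Fintype.card_fin] at this
    rw [hp, h, this]
    exact det_matY_mem hE
  · rw [Polynomial.coeff_eq_zero_of_natDegree_lt]
    · exact E.zero_mem
    · rw [hp]
      refine lt_of_le_of_lt (Polynomial.natDegree_det_X_add_C_le _ _) ?_
      rwa [Fintype.card_fin]

variable {N N' : RatMat (m + 1)} (hN : IsNormalizer N N')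
include hN

/-- det Φ_{k,1} is, up to sign, the product of the `hessT p` for p ≤ P; quotients of consecutive
products isolate each of them. -/
theorem hessT_mem {P : ℕ} (hP : P ≤ m + 1) : hessT (N' * matU (m + 1) * N) P ∈ E := by
  have hprod (P : ℕ) (hP : P ≤ m + 1) :
      ∏ p : Fin P, hessT (N' * matU (m + 1) * N) (p + 1) ∈ E := by
    rcases Nat.eq_zero_or_pos P with rfl | hP0
    · rw [Finset.univ_eq_empty, Finset.prod_empty]
      exact E.one_mem
    · obtain ⟨ε, hε⟩ := exists_psi_eq hN (P := P) (a := 0) (k := m + 1 - P) (by omega) hP0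
      have h1 := det_phiMat_matU_one_mem hE (k := m + 1 - P) (by omega)
      rw [hε, muFun, det_isEmpty, mul_one] at h1
      exact mem_of_sign_mul_mem hE (by simp) h1
  have hne (p : ℕ) : hessT (N' * matU (m + 1) * N) p ≠ 0 :=
    Finset.prod_ne_zero_iff.2 fun j _ => hN.hessB_ne_zero j
  rcases Nat.eq_zero_or_pos P with rfl | hP0
  · rw [hessT_zero]
    exact E.one_mem
  · obtain ⟨q, rfl⟩ : ∃ q, P = q + 1 := ⟨P - 1, by omega⟩
    have h1 := hprod (q + 1) hP
    rw [Fin.prod_univ_castSucc] at h1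
    have h2 := E.mul_mem (E.inv_mem (hprod q (by omega))) h1
    simp only [Fin.val_castSucc, Fin.val_last] at h2
    rwa [inv_mul_cancel_left₀ (Finset.prod_ne_zero_iff.2 fun p _ => hne _)] at h2

theorem hessB_mem (j : Fin (m + 1)) : hessB (N' * matU (m + 1) * N) j ∈ E := by
  have hne : hessT (N' * matU (m + 1) * N) j ≠ 0 :=
    Finset.prod_ne_zero_iff.2 fun j _ => hN.hessB_ne_zero j
  have h1 := E.mul_mem (hessT_mem hE hN (P := j + 1) (by omega))
    (E.inv_mem (hessT_mem hE hN (P := j) (by omega)))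
  rwa [hessT_succ, mul_inv_cancel_right₀ hne] at h1

theorem muFun_mem {P a k : ℕ} (h : P + (a + k) = m + 1) (hP : 1 ≤ P) (hk : 1 ≤ k) :
    muFun (N' * matU (m + 1) * N) h hP ∈ E := by
  obtain ⟨ε, hε⟩ := exists_psi_eq hN h hP
  have h1 := det_phiMat_matU_mem hE (k := k) (l := a + 1) hk (by omega) (by omega)
  rw [hε] at h1
  have h2 := mem_of_sign_mul_mem hE (by simp) h1
  have h3 : ∏ p : Fin P, hessT (N' * matU (m + 1) * N) (p + 1) ∈ E :=
    prod_mem fun p _ => hessT_mem hE hN (by omega)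
  have hne : ∏ p : Fin P, hessT (N' * matU (m + 1) * N) (p + 1) ≠ 0 :=
    Finset.prod_ne_zero_iff.2 fun p _ => Finset.prod_ne_zero_iff.2 fun j _ => hN.hessB_ne_zero j
  have h4 := E.mul_mem (E.inv_mem h3) h2
  rwa [inv_mul_cancel_left₀ hne] at h4

theorem coeff_det_pencil_one_mem (i : ℕ) :
    (pencil 1 (N' * matU (m + 1) * N)).det.coeff i ∈ E := by
  have hX := isUnit_det_matX (m + 1)
  -- Since det N = 1, this makes det(1 + λH) equal to det(X + λY) / det X.
  have h1 : (matX (m + 1) * N).map Polynomial.C * pencil 1 (N' * matU (m + 1) * N) =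
      pencil (matX (m + 1)) (matY (m + 1)) * N.map Polynomial.C := by
    have e : matX (m + 1) * N * (N' * matU (m + 1) * N) = matY (m + 1) * N := by
      rw [← Matrix.mul_assoc, ← Matrix.mul_assoc, Matrix.mul_assoc (matX _), hN.mul,
        Matrix.mul_one, matU, ← Matrix.mul_assoc, mul_nonsing_inv _ hX, Matrix.one_mul]
    rw [pencil, pencil, Matrix.mul_add, Matrix.add_mul, Matrix.mul_smul, smul_mul,
      ← Matrix.map_mul, ← Matrix.map_mul, ← Matrix.map_mul, ← Matrix.map_mul, e, Matrix.mul_one]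
  have h2 := congrArg Matrix.det h1
  have hC (A : RatMat (m + 1)) : (A.map Polynomial.C).det = Polynomial.C A.det := by
    rw [← RingHom.mapMatrix_apply, ← RingHom.map_det]
  rw [det_mul, det_mul, hC, hC, det_mul, hN.lower.det, mul_one, map_one, mul_one] at h2
  have h3 := coeff_det_pencil_mem hE i
  rw [← h2, Polynomial.coeff_C_mul] at h3
  have h4 := E.mul_mem (E.inv_mem (det_matX_mem hE)) h3
  rwa [inv_mul_cancel_left₀ hX.ne_zero] at h4

end Subfield

/-! ### The family generates the field of rational functions -/

section Generation

variable {m : ℕ} {R : Type*} [CommRing R] [Nontrivial R] {σ τ : RatFun (m + 1) →+* R}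
  (hE : ∀ a, family (m + 1) a ∈ σ.eqLocusField τ)
include hE

theorem mapMatrix_hess_eq {N N' : RatMat (m + 1)} (hN : IsNormalizer N N') :
    σ.mapMatrix (N' * matU (m + 1) * N) = τ.mapMatrix (N' * matU (m + 1) * N) := by
  set H := N' * matU (m + 1) * N with hH
  have hσ : IsHess (σ.mapMatrix H) := hN.hess.map (map_zero σ)
  have hτ : IsHess (τ.mapMatrix H) := hN.hess.map (map_zero τ)
  have hdet (ρ : RatFun (m + 1) →+* R) (P a : ℕ) (hP : 1 ≤ P) (h : P + a ≤ m) :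
      ((ρ.mapMatrix H).submatrix (muRow (P := P) (a := a) (by omega)) (muCol (by omega))).det =
        ρ (muFun H (P := P) (a := a) (k := m + 1 - P - a) (by omega) hP) := by
    rw [muFun, RingHom.map_det]
    rfl
  refine hσ.eq_of_det_pencil (fun j => ?_) (hσ.eq_of_minors hτ (fun j => hessB_mem hE hN j)
    (fun P a hP h => ?_) fun P a hP h => ?_) ?_
  · have := hN.hessB_ne_zero j.succ
    rw [hessB_succ] at this
    exact (IsUnit.mk0 _ this).map σ
  · rw [hdet σ P a hP h, hdet τ P a hP h]
    exact muFun_mem hE hN (by omega) hP (by omega)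
  · rw [hdet σ P a hP h]
    exact (IsUnit.mk0 _ (muFun_ne_zero hN _ _)).map σ
  · have hp (ρ : RatFun (m + 1) →+* R) : (pencil 1 (ρ.mapMatrix H)).det =
        (pencil 1 H).det.map ρ := by
      rw [← Polynomial.coe_mapRingHom, RingHom.map_det]
      congr 1
      refine Matrix.ext fun i j => ?_
      change pencil 1 (ρ.mapMatrix H) i j = (pencil 1 H i j).map ρ
      rw [pencil_apply, pencil_apply, one_apply, one_apply]
      split_ifs <;> simp
    ext i
    rw [hp, hp, Polynomial.coeff_map, Polynomial.coeff_map]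
    exact coeff_det_pencil_one_mem hE hN i

/-- The two images of XN and YN differ by one left factor Q, because the images of H agree. The
f-type minors make Q upper unitriangular, the h make it 1, and the g then remove the ambiguity in N.
-/
theorem mapMatrix_matX_matY_eq : σ.mapMatrix (matX (m + 1)) = τ.mapMatrix (matX (m + 1)) ∧
    σ.mapMatrix (matY (m + 1)) = τ.mapMatrix (matY (m + 1)) := by
  obtain ⟨N, N', hN⟩ := exists_isNormalizer m
  have hX := isUnit_det_matX (m + 1)
  set X := matX (m + 1)
  set Y := matY (m + 1)
  set H := N' * matU (m + 1) * N with hH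
  set S := σ.mapMatrix (m := Fin (m + 1))
  set T := τ.mapMatrix (m := Fin (m + 1))
  have hST : S H = T H := mapMatrix_hess_eq hE hN
  have hXH : X * N * H = Y * N := by
    rw [hH, ← Matrix.mul_assoc, ← Matrix.mul_assoc, Matrix.mul_assoc X, hN.mul, Matrix.mul_one,
      matU, ← Matrix.mul_assoc, mul_nonsing_inv _ hX, Matrix.one_mul]
  have hSXN : IsUnit (S (X * N)).det := by
    rw [← RingHom.map_det, det_mul, hN.lower.det, mul_one]
    exact hX.map σ
  have hSN : IsLowerUni (S N) := hN.lower.map σ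
  have hTN : IsLowerUni (T N) := hN.lower.map τ
  set Q := T (X * N) * (S (X * N))⁻¹ with hQ
  have hQX : Q * S (X * N) = T (X * N) := by
    rw [hQ, Matrix.mul_assoc, nonsing_inv_mul _ hSXN, Matrix.mul_one]
  have hQY : Q * S (Y * N) = T (Y * N) := by
    have h1 : Q * (S (X * N) * S H) = T (X * N) * T H := by rw [← Matrix.mul_assoc, hQX, hST]
    rwa [← map_mul, ← map_mul, hXH] at h1
  have htrail (ρ : RatFun (m + 1) →+* R) {k l : ℕ} (h : k + l ≤ m + 1) :
      trailMinor (ρ.mapMatrix (X * N)) (ρ.mapMatrix (Y * N)) h = ρ (fFun (m + 1) k l) := by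
    rw [trailMinor_map, trailMinor_mul _ _ hN.lower, trailMinor_matX_matY]
  have hQuni : IsLowerUni Qᵀ := by
    refine isLowerUni_transpose_of_trailMinor (S (X * N)) (S (Y * N)) Q (fun k l h => ?_)
      fun k l h => ?_
    · rw [hQX, hQY, htrail σ h, htrail τ h]
      exact (fFun_mem hE h).symm
    · rw [htrail σ h]
      exact (IsUnit.mk0 _ (fFun_ne_zero h)).map σ
  have hcolne (A : RatMat (m + 1)) {i d : ℕ} (h : i + d ≤ m + 1)
      (hA : 1 ≤ d → colMinor A h ≠ 0) : IsUnit (colMinor (S A) h) := by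
    rw [colMinor_map]
    refine (IsUnit.mk0 _ ?_).map σ
    rcases Nat.eq_zero_or_pos d with rfl | hd
    · rw [colMinor, det_isEmpty]
      exact one_ne_zero
    · exact hA hd
  have hcolY (ρ : RatFun (m + 1) →+* R) {i d : ℕ} (h : i + d ≤ m + 1) :
      colMinor (ρ.mapMatrix (Y * N)) h = ρ (colMinor Y h) := by
    rw [colMinor_map, colMinor_mul _ hN.lower]
  have hQ1 : Q = 1 := by
    refine eq_one_of_colMinor (S (Y * N)) Q hQuni (fun i d h => ?_) fun i d h => ?_
    · rw [hQY, hcolY σ h, hcolY τ h]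
      exact (colMinor_matY_mem hE h).symm
    · refine hcolne _ h fun hd => ?_
      rw [colMinor_mul _ hN.lower, colMinor_matY h hd]
      exact hFun_ne_zero (by omega)
  have hXN : S X * S N = T X * T N := by
    rw [← map_mul, ← map_mul, ← hQX, hQ1, Matrix.one_mul]
  have hYN : S Y * S N = T Y * T N := by
    rw [← map_mul, ← map_mul, ← hQY, hQ1, Matrix.one_mul]
  have hTNN : T N * T N' = 1 := by rw [← map_mul, hN.mul, map_one]
  have hSNN : S N * S N' = 1 := by rw [← map_mul, hN.mul, map_one]
  have hZX : S X * (S N * T N') = T X := by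
    rw [← Matrix.mul_assoc, hXN, Matrix.mul_assoc, hTNN, Matrix.mul_one]
  have hTN' : IsLowerUni (T N') := hTN.of_mul_eq_one hTNN
  -- Transposing turns the minors g of X into minors on the last columns.
  have hZ : (S N * T N')ᵀ = 1 := by
    refine eq_one_of_colMinor (S X)ᵀ _ ?_ (fun i d h => ?_) fun i d h => ?_
    · rw [transpose_transpose]
      have h1 := lower_mul hSN.zero hTN'.zero
      exact ⟨h1.1, fun i => by rw [h1.2, hSN.one, hTN'.one, mul_one]⟩
    · rw [← transpose_mul, hZX]
      exact (colMinor_map τ Xᵀ h).trans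
        ((colMinor_transpose_matX_mem hE h).symm.trans (colMinor_map σ Xᵀ h).symm)
    · refine hcolne Xᵀ h fun hd => ?_
      rw [colMinor_transpose_matX h hd]
      exact gFun_ne_zero (by omega)
  have hNN : S N * T N' = 1 := by rw [← transpose_transpose (S N * T N'), hZ, transpose_one]
  have hSTN : S N = T N := by
    have := congrArg (· * T N) hNN
    simpa only [Matrix.mul_assoc, ← map_mul, hN.mul', map_one, Matrix.mul_one,
      Matrix.one_mul] using this
  refine ⟨by rw [← hZX, hNN, Matrix.mul_one], ?_⟩
  have := congrArg (· * S N') hYN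
  simpa only [Matrix.mul_assoc, ← hSTN, hSNN, Matrix.mul_one] using this

theorem map_coordFun_eq (v : Coord (m + 1)) : σ (coordFun v) = τ (coordFun v) := by
  obtain ⟨h1, h2⟩ := mapMatrix_matX_matY_eq hE
  rcases v with ⟨i, j⟩ | ⟨i, j⟩
  · exact congr_fun (congr_fun h1 i) j
  · exact congr_fun (congr_fun h2 i) j

end Generation

/-- Faithfully flat descent: the test pair is formed by the two inclusions of K into K ⊗_L K, whose
equalizer is L. -/
theorem mem_range_algebraMap_of_forall_ringHom.{u, v} {L : Type v} {K : Type u} [Field L] [Field K]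
    [Algebra L K] {x : K} (h : ∀ (R : Type u) [CommRing R] [Nontrivial R] (σ τ : K →+* R),
      (∀ y, σ (algebraMap L K y) = τ (algebraMap L K y)) → σ x = τ x) :
    x ∈ Set.range (algebraMap L K) := by
  have heff : Algebra.IsEffective L K := .of_faithfullyFlat _ _
  rw [← heff.eqLocus_includeLeft_includeRight]
  exact h (TensorProduct L K K) Algebra.TensorProduct.includeLeftRingHom
    (Algebra.TensorProduct.includeRight (R := L) (A := K)).toRingHom
    Algebra.TensorProduct.tmul_one_eq_one_tmul

theorem adjoin_family {n : ℕ} (hn : 1 ≤ n) :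
    IntermediateField.adjoin ℂ (Set.range (family n)) = ⊤ := by
  obtain ⟨m, rfl⟩ : ∃ m, n = m + 1 := ⟨n - 1, by omega⟩
  set L := IntermediateField.adjoin ℂ (Set.range (family (m + 1))) with hL
  have hc (v : Coord (m + 1)) : coordFun v ∈ L := by
    obtain ⟨y, hy⟩ := mem_range_algebraMap_of_forall_ringHom (L := L) (x := coordFun v)
      fun R _ _ σ τ h => map_coordFun_eq
        (fun a => h ⟨_, IntermediateField.subset_adjoin ℂ _ ⟨a, rfl⟩⟩) v
    exact hy ▸ y.2
  have hp (p : PolyRing (m + 1)) : algebraMap (PolyRing (m + 1)) (RatFun (m + 1)) p ∈ L := by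
    induction p using MvPolynomial.induction_on with
    | C a => exact L.algebraMap_mem a
    | add p q hp hq => rw [map_add]; exact L.add_mem hp hq
    | mul_X p v hp => rw [map_mul]; exact L.mul_mem hp (hc v)
  refine top_unique fun x _ => ?_
  obtain ⟨p, q, _, rfl⟩ := IsFractionRing.div_surjective (A := PolyRing (m + 1)) x
  exact L.div_mem (hp p) (hp q)

/-! ### Algebraic independence -/

section Count

/-- The functions of the family are as many as the coordinates. -/
def labelEquiv (n : ℕ) : Label n ≃ Coord n where
  toFun
    -- In the x-square, g fills the diagonal and below, φ the part above; in the y-square, h fills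
    -- the diagonal and above, c the subdiagonal, f the rest.
    | .g i j _ => Sum.inl (⟨i - 1, by omega⟩, ⟨j - 1, by omega⟩)
    | .h i j _ => Sum.inr (⟨i - 1, by omega⟩, ⟨j - 1, by omega⟩)
    | .f k l _ => Sum.inr (⟨k + l, by omega⟩, ⟨k - 1, by omega⟩)
    | .phi k l _ => Sum.inl (⟨k - 1, by omega⟩, ⟨k + l - 1, by omega⟩)
    | .c i _ => Sum.inr (⟨i, by omega⟩, ⟨i - 1, by omega⟩)
  invFun
    | Sum.inl (i, j) => if h : (j : ℕ) ≤ i then .g (i + 1) (j + 1) (by omega)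
        else .phi (i + 1) (j - i) (by omega)
    | Sum.inr (i, j) => if h : (i : ℕ) ≤ j then .h (i + 1) (j + 1) (by omega)
        else if h' : (i : ℕ) = j + 1 then .c (j + 1) (by omega)
        else .f (j + 1) (i - j - 1) (by omega)
  left_inv a := by
    rcases a with ⟨i, j, h⟩ | ⟨i, j, h⟩ | ⟨k, l, h⟩ | ⟨k, l, h⟩ | ⟨i, h⟩
    · simp only
      rw [dif_pos (by omega), Label.g.injEq]
      omega
    · simp only
      rw [dif_pos (by omega), Label.h.injEq]
      omega
    · simp only
      rw [dif_neg (by omega), dif_neg (by omega), Label.f.injEq]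
      omega
    · simp only
      rw [dif_neg (by omega), Label.phi.injEq]
      omega
    · simp only
      rw [dif_neg (by omega), dif_pos (by omega), Label.c.injEq]
      omega
  right_inv v := by
    rcases v with ⟨i, j⟩ | ⟨i, j⟩
    · simp only
      split_ifs with h <;> simp only [Sum.inl.injEq, Prod.mk.injEq, Fin.ext_iff] <;> omega
    · simp only
      split_ifs with h h' <;> simp only [Sum.inr.injEq, Prod.mk.injEq, Fin.ext_iff] <;> omega

theorem card_label (n : ℕ) : Nat.card (Label n) = 2 * n ^ 2 := by
  rw [Nat.card_congr (labelEquiv n), Nat.card_eq_fintype_card, Fintype.card_sum, Fintype.card_prod,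
    Fintype.card_fin]
  ring

theorem algebraicIndependent_coordFun : AlgebraicIndependent ℂ (coordFun (n := n)) := by
  have h : (MvPolynomial.aeval (R := ℂ) (coordFun (n := n))) =
      IsScalarTower.toAlgHom ℂ (PolyRing n) (RatFun n) := by
    apply MvPolynomial.algHom_ext
    intro v
    rw [MvPolynomial.aeval_X]
    rfl
  rw [AlgebraicIndependent, h]
  exact IsFractionRing.injective (PolyRing n) (RatFun n)

/-- A finite family over which the field is algebraic, with no more members than the transcendence
degree, is a transcendence basis. -/
theorem algebraicIndependent_family (hn : 1 ≤ n) : AlgebraicIndependent ℂ (family n) := by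
  have : Finite (Label n) := Finite.of_equiv _ (labelEquiv n).symm
  have halg : Algebra.IsAlgebraic (Algebra.adjoin ℂ (Set.range (family n))) (RatFun n) := by
    refine ⟨fun x => ?_⟩
    have hx : x ∈ IntermediateField.adjoin ℂ (Set.range (family n)) := by
      rw [adjoin_family hn]
      trivial
    obtain ⟨a, ha, b, hb, rfl⟩ := IntermediateField.mem_adjoin_iff_div.1 hx
    rw [div_eq_mul_inv]
    exact (isAlgebraic_algebraMap (⟨a, ha⟩ : Algebra.adjoin ℂ (Set.range (family n)))).mul
      (isAlgebraic_algebraMap (⟨b, hb⟩ : Algebra.adjoin ℂ (Set.range (family n)))).inv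
  refine (Algebra.IsAlgebraic.isTranscendenceBasis_of_le_trdeg_of_finite ℂ (family n) ?_).1
  rw [Cardinal.mk_congr (labelEquiv n)]
  exact algebraicIndependent_coordFun.cardinalMk_le_trdeg

end Count

end DrinfeldDouble

/-- The family `F_n` consists of `2n²` functions, it is a system of coordinates on `D(GL_n)` (it is
algebraically independent and generates the field of rational functions), and it is log-canonical:
`{F_a, F_b} = ω_{ab} F_a F_b` with constants `ω_{ab}` in `½ℤ`. -/
theorem mainTheorem3 (n : ℕ) (hn : 1 ≤ n) :
    Nat.card (DrinfeldDouble.Label n) = 2 * n ^ 2 ∧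
    AlgebraicIndependent ℂ (DrinfeldDouble.family n) ∧
    IntermediateField.adjoin ℂ (Set.range (DrinfeldDouble.family n)) = ⊤ ∧
    ∃ ω : DrinfeldDouble.Label n → DrinfeldDouble.Label n → ℤ,
      ∀ a b : DrinfeldDouble.Label n,
        DrinfeldDouble.bracket (DrinfeldDouble.family n a) (DrinfeldDouble.family n b) =
          ((ω a b : DrinfeldDouble.RatFun n) / 2) *
            DrinfeldDouble.family n a * DrinfeldDouble.family n b := by
  refine ⟨DrinfeldDouble.card_label n, DrinfeldDouble.algebraicIndependent_family hn,
    DrinfeldDouble.adjoin_family hn, ?_⟩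
  choose ω hω using fun a b => DrinfeldDouble.logC_family hn a b
  exact ⟨ω, hω⟩
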